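/- **Setting.** Let $\mathcal L$ be a twisted affine Lie superalgebra over $\mathbb C$ of type $A(2k,2\ell-1)^{(2)}$, $A(2k-1,2\ell-1)^{(2)}$ (with $k\ge 1$ and $(k,\ell)\neq(1,1)$), $A(2k,2\ell)^{(4)}$ or $D(k+1,\ell)^{(2)}$, where $k\ge 0$ and $\ell\ge 1$; that is, $\mathcal L=\bigoplus_{p\in\mathbb Z}(\mathfrak g^{[p]}\otimes t^p)\oplus\mathbb Cc\oplus\mathbb Cd$, where $\mathfrak g$ is the basic classical simple Lie superalgebra of the indicated finite type with its invariant form $\kappa$, $\sigma$ is the standard diagram automorphism of $\mathfrak g$ of order $n$ (the upper index), $\zeta$ is a primitive $n$-th root of unity, $\mathfrak g^{[p]}=\{x:\sigma(x)=\zeta^p x\}$, and $$[x\otimes t^p+rc+sd,\;y\otimes t^q+r'c+s'd]=[x,y]\otimes t^{p+q}+p\,\kappa(x,y)\delta_{p+q,0}c+sq\,y\otimes t^q-s'p\,x\otimes t^p .$$ Let $\mathfrak h$ be its standard Cartan subalgebra (the diagonal part of $\mathfrak g^{[0]}$ plus $\mathbb Cc\oplus\mathbb Cd$), $(\cdot,\cdot)$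 the induced form on $\mathfrak h^*$, $\epsilon_i$ $(1\le i\le k)$, $\delta_j$ $(1\le j\le\ell)$ and $\delta$ the usual functionals on $\mathfrak h$ (with $\delta(d)=1$), and $R=\{\alpha\in\mathfrak h^*:\mathcal L^\alpha\ne0\}$ the root system, so that $0\in R$. Put $$R_{re}^\times=\{\alpha\in R:(\alpha,\alpha)\ne0\},\quad R_{re}=\{0\}\cup R_{re}^\times,\quad R_{im}=\{\alpha\in R:(\alpha,R)=0\}.$$ Let $R_0(1)$ and $R_0(2)$ be the following sets, where always $i\ne r$, $j\ne s$, and $R_0(2)=\emptyset$ if $k=0$. * $A(2k,2\ell-1)^{(2)}$: $R_0(1)=a\mathbb Z\delta\cup(\mathbb Z\delta\pm\{\delta_j\pm\delta_s\})\cup(2\mathbb Z\delta\pm\{2\delta_j\})$ with $a=2$ if $\ell=1$ and $a=1$ otherwise; $R_0(2)=\mathbb Z\delta\cup(\mathbb Z\delta\pm\{\epsilon_i,\epsilon_i\pm\epsilon_r\})\cup((2\mathbb Z+1)\delta\pm\{2\epsilon_i\})$. * $A(2k-1,2\ell-1)^{(2)}$: $R_0(1)$ as in the previous case; $R_0(2)=b\mathbb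 Z\delta\cup(\mathbb Z\delta\pm\{\epsilon_i\pm\epsilon_r\})\cup((2\mathbb Z+1)\delta\pm\{2\epsilon_i\})$ with $b=2$ if $k=1$ and $b=1$ otherwise. * $A(2k,2\ell)^{(4)}$: $R_0(1)=2\mathbb Z\delta\cup((2\mathbb Z+1)\delta\pm\{\delta_j\})\cup(2\mathbb Z\delta\pm\{\delta_j\pm\delta_s\})\cup(4\mathbb Z\delta\pm\{2\delta_j\})$; $R_0(2)=2\mathbb Z\delta\cup(2\mathbb Z\delta\pm\{\epsilon_i,\epsilon_i\pm\epsilon_r\})\cup((4\mathbb Z+2)\delta\pm\{2\epsilon_i\})$. * $D(k+1,\ell)^{(2)}$: $R_0(1)=2\mathbb Z\delta\cup(2\mathbb Z\delta\pm\{\delta_j\pm\delta_s,2\delta_j\})$; $R_0(2)=\mathbb Z\delta\cup(\mathbb Z\delta\pm\{\epsilon_i\})\cup(2\mathbb Z\delta\pm\{\epsilon_i\pm\epsilon_r\})$. (These are the root systems of the affine components of the even part of $\mathcal L$.) Let $\dot R$ be the finite set of all $\dot\alpha$ in the $\mathbb Z$-span of the $\epsilon_i$ and $\delta_j$ with $(\dot\alpha+\mathbb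 Z\delta)\cap R\neq\emptyset$, and $\dot R_0(i)=\{\dot\alpha\in\dot R:(\dot\alpha+\mathbb Z\delta)\cap R_0(i)\ne\emptyset\}$. Let $M$ be a weight $\mathcal L$-module, i.e. $M=\bigoplus_{\lambda\in\mathfrak h^*}M^\lambda$, with support $\operatorname{supp}(M)=\{\lambda:M^\lambda\neq0\}$. Let $R^{in}$ (resp. $R^{ln}$) be the set of $\alpha\in R_{re}^\times$ for which the nonzero elements of $\mathcal L^\alpha$ act injectively (resp. locally nilpotently) on $M$. Let $\mathfrak B_M$ be the set of $\alpha\in\operatorname{span}_{\mathbb Z}R$ such that $\{m\in\mathbb Z^{>0}:\lambda+m\alpha\in\operatorname{supp}(M)\}$ is finite for every $\lambda\in\operatorname{supp}(M)$, and $\mathfrak C_M$ the set of $\alpha\in\operatorname{span}_{\mathbb Z}R$ with $\alpha+\operatorname{supp}(M)\subseteq\operatorname{supp}(M)$. The module $M$ *has shadow* if $R_{re}^\times=R^{in}\cup R^{ln}$, $R^{ln}=\mathfrak B_M\cap R_{re}^\times$ and $R^{in}=\mathfrak C_M\cap R_{re}^\times$. A root $\alpha\in R_{re}^\times$ is *full-locally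 nilpotent* (resp. *full-injective*) if $(\alpha+\mathbb Z\delta)\cap R\subseteq R^{ln}$ (resp. $\subseteq R^{in}$), and *hybrid* otherwise; the corresponding sets are $R_{f\text{-}ln}$, $R_{f\text{-}in}$, $R_{hyb}$. For subsets $P,S$ of an abelian group with $P\subseteq S$, $P$ is *closed* in $S$ if $(P+P)\cap S\subseteq P$, and *parabolic* in $S$ if moreover $P\cup-P=S$. **Proposition.** Let $M$ be a weight $\mathcal L$-module having shadow, with $R_{hyb}\ne R_{re}^\times$. Suppose that for each $i\in\{1,2\}$ with $R_0(i)\neq\emptyset$ the set $R^{ln}\cap R_0(i)$ is nonempty and is a proper subset of $R_0(i)\cap R_{re}^\times$. Put $$P=R_{f\text{-}ln}\cup-R_{f\text{-}in}\cup R_{hyb}\cup\mathbb Z\delta .$$ 1. $P$ is a closed subset of $R_{re}\cup R_{im}$ with $P\cup-P=R_{re}\cup R_{im}$; and for each $i$ with $R_0(i)\ne\emptyset$, $P_i=P\cap R_0(i)$ is a parabolic subset of $R_0(i)$. 2. For each $i$ with $R_0(i)\neq\emptyset$, $\dot P_i=\{\dot\alpha\in\dot R_0(i):\exists m\in\mathbb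 Z,\ \dot\alpha+m\delta\in P_i\}$ is a parabolic subset of $\dot R_0(i)$, and $P_i=(\dot P_i+\mathbb Z\delta)\cap R_0(i)$. Moreover, for at least one $i$ with $R_0(i)\neq\emptyset$, $\dot P_i$ is a proper subset of $\dot R_0(i)$. -/

import Mathlib

noncomputable section

/-- The sign `(-1)^{ab}` for parities `a`, `b`. -/
def superSign (a b : ZMod 2) : ℂ := if a = 1 ∧ b = 1 then -1 else 1

/-- The structure of a complex Lie superalgebra on a complex vector space `V`;
`homog 0` and `homog 1` are the even and the odd part. -/
structure LieSuperalgebra (V : Type*) [AddCommGroup V] [Module ℂ V] where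
  homog : ZMod 2 → Submodule ℂ V
  isCompl : IsCompl (homog 0) (homog 1)
  br : V →ₗ[ℂ] V →ₗ[ℂ] V
  br_mem : ∀ {a b : ZMod 2} {x y : V}, x ∈ homog a → y ∈ homog b → br x y ∈ homog (a + b)
  skew : ∀ {a b : ZMod 2} {x y : V}, x ∈ homog a → y ∈ homog b →
    br x y = -(superSign a b • br y x)
  jacobi : ∀ {a b c : ZMod 2} {x y z : V}, x ∈ homog a → y ∈ homog b → z ∈ homog c →
    br x (br y z) = br (br x y) z + superSign a b • br y (br x z)

namespace LieSuperalgebra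

variable {V : Type*} [AddCommGroup V] [Module ℂ V]

theorem exists_decomp (A : LieSuperalgebra V) (x : V) :
    ∃ y ∈ A.homog 0, ∃ z ∈ A.homog 1, x = y + z := by
  have h : x ∈ A.homog 0 ⊔ A.homog 1 := by rw [A.isCompl.sup_eq_top]; trivial
  obtain ⟨y, hy, z, hz, h⟩ := Submodule.mem_sup.1 h
  exact ⟨y, hy, z, hz, h.symm⟩

/-- A subspace is graded if it contains the even and odd components of its elements. -/
def IsGraded (A : LieSuperalgebra V) (N : Submodule ℂ V) : Prop :=
  ∀ x ∈ N, ∃ y ∈ A.homog 0, ∃ z ∈ A.homog 1, y ∈ N ∧ z ∈ N ∧ x = y + z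

theorem IsGraded.mem {A : LieSuperalgebra V} {N : Submodule ℂ V} (h : A.IsGraded N) {y z : V}
    (hy : y ∈ A.homog 0) (hz : z ∈ A.homog 1) (hN : y + z ∈ N) : y ∈ N ∧ z ∈ N := by
  obtain ⟨y', hy', z', hz', hyN, hzN, e⟩ := h _ hN
  have h1 : y - y' = z' - z := by
    have : y - y' - (z' - z) = (y + z) - (y' + z') := by abel
    rw [e, sub_self] at this
    exact sub_eq_zero.1 this
  have h2 : y - y' ∈ A.homog 0 ⊓ A.homog 1 :=
    ⟨sub_mem hy hy', h1 ▸ sub_mem hz' hz⟩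
  rw [A.isCompl.inf_eq_bot, Submodule.mem_bot] at h2
  rw [h2] at h1
  rw [sub_eq_zero.1 h2, ← sub_eq_zero.1 h1.symm]
  exact ⟨hyN, hzN⟩

/-- A graded subalgebra of a Lie superalgebra. -/
def sub (A : LieSuperalgebra V) (N : Submodule ℂ V) (hg : A.IsGraded N)
    (hN : ∀ x ∈ N, ∀ y ∈ N, A.br x y ∈ N) : LieSuperalgebra N where
  homog a := (A.homog a).comap N.subtype
  isCompl := by
    refine IsCompl.of_eq ?_ ?_
    · rw [← Submodule.comap_inf, A.isCompl.inf_eq_bot]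
      simp
    · rw [eq_top_iff]
      rintro ⟨x, hx⟩ -
      obtain ⟨y, hy, z, hz, hyN, hzN, e⟩ := hg x hx
      exact Submodule.mem_sup.2 ⟨⟨y, hyN⟩, hy, ⟨z, hzN⟩, hz, Subtype.ext e.symm⟩
  br := LinearMap.mk₂ ℂ (fun x y => ⟨A.br x y, hN _ x.2 _ y.2⟩)
    (by intros; ext; simp) (by intros; ext; simp) (by intros; ext; simp) (by intros; ext; simp)
  br_mem := fun hx hy => A.br_mem hx hy
  skew := fun hx hy => Subtype.ext (A.skew hx hy)
  jacobi := fun hx hy hz => Subtype.ext (A.jacobi hx hy hz)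

theorem sub_br (A : LieSuperalgebra V) (N : Submodule ℂ V) (hg : A.IsGraded N)
    (hN : ∀ x ∈ N, ∀ y ∈ N, A.br x y ∈ N) (x y : N) :
    (((A.sub N hg hN).br x y : N) : V) = A.br x y := rfl

/-- The bracket of the quotient by a two-sided ideal. -/
def quotBr (A : LieSuperalgebra V) (I : Submodule ℂ V)
    (hl : ∀ x, ∀ y ∈ I, A.br x y ∈ I) (hr : ∀ x ∈ I, ∀ y, A.br x y ∈ I) :
    (V ⧸ I) →ₗ[ℂ] (V ⧸ I) →ₗ[ℂ] (V ⧸ I) :=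
  I.liftQ ((Submodule.mapQLinear I I).comp
      (A.br.codRestrict (Submodule.compatibleMaps I I) (fun x y hy => hl x y hy))) (by
    intro x hx
    rw [LinearMap.mem_ker]
    ext y
    exact (Submodule.Quotient.mk_eq_zero I).2 (hr x hx y))

theorem quotBr_mk (A : LieSuperalgebra V) (I : Submodule ℂ V)
    (hl : ∀ x, ∀ y ∈ I, A.br x y ∈ I) (hr : ∀ x ∈ I, ∀ y, A.br x y ∈ I) (x y : V) :
    A.quotBr I hl hr (I.mkQ x) (I.mkQ y) = I.mkQ (A.br x y) := rfl

/-- The quotient of a Lie superalgebra by a graded ideal. -/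
def quot (A : LieSuperalgebra V) (I : Submodule ℂ V) (hg : A.IsGraded I)
    (hl : ∀ x, ∀ y ∈ I, A.br x y ∈ I) (hr : ∀ x ∈ I, ∀ y, A.br x y ∈ I) :
    LieSuperalgebra (V ⧸ I) where
  homog a := (A.homog a).map I.mkQ
  isCompl := by
    refine IsCompl.of_eq ?_ ?_
    · rw [eq_bot_iff]
      rintro x ⟨⟨y, hy, rfl⟩, ⟨z, hz, hyz⟩⟩
      have h : y + (-z) ∈ I := by
        rw [← Submodule.Quotient.mk_eq_zero I, ← Submodule.mkQ_apply, map_add, map_neg, hyz]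
        simp
      exact (Submodule.Quotient.mk_eq_zero I).2 (hg.mem hy (neg_mem hz) h).1
    · rw [← Submodule.map_sup, A.isCompl.sup_eq_top, Submodule.map_top, Submodule.range_mkQ]
  br := A.quotBr I hl hr
  br_mem := by
    rintro a b _ _ ⟨x, hx, rfl⟩ ⟨y, hy, rfl⟩
    exact ⟨_, A.br_mem hx hy, rfl⟩
  skew := by
    rintro a b _ _ ⟨x, hx, rfl⟩ ⟨y, hy, rfl⟩
    simp only [quotBr_mk]
    rw [A.skew hx hy]
    simp
  jacobi := by
    rintro a b c _ _ _ ⟨x, hx, rfl⟩ ⟨y, hy, rfl⟩ ⟨z, hz, rfl⟩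
    simp only [quotBr_mk]
    rw [A.jacobi hx hy hz]
    simp

/-- An even, supersymmetric, invariant bilinear form. -/
structure InvForm (A : LieSuperalgebra V) where
  form : V →ₗ[ℂ] V →ₗ[ℂ] ℂ
  even : ∀ {a b : ZMod 2} {x y : V}, x ∈ A.homog a → y ∈ A.homog b → a ≠ b → form x y = 0
  symm : ∀ {a b : ZMod 2} {x y : V}, x ∈ A.homog a → y ∈ A.homog b →
    form x y = superSign a b • form y x
  inv : ∀ x y z : V, form (A.br x y) z = form x (A.br y z)

/-- A parity preserving endomorphism. -/
structure EvenEnd (A : LieSuperalgebra V) where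
  map : V →ₗ[ℂ] V
  map_br : ∀ x y : V, map (A.br x y) = A.br (map x) (map y)
  map_homog : ∀ (a : ZMod 2) (x : V), x ∈ A.homog a → map x ∈ A.homog a

/-- The eigenspace `{x | σ x = ζ ^ p x}`. -/
def EvenEnd.eigen {A : LieSuperalgebra V} (σ : A.EvenEnd) (ζ : ℂ) (p : ℤ) : Submodule ℂ V where
  carrier := {x | σ.map x = ζ ^ p • x}
  add_mem' := by
    intro x y hx hy
    simp only [Set.mem_ofPred_eq] at *
    rw [map_add, hx, hy, smul_add]
  zero_mem' := by simp
  smul_mem' := by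
    intro c x hx
    simp only [Set.mem_ofPred_eq] at *
    rw [map_smul, hx, smul_comm]

/-! ### Affinization -/

/-- The bracket `[x ⊗ t^p, y ⊗ t^q] = [x, y] ⊗ t^{p+q}` of the loop superalgebra; a loop
`∑ x_p ⊗ t^p` is the finitely supported function `p ↦ x_p`. -/
def loopBr (A : LieSuperalgebra V) : (ℤ →₀ V) →ₗ[ℂ] (ℤ →₀ V) →ₗ[ℂ] (ℤ →₀ V) :=
  Finsupp.lsum ℂ fun p =>
    (Finsupp.lsum ℂ fun q => (A.br.compr₂ (Finsupp.lsingle (p + q))).flip).flip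

/-- The cocycle `(x ⊗ t^p, y ⊗ t^q) ↦ p κ(x, y) δ_{p+q,0}`. -/
def InvForm.cocycle {A : LieSuperalgebra V} (κ : A.InvForm) :
    (ℤ →₀ V) →ₗ[ℂ] (ℤ →₀ V) →ₗ[ℂ] ℂ :=
  Finsupp.lsum ℂ fun p => (p : ℂ) • κ.form.compl₂ (Finsupp.lapply (-p))

/-- The form `(x ⊗ t^p, y ⊗ t^q) ↦ κ(x, y) δ_{p+q,0}`. -/
def InvForm.loopForm {A : LieSuperalgebra V} (κ : A.InvForm) :
    (ℤ →₀ V) →ₗ[ℂ] (ℤ →₀ V) →ₗ[ℂ] ℂ :=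
  Finsupp.lsum ℂ fun p => κ.form.compl₂ (Finsupp.lapply (-p))

/-- The degree derivation `x ⊗ t^p ↦ p x ⊗ t^p`. -/
def loopDeg (V : Type*) [AddCommGroup V] [Module ℂ V] : (ℤ →₀ V) →ₗ[ℂ] (ℤ →₀ V) :=
  Finsupp.lsum ℂ fun p => (p : ℂ) • Finsupp.lsingle p

theorem loopBr_single (A : LieSuperalgebra V) (p q : ℤ) (x y : V) :
    A.loopBr (Finsupp.single p x) (Finsupp.single q y) = Finsupp.single (p + q) (A.br x y) := by
  simp [loopBr]

theorem loopDeg_single (p : ℤ) (x : V) :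
    loopDeg V (Finsupp.single p x) = (p : ℂ) • Finsupp.single p x := by
  simp [loopDeg]

theorem cocycle_single {A : LieSuperalgebra V} (κ : A.InvForm) (p q : ℤ) (x y : V) :
    κ.cocycle (Finsupp.single p x) (Finsupp.single q y) =
      if p + q = 0 then (p : ℂ) * κ.form x y else 0 := by
  by_cases h : p + q = 0
  · have : q = -p := by omega
    subst this
    simp [InvForm.cocycle]
  · have : q ≠ -p := by omega
    simp [InvForm.cocycle, h, this]

theorem loopForm_single {A : LieSuperalgebra V} (κ : A.InvForm) (p q : ℤ) (x y : V) :
    κ.loopForm (Finsupp.single p x) (Finsupp.single q y) =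
      if p + q = 0 then κ.form x y else 0 := by
  by_cases h : p + q = 0
  · have : q = -p := by omega
    subst this
    simp [InvForm.loopForm]
  · have : q ≠ -p := by omega
    simp [InvForm.loopForm, h, this]

/-- Loops all of whose coefficients lie in `W`. -/
def loopsIn (W : Submodule ℂ V) : Submodule ℂ (ℤ →₀ V) where
  carrier := {x | ∀ p, x p ∈ W}
  add_mem' := fun hx hy p => W.add_mem (hx p) (hy p)
  zero_mem' := fun _ => W.zero_mem
  smul_mem' := fun c _ hx p => W.smul_mem c (hx p)

theorem loop_induction {W : ℤ → Submodule ℂ V}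
    {Q : (x : ℤ →₀ V) → (∀ p, x p ∈ W p) → Prop} (h0 : Q 0 (fun p => zero_mem (W p)))
    (hadd : ∀ x y hx hy, Q x hx → Q y hy → Q (x + y) (fun p => add_mem (hx p) (hy p)))
    (hs : ∀ p, ∀ x, (hx : x ∈ W p) → ∀ h, Q (Finsupp.single p x) h)
    (x : ℤ →₀ V) (hx : ∀ p, x p ∈ W p) : Q x hx := by
  have key : ∃ h, Q x h := by
    have hsum : ∃ h, Q (x.sum Finsupp.single) h := by
      rw [Finsupp.sum]
      refine Finset.sum_induction _ (fun y => ∃ h, Q y h) ?_ ⟨_, h0⟩ ?_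
      · rintro y z ⟨h, hy⟩ ⟨h', hz⟩
        exact ⟨_, hadd y z h h' hy hz⟩
      · intro p _
        have hp : ∀ q, Finsupp.single p (x p) q ∈ W q := by
          intro q
          rw [Finsupp.single_apply]
          split_ifs with h
          · subst h; exact hx p
          · exact zero_mem _
        exact ⟨hp, hs p _ (hx p) hp⟩
    rwa [Finsupp.sum_single x] at hsum
  exact key.2

theorem loopBr_mem (A : LieSuperalgebra V) {W₁ W₂ W₃ : ℤ → Submodule ℂ V}
    (hW : ∀ p q, ∀ x ∈ W₁ p, ∀ y ∈ W₂ q, A.br x y ∈ W₃ (p + q)) {x y : ℤ →₀ V}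
    (hx : ∀ p, x p ∈ W₁ p) (hy : ∀ p, y p ∈ W₂ p) (r : ℤ) : A.loopBr x y r ∈ W₃ r := by
  induction x, hx using loop_induction with
  | h0 => simp
  | hadd x x' _ _ h h' => simpa using add_mem h h'
  | hs p x hx _ =>
    induction y, hy using loop_induction with
    | h0 => simp
    | hadd x x' _ _ h h' => simpa using add_mem h h'
    | hs q y hy _ =>
      rw [loopBr_single, Finsupp.single_apply]
      split_ifs with h
      · exact h ▸ hW p q x hx y hy
      · exact zero_mem _

theorem loopDeg_apply (x : ℤ →₀ V) (p : ℤ) : loopDeg V x p = (p : ℂ) • x p := by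
  induction x using Finsupp.induction_linear with
  | zero => simp
  | add x y hx hy => simp [hx, hy]
  | single q x =>
    rw [loopDeg_single]
    by_cases h : q = p
    · subst h; simp
    · simp [h]

theorem loop_skew (A : LieSuperalgebra V) {a b : ZMod 2} {x y : ℤ →₀ V}
    (hx : ∀ p, x p ∈ A.homog a) (hy : ∀ p, y p ∈ A.homog b) :
    A.loopBr x y = -(superSign a b • A.loopBr y x) := by
  induction x, hx using loop_induction with
  | h0 => simp
  | hadd x x' _ _ h h' => simp only [map_add, LinearMap.add_apply, h, h', smul_add]; abel
  | hs p x hx _ =>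
    induction y, hy using loop_induction with
    | h0 => simp
    | hadd x x' _ _ h h' => simp only [map_add, LinearMap.add_apply, h, h', smul_add]; abel
    | hs q y hy _ => rw [loopBr_single, loopBr_single, A.skew hx hy, add_comm q p]; simp

theorem loop_jacobi (A : LieSuperalgebra V) {a b c : ZMod 2} {x y z : ℤ →₀ V}
    (hx : ∀ p, x p ∈ A.homog a) (hy : ∀ p, y p ∈ A.homog b) (hz : ∀ p, z p ∈ A.homog c) :
    A.loopBr x (A.loopBr y z) =
      A.loopBr (A.loopBr x y) z + superSign a b • A.loopBr y (A.loopBr x z) := by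
  induction x, hx using loop_induction with
  | h0 => simp
  | hadd x x' _ _ h h' => simp only [map_add, LinearMap.add_apply, h, h', smul_add]; abel
  | hs p x hx _ =>
    induction y, hy using loop_induction with
    | h0 => simp
    | hadd x x' _ _ h h' => simp only [map_add, LinearMap.add_apply, h, h', smul_add]; abel
    | hs q y hy _ =>
      induction z, hz using loop_induction with
      | h0 => simp
      | hadd x x' _ _ h h' => simp only [map_add, h, h', smul_add]; abel
      | hs r z hz _ =>
        simp only [loopBr_single]
        rw [A.jacobi hx hy hz, Finsupp.single_add, ← Finsupp.smul_single, add_assoc,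
          add_left_comm q p r]

theorem loopDeg_br (A : LieSuperalgebra V) (x y : ℤ →₀ V) :
    loopDeg V (A.loopBr x y) = A.loopBr (loopDeg V x) y + A.loopBr x (loopDeg V y) := by
  induction x using Finsupp.induction_linear with
  | zero => simp
  | add x x' h h' => simp only [map_add, LinearMap.add_apply, h, h']; abel
  | single p x =>
    induction y using Finsupp.induction_linear with
    | zero => simp
    | add x x' h h' => simp only [map_add, h, h']; abel
    | single q y =>
      simp only [loopBr_single, loopDeg_single, map_smul, LinearMap.smul_apply]
      push_cast
      rw [add_smul]

theorem cocycle_deg {A : LieSuperalgebra V} (κ : A.InvForm) (x y : ℤ →₀ V) :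
    κ.cocycle (loopDeg V x) y + κ.cocycle x (loopDeg V y) = 0 := by
  induction x using Finsupp.induction_linear with
  | zero => simp
  | add x x' h h' =>
    simp only [map_add, LinearMap.add_apply]
    linear_combination h + h'
  | single p x =>
    induction y using Finsupp.induction_linear with
    | zero => simp
    | add x x' h h' =>
      simp only [map_add]
      linear_combination h + h'
    | single q y =>
      simp only [loopDeg_single, map_smul, LinearMap.smul_apply, cocycle_single]
      split_ifs with h
      · have : q = -p := by omega
        subst this
        simp
      · simp

theorem cocycle_skew {A : LieSuperalgebra V} (κ : A.InvForm) {a b : ZMod 2} {x y : ℤ →₀ V}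
    (hx : ∀ p, x p ∈ A.homog a) (hy : ∀ p, y p ∈ A.homog b) :
    κ.cocycle x y = -(superSign a b * κ.cocycle y x) := by
  induction x, hx using loop_induction with
  | h0 => simp
  | hadd x x' _ _ h h' =>
    simp only [map_add, LinearMap.add_apply]
    linear_combination h + h'
  | hs p x hx _ =>
    induction y, hy using loop_induction with
    | h0 => simp
    | hadd x x' _ _ h h' =>
      simp only [map_add, LinearMap.add_apply]
      linear_combination h + h'
    | hs q y hy _ =>
      rw [cocycle_single, cocycle_single, κ.symm hx hy, add_comm q p]
      split_ifs with h
      · have : q = -p := by omega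
        subst this
        simp only [smul_eq_mul]; push_cast; ring
      · simp

theorem cocycle_even {A : LieSuperalgebra V} (κ : A.InvForm) {a b : ZMod 2} {x y : ℤ →₀ V}
    (hx : ∀ p, x p ∈ A.homog a) (hy : ∀ p, y p ∈ A.homog b) (hab : a ≠ b) :
    κ.cocycle x y = 0 := by
  induction x, hx using loop_induction with
  | h0 => simp
  | hadd x x' _ _ h h' => simp [h, h']
  | hs p x hx _ =>
    induction y, hy using loop_induction with
    | h0 => simp
    | hadd x x' _ _ h h' => simp [h, h']
    | hs q y hy _ => rw [cocycle_single, κ.even hx hy hab]; simp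

theorem superSign_cases (a b : ZMod 2) : superSign a b = 1 ∨ superSign a b = -1 := by
  unfold superSign; split_ifs <;> simp

theorem superSign_comm (a b : ZMod 2) : superSign a b = superSign b a := by
  unfold superSign; simp [and_comm]

theorem superSign_mul_self (a b : ZMod 2) : superSign a b * superSign a b = 1 := by
  rcases superSign_cases a b with h | h <;> simp [h]

theorem superSign_add (a b c : ZMod 2) :
    superSign a (b + c) = superSign a b * superSign a c := by
  have h2 : (1 : ZMod 2) + 1 = 0 := by decide
  have h01 : (0 : ZMod 2) ≠ 1 := by decide
  have key : ∀ d : ZMod 2, d = 0 ∨ d = 1 := by decide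
  rcases key a with rfl | rfl <;> rcases key b with rfl | rfl <;> rcases key c with rfl | rfl <;>
    simp [superSign, h2, h01]

theorem cocycle_jacobi {A : LieSuperalgebra V} (κ : A.InvForm) {a b c : ZMod 2} {x y z : ℤ →₀ V}
    (hx : ∀ p, x p ∈ A.homog a) (hy : ∀ p, y p ∈ A.homog b) (hz : ∀ p, z p ∈ A.homog c) :
    κ.cocycle x (A.loopBr y z) =
      κ.cocycle (A.loopBr x y) z + superSign a b * κ.cocycle y (A.loopBr x z) := by
  induction x, hx using loop_induction with
  | h0 => simp
  | hadd x x' _ _ h h' =>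
    simp only [map_add, LinearMap.add_apply]
    linear_combination h + h'
  | hs p x hx _ =>
    induction y, hy using loop_induction with
    | h0 => simp
    | hadd x x' _ _ h h' =>
      simp only [map_add, LinearMap.add_apply]
      linear_combination h + h'
    | hs q y hy _ =>
      induction z, hz using loop_induction with
      | h0 => simp
      | hadd x x' _ _ h h' =>
        simp only [map_add]
        linear_combination h + h'
      | hs r z hz _ =>
        simp only [loopBr_single, cocycle_single]
        have e1 : κ.form y (A.br x z) = -(superSign a b * κ.form x (A.br y z)) := by
          rw [← κ.inv, A.skew hy hx, ← κ.inv, superSign_comm b a]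
          simp
        rw [e1, κ.inv, add_assoc, add_left_comm q p r]
        split_ifs with h
        · push_cast
          linear_combination ((q : ℂ) * κ.form x (A.br y z)) * superSign_mul_self a b
        · simp

/-- The bracket of the affinization: `(x, r, s)` stands for `x + r c + s d`, and
`[x + r c + s d, y + r' c + s' d] = [x, y] + ω(x, y) c + s (deg y) - s' (deg x)`. -/
def affineBr (A : LieSuperalgebra V) (κ : A.InvForm) :
    ((ℤ →₀ V) × ℂ × ℂ) →ₗ[ℂ] ((ℤ →₀ V) × ℂ × ℂ) →ₗ[ℂ] ((ℤ →₀ V) × ℂ × ℂ) :=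
  LinearMap.mk₂ ℂ (fun u v =>
      (A.loopBr u.1 v.1 + u.2.2 • loopDeg V v.1 - v.2.2 • loopDeg V u.1, κ.cocycle u.1 v.1, 0))
    (by
      intro u u' v
      ext1
      · simp only [Prod.fst_add, Prod.snd_add, map_add, LinearMap.add_apply, add_smul, smul_add]
        abel
      · simp)
    (by
      intro c u v
      ext1
      · simp [smul_add, smul_sub, smul_smul, mul_comm]
      · simp)
    (by
      intro u v v'
      ext1
      · simp only [Prod.fst_add, Prod.snd_add, map_add, add_smul, smul_add]
        abel
      · simp)
    (by
      intro c u v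
      ext1
      · simp [smul_add, smul_sub, smul_smul, mul_comm]
      · simp)

/-- The parity of the affinization; `c` and `d` are even. -/
def affineHomog (A : LieSuperalgebra V) (a : ZMod 2) : Submodule ℂ ((ℤ →₀ V) × ℂ × ℂ) :=
  (loopsIn (A.homog a)).prod (if a = 0 then ⊤ else ⊥)

theorem mem_affineHomog (A : LieSuperalgebra V) {a : ZMod 2} {u : (ℤ →₀ V) × ℂ × ℂ} :
    u ∈ A.affineHomog a ↔ (∀ p, u.1 p ∈ A.homog a) ∧ (a ≠ 0 → u.2 = 0) := by
  unfold affineHomog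
  split_ifs with h
  · simp only [Submodule.mem_prod, h]
    exact ⟨fun H => ⟨H.1, fun h' => (h' rfl).elim⟩, fun H => ⟨H.1, trivial⟩⟩
  · simp only [Submodule.mem_prod, Submodule.mem_bot]
    exact ⟨fun H => ⟨H.1, fun _ => H.2⟩, fun H => ⟨H.1, H.2 h⟩⟩

theorem loop_decomp (A : LieSuperalgebra V) (W : ℤ → Submodule ℂ V) (hW : ∀ p, A.IsGraded (W p))
    {x : ℤ →₀ V} (hx : ∀ p, x p ∈ W p) :
    ∃ y z : ℤ →₀ V, (∀ p, y p ∈ A.homog 0 ⊓ W p) ∧ (∀ p, z p ∈ A.homog 1 ⊓ W p) ∧ x = y + z := by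
  induction x, hx using loop_induction with
  | h0 => exact ⟨0, 0, by simp, by simp, by simp⟩
  | hadd x x' _ _ h h' =>
    obtain ⟨y, z, hy, hz, e⟩ := h
    obtain ⟨y', z', hy', hz', e'⟩ := h'
    exact ⟨y + y', z + z', fun p => add_mem (hy p) (hy' p), fun p => add_mem (hz p) (hz' p),
      by rw [e, e']; abel⟩
  | hs p x hx _ =>
    obtain ⟨y, hy, z, hz, hyW, hzW, e⟩ := hW p x hx
    refine ⟨Finsupp.single p y, Finsupp.single p z, ?_, ?_, by rw [e, Finsupp.single_add]⟩
    · intro q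
      rw [Finsupp.single_apply]
      split_ifs with h
      · subst h; exact ⟨hy, hyW⟩
      · exact zero_mem _
    · intro q
      rw [Finsupp.single_apply]
      split_ifs with h
      · subst h; exact ⟨hz, hzW⟩
      · exact zero_mem _

/-- The (untwisted) affinization `V ⊗ ℂ[t, t⁻¹] ⊕ ℂ c ⊕ ℂ d` of a Lie superalgebra with an
invariant form. -/
def affine (A : LieSuperalgebra V) (κ : A.InvForm) : LieSuperalgebra ((ℤ →₀ V) × ℂ × ℂ) where
  homog := A.affineHomog
  isCompl := by
    refine IsCompl.of_eq ?_ ?_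
    · rw [eq_bot_iff]
      rintro u ⟨h0, h1⟩
      rw [SetLike.mem_coe, mem_affineHomog] at h0 h1
      ext1
      · ext p
        have : u.1 p ∈ A.homog 0 ⊓ A.homog 1 := ⟨h0.1 p, h1.1 p⟩
        rw [A.isCompl.inf_eq_bot, Submodule.mem_bot] at this
        rw [this]; rfl
      · exact h1.2 one_ne_zero
    · rw [eq_top_iff]
      rintro ⟨x, w⟩ -
      obtain ⟨y, z, hy, hz, e⟩ := A.loop_decomp (fun _ => ⊤) (fun _ x _ => by
        obtain ⟨y, hy, z, hz, e⟩ := A.exists_decomp x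
        exact ⟨y, hy, z, hz, trivial, trivial, e⟩) (x := x) (fun _ => trivial)
      refine Submodule.mem_sup.2 ⟨(y, w), ?_, (z, 0), ?_, ?_⟩
      · rw [mem_affineHomog]; exact ⟨fun p => (hy p).1, fun h => (h rfl).elim⟩
      · rw [mem_affineHomog]; exact ⟨fun p => (hz p).1, fun _ => rfl⟩
      · ext1
        · exact e.symm
        · simp
  br := A.affineBr κ
  br_mem := by
    intro a b u v hu hv
    rw [mem_affineHomog] at hu hv ⊢
    have key : ∀ d : ZMod 2, d = 0 ∨ d = 1 := by decide
    constructor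
    · intro p
      have h1 : A.loopBr u.1 v.1 p ∈ A.homog (a + b) :=
        A.loopBr_mem (W₃ := fun _ => A.homog (a + b)) (fun _ _ x hx y hy => A.br_mem hx hy)
          hu.1 hv.1 p
      have h2 : u.2.2 • loopDeg V v.1 p ∈ A.homog (a + b) := by
        rcases key a with rfl | rfl
        · rw [zero_add, loopDeg_apply]
          exact Submodule.smul_mem _ _ (Submodule.smul_mem _ _ (hv.1 p))
        · rw [hu.2 one_ne_zero]; simp
      have h3 : v.2.2 • loopDeg V u.1 p ∈ A.homog (a + b) := by
        rcases key b with rfl | rfl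
        · rw [add_zero, loopDeg_apply]
          exact Submodule.smul_mem _ _ (Submodule.smul_mem _ _ (hu.1 p))
        · rw [hv.2 one_ne_zero]; simp
      exact sub_mem (add_mem h1 h2) h3
    · intro hab
      have hne : a ≠ b := by
        rintro rfl
        exact hab (CharTwo.add_self_eq_zero a)
      ext1
      · exact cocycle_even κ hu.1 hv.1 hne
      · rfl
  skew := by
    intro a b u v hu hv
    rw [mem_affineHomog] at hu hv
    have key : ∀ d : ZMod 2, d = 0 ∨ d = 1 := by decide
    have h01 : (0 : ZMod 2) ≠ 1 := by decide
    ext1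
    · change A.loopBr u.1 v.1 + u.2.2 • loopDeg V v.1 - v.2.2 • loopDeg V u.1 =
        -(superSign a b • (A.loopBr v.1 u.1 + v.2.2 • loopDeg V u.1 - u.2.2 • loopDeg V v.1))
      rw [A.loop_skew hu.1 hv.1]
      rcases key a with rfl | rfl
      · have : superSign 0 b = 1 := by simp [superSign, h01]
        rw [this, one_smul, one_smul]; abel
      · rcases key b with rfl | rfl
        · have : superSign 1 0 = 1 := by simp [superSign, h01]
          rw [this, one_smul, one_smul]; abel
        · rw [hu.2 one_ne_zero, hv.2 one_ne_zero]; simp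
    · ext1
      · exact cocycle_skew κ hu.1 hv.1
      · change (0 : ℂ) = -(superSign a b * 0)
        simp
  jacobi := by
    intro a b c u v w hu hv hw
    rw [mem_affineHomog] at hu hv hw
    have key : ∀ d : ZMod 2, d = 0 ∨ d = 1 := by decide
    have h01 : (0 : ZMod 2) ≠ 1 := by decide
    have hs0 : ∀ b, superSign 0 b = 1 := by intro b; simp [superSign, h01]
    have hs1 : ∀ b, superSign b 0 = 1 := by intro b; simp [superSign, h01]
    obtain ⟨x, r, s⟩ := u
    obtain ⟨y, r', s'⟩ := v
    obtain ⟨z, r'', s''⟩ := w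
    have J := A.loop_jacobi hu.1 hv.1 hw.1
    have K := cocycle_jacobi κ hu.1 hv.1 hw.1
    have Sxy := A.loop_skew hu.1 hv.1
    have Cxy := cocycle_skew κ hu.1 hv.1
    have D1 := A.loopDeg_br x y
    have D2 := A.loopDeg_br y z
    have D3 := A.loopDeg_br x z
    have E1 := cocycle_deg κ x y
    have E2 := cocycle_deg κ y z
    have E3 := cocycle_deg κ x z
    have hs : a ≠ 0 → s = 0 := fun h => congrArg Prod.snd (hu.2 h)
    have hs' : b ≠ 0 → s' = 0 := fun h => congrArg Prod.snd (hv.2 h)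
    have hs'' : c ≠ 0 → s'' = 0 := fun h => congrArg Prod.snd (hw.2 h)
    have t1 : superSign a b • (s : ℂ) = s := by
      rcases key a with rfl | rfl
      · simp [hs0]
      · simp [hs one_ne_zero]
    have t2 : superSign a b • (s' : ℂ) = s' := by
      rcases key b with rfl | rfl
      · simp [hs1]
      · simp [hs' one_ne_zero]
    simp only [smul_eq_mul] at t1 t2
    have Sdxy : A.loopBr (loopDeg V x) y = -(superSign a b • A.loopBr y (loopDeg V x)) :=
      A.loop_skew (fun p => by rw [loopDeg_apply]; exact Submodule.smul_mem _ _ (hu.1 p)) hv.1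
    have Cdxy : κ.cocycle (loopDeg V x) y = -(superSign a b * κ.cocycle y (loopDeg V x)) :=
      cocycle_skew κ (fun p => by rw [loopDeg_apply]; exact Submodule.smul_mem _ _ (hu.1 p)) hv.1
    have q := superSign_mul_self a b
    ext1
    · simp only [affineBr, LinearMap.mk₂_apply, Prod.fst_add, Prod.smul_fst, map_add, map_sub,
        map_smul, LinearMap.add_apply, LinearMap.sub_apply, LinearMap.smul_apply, zero_smul,
        sub_zero, add_zero, D1, D2, D3, J, Sdxy]
      have e1 : superSign a b • s • A.loopBr y (loopDeg V z) = s • A.loopBr y (loopDeg V z) := by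
        rw [smul_smul, t1]
      have e2 : superSign a b • s' • loopDeg V (A.loopBr x z) = s' • loopDeg V (A.loopBr x z) := by
        rw [smul_smul, t2]
      have e3 : superSign a b • s' • s • loopDeg V (loopDeg V z)
          = s' • s • loopDeg V (loopDeg V z) := by
        rw [smul_smul, t2]
      have e4 : superSign a b • s' • s'' • loopDeg V (loopDeg V x)
          = s' • s'' • loopDeg V (loopDeg V x) := by
        rw [smul_smul, t2]
      have e5 : superSign a b • s' • A.loopBr (loopDeg V x) z = s' • A.loopBr (loopDeg V x) z := by
        rw [smul_smul, t2]
      have e6 : superSign a b • s' • A.loopBr x (loopDeg V z) = s' • A.loopBr x (loopDeg V z) := by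
        rw [smul_smul, t2]
      simp only [smul_add, smul_sub, smul_neg, e1, e3, e4, e5, e6]
      rw [smul_comm s s' (loopDeg V (loopDeg V z)), smul_comm s s'' (loopDeg V (loopDeg V y)),
        smul_comm s' s'' (loopDeg V (loopDeg V x)), smul_comm (superSign a b) s'' _]
      abel
    · ext1
      · simp only [affineBr, LinearMap.mk₂_apply, Prod.fst_add, Prod.snd_add, Prod.smul_fst,
          Prod.smul_snd, map_add, map_sub,
          map_smul, LinearMap.add_apply, LinearMap.sub_apply, LinearMap.smul_apply, smul_eq_mul, K]
        linear_combination s' * E3 - s'' * E1 - s * E2 + s'' * Cdxy -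
          κ.cocycle y (loopDeg V z) * t1
      · simp [affineBr]

end LieSuperalgebra
end

set_option linter.unusedSectionVars false

noncomputable section

namespace SuperMatrix

open LieSuperalgebra

variable {E O : Type} [Fintype E] [Fintype O] [DecidableEq E] [DecidableEq O]

/-- The parity of a basis vector of `ℂ^{E|O}`. -/
def par : E ⊕ O → ZMod 2 := Sum.elim (fun _ => 0) (fun _ => 1)

/-- Matrices of parity `a` in `gl(E|O)`. -/
def homog (E O : Type) (a : ZMod 2) : Submodule ℂ (Matrix (E ⊕ O) (E ⊕ O) ℂ) where
  carrier := {x | ∀ i j, par i + par j ≠ a → x i j = 0}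
  add_mem' := fun hx hy i j h => by simp [hx i j h, hy i j h]
  zero_mem' := fun _ _ _ => rfl
  smul_mem' := fun c x hx i j h => by simp [hx i j h]

/-- The odd component of a matrix. -/
def oddPart : Matrix (E ⊕ O) (E ⊕ O) ℂ →ₗ[ℂ] Matrix (E ⊕ O) (E ⊕ O) ℂ where
  toFun x := Matrix.fromBlocks 0 x.toBlocks₁₂ x.toBlocks₂₁ 0
  map_add' x y := by
    ext (i | i) (j | j) <;> simp [Matrix.toBlocks₁₂, Matrix.toBlocks₂₁]
  map_smul' c x := by
    ext (i | i) (j | j) <;> simp [Matrix.toBlocks₁₂, Matrix.toBlocks₂₁]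

/-- The supercommutator: for homogeneous `x`, `y` it is `x y - (-1)^{|x||y|} y x`. -/
def br : Matrix (E ⊕ O) (E ⊕ O) ℂ →ₗ[ℂ] Matrix (E ⊕ O) (E ⊕ O) ℂ →ₗ[ℂ]
    Matrix (E ⊕ O) (E ⊕ O) ℂ :=
  LinearMap.mk₂ ℂ (fun x y => x * y - y * x + (2 : ℂ) • (oddPart y * oddPart x))
    (by intros; simp only [map_add, add_mul, mul_add, smul_add]; abel)
    (by intros; simp only [map_smul, smul_mul_assoc, mul_smul_comm, smul_add, smul_sub,
          smul_comm (2 : ℂ)])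
    (by intros; simp only [map_add, add_mul, mul_add, smul_add]; abel)
    (by intros; simp only [map_smul, smul_mul_assoc, mul_smul_comm, smul_add, smul_sub,
          smul_comm (2 : ℂ)])

theorem par_cases (d : ZMod 2) : d = 0 ∨ d = 1 := by revert d; decide

theorem oddPart_of_even {x : Matrix (E ⊕ O) (E ⊕ O) ℂ} (hx : x ∈ homog E O 0) :
    oddPart x = 0 := by
  ext (i | i) (j | j)
  · rfl
  · exact hx _ _ (by simp [par])
  · exact hx _ _ (by simp [par])
  · rfl

theorem oddPart_of_odd {x : Matrix (E ⊕ O) (E ⊕ O) ℂ} (hx : x ∈ homog E O 1) :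
    oddPart x = x := by
  ext (i | i) (j | j)
  · exact (hx _ _ (by simp [par])).symm
  · rfl
  · rfl
  · exact (hx _ _ (by simp only [par, Sum.elim_inr]; decide)).symm

theorem br_homog {a b : ZMod 2} {x y : Matrix (E ⊕ O) (E ⊕ O) ℂ} (hx : x ∈ homog E O a)
    (hy : y ∈ homog E O b) : br x y = x * y - superSign a b • (y * x) := by
  have h01 : (0 : ZMod 2) ≠ 1 := by decide
  change x * y - y * x + (2 : ℂ) • (oddPart y * oddPart x) = _
  rcases par_cases a with rfl | rfl
  · simp [oddPart_of_even hx, superSign, h01]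
  · rcases par_cases b with rfl | rfl
    · simp [oddPart_of_even hy, superSign, h01]
    · rw [oddPart_of_odd hx, oddPart_of_odd hy, two_smul]
      simp only [superSign, and_self, if_true, neg_smul, one_smul]
      abel

theorem mul_mem {a b : ZMod 2} {x y : Matrix (E ⊕ O) (E ⊕ O) ℂ} (hx : x ∈ homog E O a)
    (hy : y ∈ homog E O b) : x * y ∈ homog E O (a + b) := by
  intro i j hij
  rw [Matrix.mul_apply]
  refine Finset.sum_eq_zero fun l _ => ?_
  by_cases h1 : par i + par l = a
  · by_cases h2 : par l + par j = b
    · refine (hij ?_).elim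
      rw [← h1, ← h2]
      have := CharTwo.add_self_eq_zero (par l)
      linear_combination -this
    · rw [hy _ _ h2, mul_zero]
  · rw [hx _ _ h1, zero_mul]

theorem exists_decomp (x : Matrix (E ⊕ O) (E ⊕ O) ℂ) :
    x - oddPart x ∈ homog E O 0 ∧ oddPart x ∈ homog E O 1 := by
  constructor
  · rintro (i | i) (j | j) h
    · simp [par] at h
    · exact sub_self _
    · exact sub_self _
    · exact (h (by simp only [par, Sum.elim_inr]; decide)).elim
  · rintro (i | i) (j | j) h
    · rfl
    · simp [par] at h
    · simp [par] at h
    · rfl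

/-- The general linear Lie superalgebra `gl(E|O)`. -/
def gl (E O : Type) [Fintype E] [Fintype O] [DecidableEq E] [DecidableEq O] :
    LieSuperalgebra (Matrix (E ⊕ O) (E ⊕ O) ℂ) where
  homog := homog E O
  isCompl := by
    refine IsCompl.of_eq ?_ ?_
    · rw [eq_bot_iff]
      rintro x ⟨h0, h1⟩
      ext i j
      by_cases h : par i + par j = 0
      · exact h1 i j (by rw [h]; decide)
      · exact h0 i j h
    · rw [eq_top_iff]
      rintro x -
      exact Submodule.mem_sup.2 ⟨_, (exists_decomp x).1, _, (exists_decomp x).2, by abel⟩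
  br := br
  br_mem := by
    intro a b x y hx hy
    rw [br_homog hx hy]
    exact sub_mem (mul_mem hx hy) (Submodule.smul_mem _ _ (add_comm b a ▸ mul_mem hy hx))
  skew := by
    intro a b x y hx hy
    rw [br_homog hx hy, br_homog hy hx, superSign_comm b a, smul_sub, smul_smul,
      superSign_mul_self, one_smul]
    abel
  jacobi := by
    intro a b c x y z hx hy hz
    have hyz := sub_mem (mul_mem hy hz)
      (Submodule.smul_mem _ (superSign b c) (add_comm c b ▸ mul_mem hz hy))
    have hxy := sub_mem (mul_mem hx hy)
      (Submodule.smul_mem _ (superSign a b) (add_comm b a ▸ mul_mem hy hx))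
    have hxz := sub_mem (mul_mem hx hz)
      (Submodule.smul_mem _ (superSign a c) (add_comm c a ▸ mul_mem hz hx))
    rw [br_homog hy hz, br_homog hx hy, br_homog hx hz, br_homog hx hyz, br_homog hxy hz,
      br_homog hy hxz, superSign_add, superSign_comm (a + b) c, superSign_add, superSign_add,
      superSign_comm c a, superSign_comm c b, superSign_comm b a]
    rcases superSign_cases a b with h1 | h1 <;> rcases superSign_cases a c with h2 | h2 <;>
      rcases superSign_cases b c with h3 | h3 <;> rw [h1, h2, h3] <;>
      simp only [one_smul, neg_smul, mul_one, mul_neg, neg_neg] <;> noncomm_ring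

/-- The supertrace. -/
def str : Matrix (E ⊕ O) (E ⊕ O) ℂ →ₗ[ℂ] ℂ where
  toFun x := ∑ i, x (Sum.inl i) (Sum.inl i) - ∑ j, x (Sum.inr j) (Sum.inr j)
  map_add' x y := by simp only [Matrix.add_apply, Finset.sum_add_distrib]; ring
  map_smul' c x := by
    simp only [Matrix.smul_apply, smul_eq_mul, RingHom.id_apply, ← Finset.mul_sum]; ring

/-- The sign `(-1)^{|i|}`. -/
def sgn : E ⊕ O → ℂ := Sum.elim (fun _ => 1) (fun _ => -1)

theorem str_eq (x : Matrix (E ⊕ O) (E ⊕ O) ℂ) : str x = ∑ i, sgn i * x i i := by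
  simp [str, sgn, Fintype.sum_sum_type, sub_eq_add_neg]

theorem superSign_par (i j : E ⊕ O) :
    superSign (par i + par j) (par i + par j) = sgn i * sgn j := by
  have h11 : (1 : ZMod 2) + 1 = 0 := by decide
  have h01 : (0 : ZMod 2) ≠ 1 := by decide
  rcases i with i | i <;> rcases j with j | j <;> simp [par, sgn, superSign, h11, h01]

theorem str_mul_even {a b : ZMod 2} {x y : Matrix (E ⊕ O) (E ⊕ O) ℂ} (hx : x ∈ homog E O a)
    (hy : y ∈ homog E O b) (hab : a ≠ b) : str (x * y) = 0 := by
  rw [str_eq]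
  refine Finset.sum_eq_zero fun i _ => ?_
  rw [Matrix.mul_apply, Finset.sum_eq_zero, mul_zero]
  intro l _
  by_cases h1 : par i + par l = a
  · rw [hy l i (by rw [add_comm, h1]; exact hab), mul_zero]
  · rw [hx _ _ h1, zero_mul]

theorem str_mul_comm {a b : ZMod 2} {x y : Matrix (E ⊕ O) (E ⊕ O) ℂ} (hx : x ∈ homog E O a)
    (hy : y ∈ homog E O b) : str (x * y) = superSign a b * str (y * x) := by
  by_cases hab : a = b
  · subst hab
    rw [str_eq, str_eq]
    simp only [Matrix.mul_apply, Finset.mul_sum]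
    rw [Finset.sum_comm]
    refine Finset.sum_congr rfl fun l _ => Finset.sum_congr rfl fun i _ => ?_
    by_cases h : par i + par l = a
    · rw [← h, superSign_par]
      have : sgn l * sgn l = 1 := by rcases l with l | l <;> simp [sgn]
      linear_combination (-(sgn i * x i l * y l i)) * this
    · rw [hx _ _ h]; ring
  · rw [str_mul_even hx hy hab, str_mul_even hy hx (Ne.symm hab), mul_zero]

theorem str_br (x y : Matrix (E ⊕ O) (E ⊕ O) ℂ) : str (br x y) = 0 := by
  have key : ∀ {a b : ZMod 2} {x y : Matrix (E ⊕ O) (E ⊕ O) ℂ}, x ∈ homog E O a →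
      y ∈ homog E O b → str (br x y) = 0 := by
    intro a b x y hx hy
    rw [br_homog hx hy, map_sub, map_smul, str_mul_comm hx hy, smul_eq_mul, sub_self]
  obtain ⟨h0, h1⟩ := exists_decomp x
  obtain ⟨k0, k1⟩ := exists_decomp y
  rw [← sub_add_cancel x (oddPart x), ← sub_add_cancel y (oddPart y)]
  generalize x - oddPart x = x0 at *
  generalize y - oddPart y = y0 at *
  simp only [map_add, LinearMap.add_apply, key h0 k0, key h0 k1, key h1 k0, key h1 k1, add_zero]

theorem str_inv (x y z : Matrix (E ⊕ O) (E ⊕ O) ℂ) : str (br x y * z) = str (x * br y z) := by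
  have key : ∀ {a b c : ZMod 2} {x y z : Matrix (E ⊕ O) (E ⊕ O) ℂ}, x ∈ homog E O a →
      y ∈ homog E O b → z ∈ homog E O c → str (br x y * z) = str (x * br y z) := by
    intro a b c x y z hx hy hz
    have h := str_mul_comm hy (mul_mem hx hz)
    rw [superSign_add, superSign_comm b a] at h
    rw [br_homog hx hy, br_homog hy hz, sub_mul, mul_sub, map_sub, map_sub, smul_mul_assoc,
      mul_smul_comm, map_smul, map_smul, mul_assoc, mul_assoc, h, ← mul_assoc x z y, smul_eq_mul,
      smul_eq_mul]
    linear_combination (-(superSign b c * str (x * z * y))) * superSign_mul_self a b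
  obtain ⟨h0, h1⟩ := exists_decomp x
  obtain ⟨k0, k1⟩ := exists_decomp y
  obtain ⟨l0, l1⟩ := exists_decomp z
  rw [← sub_add_cancel x (oddPart x), ← sub_add_cancel y (oddPart y),
    ← sub_add_cancel z (oddPart z)]
  generalize x - oddPart x = x0 at *
  generalize y - oddPart y = y0 at *
  generalize z - oddPart z = z0 at *
  simp only [map_add, LinearMap.add_apply, add_mul, mul_add, key h0 k0 l0, key h0 k0 l1,
    key h0 k1 l0, key h0 k1 l1, key h1 k0 l0, key h1 k0 l1, key h1 k1 l0, key h1 k1 l1]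

/-- The supertrace form `(x, y) ↦ str (x y)` on `gl(E|O)`. -/
def strForm : (gl E O).InvForm where
  form := LinearMap.mk₂ ℂ (fun x y => str (x * y))
    (by intros; rw [add_mul, map_add]) (by intros; rw [smul_mul_assoc, map_smul])
    (by intros; rw [mul_add, map_add]) (by intros; rw [mul_smul_comm, map_smul])
  even := fun hx hy h => str_mul_even hx hy h
  symm := fun hx hy => str_mul_comm hx hy
  inv := str_inv

/-- The supertranspose. -/
def superT : Matrix (E ⊕ O) (E ⊕ O) ℂ →ₗ[ℂ] Matrix (E ⊕ O) (E ⊕ O) ℂ where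
  toFun x := Matrix.fromBlocks x.toBlocks₁₁.transpose x.toBlocks₂₁.transpose
    (-x.toBlocks₁₂.transpose) x.toBlocks₂₂.transpose
  map_add' x y := by
    ext (i | i) (j | j) <;>
      simp [Matrix.toBlocks₁₂, Matrix.toBlocks₂₁, Matrix.toBlocks₁₁, Matrix.toBlocks₂₂, add_comm]
  map_smul' c x := by
    ext (i | i) (j | j) <;>
      simp [Matrix.toBlocks₁₂, Matrix.toBlocks₂₁, Matrix.toBlocks₁₁, Matrix.toBlocks₂₂]

theorem superT_mem {a : ZMod 2} {x : Matrix (E ⊕ O) (E ⊕ O) ℂ} (hx : x ∈ homog E O a) :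
    superT x ∈ homog E O a := by
  rintro (i | i) (j | j) h
  · exact hx _ _ (by rwa [add_comm] at h)
  · exact hx _ _ (by rwa [add_comm] at h)
  · change -(x (Sum.inl j) (Sum.inr i)) = 0
    rw [hx _ _ (by rwa [add_comm] at h), neg_zero]
  · exact hx _ _ (by rwa [add_comm] at h)

theorem superT_entry (x : Matrix (E ⊕ O) (E ⊕ O) ℂ) (i j : E ⊕ O) :
    superT x i j = superSign (par i) (par i + par j) * x j i := by
  have h11 : (1 : ZMod 2) + 1 = 0 := by decide
  have h01 : (0 : ZMod 2) ≠ 1 := by decide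
  rcases i with i | i <;> rcases j with j | j <;>
    simp [superT, superSign, par, h11, h01, Matrix.toBlocks₁₂, Matrix.toBlocks₂₁,
      Matrix.toBlocks₁₁, Matrix.toBlocks₂₂]

theorem superT_mul {a b : ZMod 2} {x y : Matrix (E ⊕ O) (E ⊕ O) ℂ} (hx : x ∈ homog E O a)
    (hy : y ∈ homog E O b) : superT (x * y) = superSign a b • (superT y * superT x) := by
  have h11 : (1 : ZMod 2) + 1 = 0 := by decide
  have h01 : (0 : ZMod 2) ≠ 1 := by decide
  ext i j
  rw [superT_entry, Matrix.smul_apply, Matrix.mul_apply, Matrix.mul_apply, Finset.mul_sum,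
    smul_eq_mul, Finset.mul_sum]
  refine Finset.sum_congr rfl fun l _ => ?_
  rw [superT_entry, superT_entry]
  by_cases h1 : par j + par l = a
  · by_cases h2 : par l + par i = b
    · rw [← h1, ← h2]
      rcases par_cases (par i) with hi | hi <;> rcases par_cases (par j) with hj | hj <;>
        rcases par_cases (par l) with hl | hl <;> rw [hi, hj, hl] <;>
        simp [superSign, h11, h01, mul_comm]
    · rw [hy _ _ h2]; ring
  · rw [hx _ _ h1]; ring

/-- For an even orthogonal matrix `G` (so `G⁻¹ = Gᵀ`), the automorphism
`x ↦ -G⁻¹ x^{st} G` of `gl(E|O)`, where `x^{st}` is the supertranspose. If `B(v, w) = vᵀ G w`, then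
`B (x v) w = -(-1)^{|x||v|} B v (σ x w)`. -/
def negAdjoint (G : Matrix (E ⊕ O) (E ⊕ O) ℂ) (hG : G ∈ homog E O 0)
    (hGG : G * G.transpose = 1) : (gl E O).EvenEnd where
  map := -((LinearMap.mulLeft ℂ G.transpose).comp ((LinearMap.mulRight ℂ G).comp superT))
  map_br := by
    intro x y
    have hE : ∀ x : Matrix (E ⊕ O) (E ⊕ O) ℂ,
      (-((LinearMap.mulLeft ℂ G.transpose).comp ((LinearMap.mulRight ℂ G).comp superT))) x =
        -(G.transpose * (superT x * G)) := fun _ => rfl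
    have hmem : ∀ {a : ZMod 2} {x : Matrix (E ⊕ O) (E ⊕ O) ℂ}, x ∈ homog E O a →
        (-((LinearMap.mulLeft ℂ G.transpose).comp ((LinearMap.mulRight ℂ G).comp superT))) x ∈
          homog E O a := by
      intro a x hx
      have hGt : G.transpose ∈ homog E O 0 := fun i j h => hG j i (by rwa [add_comm] at h)
      have := mul_mem hGt (mul_mem (superT_mem hx) hG)
      rw [zero_add, add_zero] at this
      exact neg_mem this
    have key : ∀ {a b : ZMod 2} {x y : Matrix (E ⊕ O) (E ⊕ O) ℂ}, x ∈ homog E O a →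
      y ∈ homog E O b →
      (-((LinearMap.mulLeft ℂ G.transpose).comp ((LinearMap.mulRight ℂ G).comp superT))) (br x y) =
      br ((-((LinearMap.mulLeft ℂ G.transpose).comp ((LinearMap.mulRight ℂ G).comp superT))) x)
      ((-((LinearMap.mulLeft ℂ G.transpose).comp ((LinearMap.mulRight ℂ G).comp superT))) y) := by
      intro a b x y hx hy
      rw [br_homog (hmem hx) (hmem hy), br_homog hx hy, hE, hE, hE]
      have e : ∀ u v : Matrix (E ⊕ O) (E ⊕ O) ℂ,
          -(G.transpose * (u * G)) * -(G.transpose * (v * G)) = G.transpose * (u * v * G) := by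
        intro u v
        rw [neg_mul_neg]
        calc G.transpose * (u * G) * (G.transpose * (v * G))
            = G.transpose * (u * (G * G.transpose) * v * G) := by simp only [mul_assoc]
          _ = _ := by rw [hGG, mul_one]
      rw [e, e, map_sub, map_smul, superT_mul hx hy, superT_mul hy hx, superSign_comm b a,
        smul_smul, superSign_mul_self, one_smul, sub_mul, mul_sub, smul_mul_assoc, mul_smul_comm]
      abel
    obtain ⟨h0, h1⟩ := exists_decomp x
    obtain ⟨k0, k1⟩ := exists_decomp y
    change (-((LinearMap.mulLeft ℂ G.transpose).comp
      ((LinearMap.mulRight ℂ G).comp superT))) (br x y) = br _ _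
    rw [← sub_add_cancel x (oddPart x), ← sub_add_cancel y (oddPart y)]
    generalize x - oddPart x = x0 at *
    generalize y - oddPart y = y0 at *
    generalize -((LinearMap.mulLeft ℂ G.transpose).comp ((LinearMap.mulRight ℂ G).comp superT)) =
      f at *
    simp only [map_add, LinearMap.add_apply, key h0 k0, key h0 k1, key h1 k0, key h1 k1]
  map_homog := by
    intro a x hx
    have hGt : G.transpose ∈ homog E O 0 := fun i j h => hG j i (by rwa [add_comm] at h)
    have := mul_mem hGt (mul_mem (superT_mem hx) hG)
    rw [zero_add, add_zero] at this
    exact neg_mem this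

theorem negAdjoint_map (G : Matrix (E ⊕ O) (E ⊕ O) ℂ) (hG : G ∈ homog E O 0)
    (hGG : G * G.transpose = 1) (x : Matrix (E ⊕ O) (E ⊕ O) ℂ) :
    (negAdjoint G hG hGG).map x = -(G.transpose * (superT x * G)) := rfl

/-- Conjugation by an even orthogonal matrix. -/
def conj (s : Matrix (E ⊕ O) (E ⊕ O) ℂ) (hs : s ∈ homog E O 0)
    (hss : s.transpose * s = 1) : (gl E O).EvenEnd where
  map := (LinearMap.mulLeft ℂ s).comp (LinearMap.mulRight ℂ s.transpose)
  map_br := by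
    intro x y
    have hst : s.transpose ∈ homog E O 0 := fun i j h => hs j i (by rwa [add_comm] at h)
    have hE : ∀ x : Matrix (E ⊕ O) (E ⊕ O) ℂ,
      ((LinearMap.mulLeft ℂ s).comp (LinearMap.mulRight ℂ s.transpose)) x =
        s * (x * s.transpose) := fun _ => rfl
    have hmem : ∀ {a : ZMod 2} {x : Matrix (E ⊕ O) (E ⊕ O) ℂ}, x ∈ homog E O a →
        s * (x * s.transpose) ∈ homog E O a := by
      intro a x hx
      have := mul_mem hs (mul_mem hx hst)
      rwa [zero_add, add_zero] at this
    have key : ∀ {a b : ZMod 2} {x y : Matrix (E ⊕ O) (E ⊕ O) ℂ}, x ∈ homog E O a →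
      y ∈ homog E O b →
      ((LinearMap.mulLeft ℂ s).comp (LinearMap.mulRight ℂ s.transpose)) (br x y) =
      br (((LinearMap.mulLeft ℂ s).comp (LinearMap.mulRight ℂ s.transpose)) x)
        (((LinearMap.mulLeft ℂ s).comp (LinearMap.mulRight ℂ s.transpose)) y) := by
      intro a b x y hx hy
      rw [hE, hE, hE, br_homog (hmem hx) (hmem hy), br_homog hx hy]
      have e : ∀ u v : Matrix (E ⊕ O) (E ⊕ O) ℂ,
          s * (u * s.transpose) * (s * (v * s.transpose)) = s * (u * v * s.transpose) := by
        intro u v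
        calc s * (u * s.transpose) * (s * (v * s.transpose))
            = s * (u * (s.transpose * s) * v * s.transpose) := by simp only [mul_assoc]
          _ = _ := by rw [hss, mul_one]
      rw [e, e, sub_mul, mul_sub, smul_mul_assoc, mul_smul_comm]
    obtain ⟨h0, h1⟩ := exists_decomp x
    obtain ⟨k0, k1⟩ := exists_decomp y
    change ((LinearMap.mulLeft ℂ s).comp (LinearMap.mulRight ℂ s.transpose)) (br x y) = br _ _
    rw [← sub_add_cancel x (oddPart x), ← sub_add_cancel y (oddPart y)]
    generalize x - oddPart x = x0 at *
    generalize y - oddPart y = y0 at *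
    generalize (LinearMap.mulLeft ℂ s).comp (LinearMap.mulRight ℂ s.transpose) = f at *
    simp only [map_add, LinearMap.add_apply, key h0 k0, key h0 k1, key h1 k0, key h1 k1]
  map_homog := by
    intro a x hx
    have hst : s.transpose ∈ homog E O 0 := fun i j h => hs j i (by rwa [add_comm] at h)
    have := mul_mem hs (mul_mem hx hst)
    rwa [zero_add, add_zero] at this

end SuperMatrix
end

noncomputable section

namespace LieSuperalgebra

variable {V : Type*} [AddCommGroup V] [Module ℂ V]

/-- Restriction of an invariant form to a graded subalgebra. -/
def InvForm.sub {A : LieSuperalgebra V} (κ : A.InvForm) (N : Submodule ℂ V) (hg : A.IsGraded N)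
    (hN : ∀ x ∈ N, ∀ y ∈ N, A.br x y ∈ N) : (A.sub N hg hN).InvForm where
  form := κ.form.domRestrict₁₂ N N
  even := fun hx hy h => κ.even hx hy h
  symm := fun hx hy => κ.symm hx hy
  inv := fun x y z => κ.inv x y z

/-- The form induced on the quotient by an ideal contained in the radical. -/
def InvForm.quot {A : LieSuperalgebra V} (κ : A.InvForm) (I : Submodule ℂ V) (hg : A.IsGraded I)
    (hl : ∀ x, ∀ y ∈ I, A.br x y ∈ I) (hr : ∀ x ∈ I, ∀ y, A.br x y ∈ I)
    (h1 : ∀ x ∈ I, ∀ y, κ.form x y = 0) (h2 : ∀ x, ∀ y ∈ I, κ.form x y = 0) :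
    (A.quot I hg hl hr).InvForm where
  form := I.liftQ (LinearMap.flip (I.liftQ κ.form.flip (fun y hy => by
      rw [LinearMap.mem_ker]; ext x; exact h2 x y hy))) (fun x hx => by
      rw [LinearMap.mem_ker]; ext y; exact h1 x hx y)
  even := by
    rintro a b _ _ ⟨x, hx, rfl⟩ ⟨y, hy, rfl⟩ h
    exact κ.even hx hy h
  symm := by
    rintro a b _ _ ⟨x, hx, rfl⟩ ⟨y, hy, rfl⟩
    exact κ.symm hx hy
  inv := by
    intro x y z
    obtain ⟨x, rfl⟩ := I.mkQ_surjective x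
    obtain ⟨y, rfl⟩ := I.mkQ_surjective y
    obtain ⟨z, rfl⟩ := I.mkQ_surjective z
    exact κ.inv x y z

/-- Restriction of an endomorphism to a stable graded subalgebra. -/
def EvenEnd.sub {A : LieSuperalgebra V} (σ : A.EvenEnd) (N : Submodule ℂ V) (hg : A.IsGraded N)
    (hN : ∀ x ∈ N, ∀ y ∈ N, A.br x y ∈ N) (hσ : ∀ x ∈ N, σ.map x ∈ N) :
    (A.sub N hg hN).EvenEnd where
  map := σ.map.restrict hσ
  map_br := fun x y => Subtype.ext (σ.map_br x y)
  map_homog := fun a x hx => σ.map_homog a x hx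

/-- The endomorphism induced on the quotient by a stable graded ideal. -/
def EvenEnd.quot {A : LieSuperalgebra V} (σ : A.EvenEnd) (I : Submodule ℂ V) (hg : A.IsGraded I)
    (hl : ∀ x, ∀ y ∈ I, A.br x y ∈ I) (hr : ∀ x ∈ I, ∀ y, A.br x y ∈ I)
    (hσ : ∀ x ∈ I, σ.map x ∈ I) : (A.quot I hg hl hr).EvenEnd where
  map := I.mapQ I σ.map hσ
  map_br := by
    intro x y
    obtain ⟨x, rfl⟩ := I.mkQ_surjective x
    obtain ⟨y, rfl⟩ := I.mkQ_surjective y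
    exact congrArg I.mkQ (σ.map_br x y)
  map_homog := by
    rintro a _ ⟨x, hx, rfl⟩
    exact ⟨_, σ.map_homog a x hx, rfl⟩

theorem EvenEnd.eigen_graded {A : LieSuperalgebra V} (σ : A.EvenEnd) (ζ : ℂ) (p : ℤ) :
    A.IsGraded (σ.eigen ζ p) := by
  intro x hx
  obtain ⟨y, hy, z, hz, rfl⟩ := A.exists_decomp x
  have hx' : σ.map (y + z) = ζ ^ p • (y + z) := hx
  have e : (σ.map y - ζ ^ p • y) = -(σ.map z - ζ ^ p • z) := by
    rw [eq_neg_iff_add_eq_zero]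
    rw [map_add, smul_add] at hx'
    rw [← sub_eq_zero] at hx'
    rw [← hx']; abel
  have h0 : σ.map y - ζ ^ p • y ∈ A.homog 0 :=
    sub_mem (σ.map_homog 0 y hy) (Submodule.smul_mem _ _ hy)
  have h1 : σ.map z - ζ ^ p • z ∈ A.homog 1 :=
    sub_mem (σ.map_homog 1 z hz) (Submodule.smul_mem _ _ hz)
  have h : σ.map y - ζ ^ p • y ∈ A.homog 0 ⊓ A.homog 1 := ⟨h0, e ▸ neg_mem h1⟩
  rw [A.isCompl.inf_eq_bot, Submodule.mem_bot] at h
  rw [h, eq_comm, neg_eq_zero] at e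
  exact ⟨y, hy, z, hz, sub_eq_zero.1 h, sub_eq_zero.1 e, rfl⟩

/-- The subspace `⨁_p V^{[p]} ⊗ t^p ⊕ ℂ c ⊕ ℂ d` of the affinization of `V`, where
`V^{[p]} = {x | σ x = ζ ^ p x}`. -/
def twistedSubspace {A : LieSuperalgebra V} (σ : A.EvenEnd) (ζ : ℂ) :
    Submodule ℂ ((ℤ →₀ V) × ℂ × ℂ) where
  carrier := {u | ∀ p, u.1 p ∈ σ.eigen ζ p}
  add_mem' := fun hx hy p => add_mem (hx p) (hy p)
  zero_mem' := fun _ => zero_mem _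
  smul_mem' := fun c _ hx p => Submodule.smul_mem _ c (hx p)

theorem twisted_graded {A : LieSuperalgebra V} (κ : A.InvForm) (σ : A.EvenEnd) (ζ : ℂ) :
    (A.affine κ).IsGraded (twistedSubspace σ ζ) := by
  rintro ⟨x, w⟩ hx
  obtain ⟨y, z, hy, hz, e⟩ := A.loop_decomp (σ.eigen ζ) (σ.eigen_graded ζ) (x := x) hx
  refine ⟨(y, w), ?_, (z, 0), ?_, fun p => (hy p).2, fun p => (hz p).2, ?_⟩
  · exact A.mem_affineHomog.2 ⟨fun p => (hy p).1, fun h => (h rfl).elim⟩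
  · exact A.mem_affineHomog.2 ⟨fun p => (hz p).1, fun _ => rfl⟩
  · ext1
    · exact e
    · simp

theorem twisted_closed {A : LieSuperalgebra V} (κ : A.InvForm) (σ : A.EvenEnd) {ζ : ℂ}
    (hζ : ζ ≠ 0) : ∀ x ∈ twistedSubspace σ ζ, ∀ y ∈ twistedSubspace σ ζ,
      (A.affine κ).br x y ∈ twistedSubspace σ ζ := by
  intro u hu v hv p
  have h1 : A.loopBr u.1 v.1 p ∈ σ.eigen ζ p := by
    refine A.loopBr_mem (W₁ := σ.eigen ζ) (W₂ := σ.eigen ζ) ?_ hu hv p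
    intro p q x hx y hy
    change σ.map (A.br x y) = _
    rw [σ.map_br, show σ.map x = _ from hx, show σ.map y = _ from hy, zpow_add₀ hζ]
    simp [smul_smul, mul_comm]
  have h2 : u.2.2 • loopDeg V v.1 p ∈ σ.eigen ζ p := by
    rw [loopDeg_apply]
    exact Submodule.smul_mem _ _ (Submodule.smul_mem _ _ (hv p))
  have h3 : v.2.2 • loopDeg V u.1 p ∈ σ.eigen ζ p := by
    rw [loopDeg_apply]
    exact Submodule.smul_mem _ _ (Submodule.smul_mem _ _ (hu p))
  exact sub_mem (add_mem h1 h2) h3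

/-- The twisted affinization attached to `V`, an invariant form, an endomorphism `σ` and a
root of unity `ζ`. -/
def twisted {A : LieSuperalgebra V} (κ : A.InvForm) (σ : A.EvenEnd) (ζ : ℂ) (hζ : ζ ≠ 0) :
    LieSuperalgebra (twistedSubspace σ ζ) :=
  (A.affine κ).sub (twistedSubspace σ ζ) (twisted_graded κ σ ζ) (twisted_closed κ σ hζ)

/-- The bilinear form
`(x ⊗ t^p + r c + s d, y ⊗ t^q + r' c + s' d) ↦ κ(x, y) δ_{p+q,0} + r s' + s r'`. -/
def affineForm {A : LieSuperalgebra V} (κ : A.InvForm) (u v : (ℤ →₀ V) × ℂ × ℂ) : ℂ :=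
  κ.loopForm u.1 v.1 + u.2.1 * v.2.2 + u.2.2 * v.2.1

end LieSuperalgebra

/-! ### The four families -/

open LieSuperalgebra SuperMatrix

/-- The four families of twisted affine Lie superalgebras:
`evenOdd` is `A(2k,2ℓ-1)^(2)`, `oddOdd` is `A(2k-1,2ℓ-1)^(2)`, `evenEven` is `A(2k,2ℓ)^(4)`
and `orth` is `D(k+1,ℓ)^(2)`. -/
inductive TwistedType
  | evenOdd
  | oddOdd
  | evenEven
  | orth

namespace TwistedType

/-- The range of the parameters: `ℓ` is positive; `k` may be zero except for
`A(2k-1,2ℓ-1)^(2)`, where also `(k,ℓ) ≠ (1,1)`. -/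
def Admissible : TwistedType → ℕ → ℕ → Prop
  | oddOdd, k, l => 1 ≤ k ∧ 1 ≤ l ∧ (k, l) ≠ (1, 1)
  | _, _, l => 1 ≤ l

/-- The underlying superspace has even dimension `2k + p`. -/
def p : TwistedType → ℕ
  | evenOdd => 1
  | oddOdd => 0
  | evenEven => 1
  | orth => 2

/-- The underlying superspace has odd dimension `2ℓ + q`. -/
def q : TwistedType → ℕ
  | evenOdd => 0
  | oddOdd => 0
  | evenEven => 1
  | orth => 0

/-- The primitive root of unity: of order four for `A(2k,2ℓ)^(4)` and of order two otherwise. -/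
def zeta : TwistedType → ℂ
  | evenEven => Complex.I
  | _ => -1

theorem zeta_ne_zero (X : TwistedType) : X.zeta ≠ 0 := by
  cases X <;> simp [zeta]

/-- Indices of a basis of the even (or odd) part of the underlying superspace: two dual
families of length `k`, and `p` further vectors. -/
abbrev Half (k p : ℕ) : Type := (Fin k ⊕ Fin k) ⊕ Fin p

/-- Indices of a basis of the underlying superspace. -/
abbrev Idx (X : TwistedType) (k l : ℕ) : Type := Half k X.p ⊕ Half l X.q

/-- The general linear superalgebra containing everything. -/
abbrev Mat (X : TwistedType) (k l : ℕ) : Type := Matrix (X.Idx k l) (X.Idx k l) ℂ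

/-- The reversal matrix of size `p`. -/
def rev (p : ℕ) : Matrix (Fin p) (Fin p) ℂ := Matrix.of fun i j => if j = i.rev then 1 else 0

/-- The Gram matrix of an even bilinear form on the underlying superspace: symmetric on the
even part; on the odd part it is the standard symplectic form, orthogonally extended
by the form of `rev q`. -/
def gram (X : TwistedType) (k l : ℕ) : X.Mat k l :=
  Matrix.fromBlocks
    (Matrix.fromBlocks (Matrix.fromBlocks 0 1 1 0) 0 0 (rev X.p)) 0 0
    (Matrix.fromBlocks (Matrix.fromBlocks 0 1 (-1) 0) 0 0 (rev X.q))

/-- The permutation matrix that reverses the `p` additional even basis vectors. -/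
def swap (X : TwistedType) (k l : ℕ) : X.Mat k l :=
  Matrix.fromBlocks (Matrix.fromBlocks 1 0 0 (rev X.p)) 0 0 1

theorem rev_transpose (p : ℕ) : (rev p).transpose = rev p := by
  ext i j
  have h : i = j.rev ↔ j = i.rev := ⟨fun h => by rw [h, Fin.rev_rev], fun h => by
    rw [h, Fin.rev_rev]⟩
  simp [rev, h]

theorem rev_mul_rev (p : ℕ) : rev p * rev p = 1 := by
  ext i j
  rw [Matrix.mul_apply, Finset.sum_eq_single i.rev]
  · simp [rev, Matrix.one_apply, eq_comm]
  · intro b _ hb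
    simp [rev, hb]
  · simp

theorem gram_mem (X : TwistedType) (k l : ℕ) : X.gram k l ∈ SuperMatrix.homog _ _ 0 := by
  rintro (i | i) (j | j) h
  · simp [par] at h
  · rfl
  · rfl
  · exact (h (by simp only [par, Sum.elim_inr]; decide)).elim

theorem swap_mem (X : TwistedType) (k l : ℕ) : X.swap k l ∈ SuperMatrix.homog _ _ 0 := by
  rintro (i | i) (j | j) h
  · simp [par] at h
  · rfl
  · rfl
  · exact (h (by simp only [par, Sum.elim_inr]; decide)).elim

theorem gram_mul_transpose (X : TwistedType) (k l : ℕ) :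
    X.gram k l * (X.gram k l).transpose = 1 := by
  simp [gram, Matrix.fromBlocks_transpose, Matrix.fromBlocks_multiply, rev_transpose, rev_mul_rev]

theorem swap_transpose (X : TwistedType) (k l : ℕ) :
    (X.swap k l).transpose = X.swap k l := by
  simp [swap, Matrix.fromBlocks_transpose, rev_transpose]

theorem swap_transpose_mul (X : TwistedType) (k l : ℕ) :
    (X.swap k l).transpose * X.swap k l = 1 := by
  rw [swap_transpose]
  simp [swap, Matrix.fromBlocks_multiply, rev_mul_rev]

theorem gram_mul_swap (X : TwistedType) (k l : ℕ) :
    X.gram k l * X.swap k l = X.swap k l * X.gram k l := by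
  simp [gram, swap, Matrix.fromBlocks_multiply]

/-- The automorphism `x ↦ -G⁻¹ x^{st} G` of `gl`, where `G` is the Gram matrix. -/
def adj (X : TwistedType) (k l : ℕ) : (gl (Half k X.p) (Half l X.q)).EvenEnd :=
  negAdjoint (X.gram k l) (X.gram_mem k l) (X.gram_mul_transpose k l)

/-- Conjugation by the permutation matrix `swap`. -/
def swapConj (X : TwistedType) (k l : ℕ) : (gl (Half k X.p) (Half l X.q)).EvenEnd :=
  conj (X.swap k l) (X.swap_mem k l) (X.swap_transpose_mul k l)

/-- `osp(2k+2|2ℓ)` in the orthosymplectic case (the matrices that are skew for the form), the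
special linear superalgebra otherwise. -/
def carrier (X : TwistedType) (k l : ℕ) : Submodule ℂ (X.Mat k l) :=
  match X with
  | orth => LinearMap.ker ((orth.adj k l).map - LinearMap.id)
  | evenOdd => LinearMap.ker str
  | oddOdd => LinearMap.ker str
  | evenEven => LinearMap.ker str

/-- The automorphism of `gl` which induces the diagram automorphism `σ`. -/
def autGl (X : TwistedType) (k l : ℕ) : (gl (Half k X.p) (Half l X.q)).EvenEnd :=
  match X with
  | orth => orth.swapConj k l
  | evenOdd => evenOdd.adj k l
  | oddOdd => oddOdd.adj k l
  | evenEven => evenEven.adj k l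

theorem isGraded_ker_str (E O : Type) [Fintype E] [Fintype O] [DecidableEq E] [DecidableEq O] :
    (gl E O).IsGraded (LinearMap.ker str) := by
  intro x hx
  have h1 : str (oddPart x) = 0 := by simp [str, oddPart]
  refine ⟨_, (exists_decomp x).1, _, (exists_decomp x).2, ?_, h1, by abel⟩
  rw [LinearMap.mem_ker, map_sub, h1, LinearMap.mem_ker.1 hx, sub_zero]

theorem isGraded_fixed {V : Type*} [AddCommGroup V] [Module ℂ V] {A : LieSuperalgebra V}
    (σ : A.EvenEnd) : A.IsGraded (LinearMap.ker (σ.map - LinearMap.id)) := by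
  have h : LinearMap.ker (σ.map - LinearMap.id) = σ.eigen 1 0 := by
    ext x
    rw [LinearMap.mem_ker, LinearMap.sub_apply, sub_eq_zero]
    change _ ↔ σ.map x = (1 : ℂ) ^ (0 : ℤ) • x
    simp
  rw [h]
  exact σ.eigen_graded 1 0

theorem carrier_graded (X : TwistedType) (k l : ℕ) :
    (gl (Half k X.p) (Half l X.q)).IsGraded (X.carrier k l) := by
  cases X
  · exact isGraded_ker_str _ _
  · exact isGraded_ker_str _ _
  · exact isGraded_ker_str _ _
  · exact isGraded_fixed _

theorem carrier_closed (X : TwistedType) (k l : ℕ) : ∀ x ∈ X.carrier k l, ∀ y ∈ X.carrier k l,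
    (gl (Half k X.p) (Half l X.q)).br x y ∈ X.carrier k l := by
  intro x hx y hy
  cases X
  · exact str_br x y
  · exact str_br x y
  · exact str_br x y
  · have hx' : (orth.adj k l).map x = x := sub_eq_zero.1 hx
    have hy' : (orth.adj k l).map y = y := sub_eq_zero.1 hy
    change (orth.adj k l).map _ - _ = 0
    rw [(orth.adj k l).map_br, hx', hy', LinearMap.id_apply, sub_self]

theorem superT_mul_left {E O : Type} [Fintype E] [Fintype O] [DecidableEq E] [DecidableEq O]
    {s : Matrix (E ⊕ O) (E ⊕ O) ℂ} (hs : s ∈ SuperMatrix.homog E O 0)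
    (x : Matrix (E ⊕ O) (E ⊕ O) ℂ) :
    superT (s * x) = superT x * s.transpose ∧ superT (x * s) = s.transpose * superT x := by
  have h01 : (0 : ZMod 2) ≠ 1 := by decide
  have hst : superT s = s.transpose := by
    ext i j
    rw [superT_entry, Matrix.transpose_apply]
    by_cases h : par i + par j = 0
    · simp [superSign, h]
    · rw [hs j i (by rwa [add_comm]), mul_zero]
  obtain ⟨h0, h1⟩ := exists_decomp x
  rw [← sub_add_cancel x (oddPart x)]
  generalize x - oddPart x = x0 at *
  rw [mul_add, add_mul, map_add, map_add, map_add, superT_mul hs h0, superT_mul hs h1,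
    superT_mul h0 hs, superT_mul h1 hs, hst, add_mul, mul_add]
  simp [superSign, h01]

theorem str_comm_even {E O : Type} [Fintype E] [Fintype O] [DecidableEq E] [DecidableEq O]
    {s : Matrix (E ⊕ O) (E ⊕ O) ℂ} (hs : s ∈ SuperMatrix.homog E O 0)
    (x : Matrix (E ⊕ O) (E ⊕ O) ℂ) : str (s * x) = str (x * s) := by
  have h01 : (0 : ZMod 2) ≠ 1 := by decide
  obtain ⟨h0, h1⟩ := exists_decomp x
  rw [← sub_add_cancel x (oddPart x)]
  generalize x - oddPart x = x0 at *
  rw [mul_add, add_mul, map_add, map_add, str_mul_comm hs h0, str_mul_comm hs h1]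
  simp [superSign, h01]

theorem str_adj (X : TwistedType) (k l : ℕ) (x : X.Mat k l) :
    str ((X.adj k l).map x) = -str x := by
  have hGt : (X.gram k l).transpose ∈ SuperMatrix.homog (Half k X.p) (Half l X.q) 0 :=
    fun i j h => X.gram_mem k l j i (by rwa [add_comm] at h)
  rw [adj, negAdjoint_map, map_neg, str_comm_even hGt, mul_assoc, gram_mul_transpose, mul_one]
  simp [str, superT, Matrix.toBlocks₁₁, Matrix.toBlocks₂₂]

theorem swapConj_map (X : TwistedType) (k l : ℕ) (x : X.Mat k l) :
    (X.swapConj k l).map x = X.swap k l * (x * (X.swap k l).transpose) := rfl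

theorem adj_map (X : TwistedType) (k l : ℕ) (x : X.Mat k l) :
    (X.adj k l).map x = -((X.gram k l).transpose * (superT x * X.gram k l)) := rfl

theorem adj_swapConj (X : TwistedType) (k l : ℕ) (x : X.Mat k l) :
    (X.adj k l).map ((X.swapConj k l).map x) = (X.swapConj k l).map ((X.adj k l).map x) := by
  have h1 := X.gram_mul_swap k l
  have h2 : (X.gram k l).transpose * X.swap k l = X.swap k l * (X.gram k l).transpose := by
    have := congrArg Matrix.transpose h1
    rw [Matrix.transpose_mul, Matrix.transpose_mul, swap_transpose] at this
    exact this.symm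
  rw [swapConj_map, swapConj_map, adj_map, adj_map, swap_transpose,
    (superT_mul_left (X.swap_mem k l) _).1, (superT_mul_left (X.swap_mem k l) _).2, swap_transpose,
    neg_mul, mul_neg]
  congr 1
  calc (X.gram k l).transpose * (X.swap k l * superT x * X.swap k l * X.gram k l)
      = ((X.gram k l).transpose * X.swap k l) * superT x * (X.swap k l * X.gram k l) := by
        simp only [mul_assoc]
    _ = _ := by rw [h2, ← h1]; simp only [mul_assoc]

theorem carrier_stable (X : TwistedType) (k l : ℕ) :
    ∀ x ∈ X.carrier k l, (X.autGl k l).map x ∈ X.carrier k l := by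
  intro x hx
  cases X
  · exact (str_adj _ k l x).trans (by rw [show str x = 0 from hx, neg_zero])
  · exact (str_adj _ k l x).trans (by rw [show str x = 0 from hx, neg_zero])
  · exact (str_adj _ k l x).trans (by rw [show str x = 0 from hx, neg_zero])
  · have hx' : (orth.adj k l).map x = x := sub_eq_zero.1 hx
    change (orth.adj k l).map ((orth.swapConj k l).map x) - (orth.swapConj k l).map x = 0
    rw [adj_swapConj, hx', sub_self]

/-- The scalar matrices in `carrier`. They form the zero subspace except for `sl(n|n)`. -/
def scalars (X : TwistedType) (k l : ℕ) : Submodule ℂ (X.carrier k l) :=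
  (Submodule.span ℂ {(1 : X.Mat k l)}).comap (X.carrier k l).subtype

/-- `carrier` as a Lie superalgebra. -/
def preAlg (X : TwistedType) (k l : ℕ) : LieSuperalgebra (X.carrier k l) :=
  (gl (Half k X.p) (Half l X.q)).sub (X.carrier k l) (X.carrier_graded k l) (X.carrier_closed k l)

theorem one_mem_homog (E O : Type) [Fintype E] [Fintype O] [DecidableEq E] [DecidableEq O] :
    (1 : Matrix (E ⊕ O) (E ⊕ O) ℂ) ∈ SuperMatrix.homog E O 0 := by
  intro i j h
  refine Matrix.one_apply_ne ?_
  rintro rfl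
  exact h (CharTwo.add_self_eq_zero _)

theorem br_one {E O : Type} [Fintype E] [Fintype O] [DecidableEq E] [DecidableEq O]
    (x : Matrix (E ⊕ O) (E ⊕ O) ℂ) : SuperMatrix.br x 1 = 0 ∧ SuperMatrix.br 1 x = 0 := by
  have h := oddPart_of_even (one_mem_homog E O)
  constructor
  · change x * 1 - 1 * x + (2 : ℂ) • (oddPart 1 * oddPart x) = 0
    rw [h]; simp
  · change 1 * x - x * 1 + (2 : ℂ) • (oddPart x * oddPart 1) = 0
    rw [h]; simp

theorem scalars_graded (X : TwistedType) (k l : ℕ) : (X.preAlg k l).IsGraded (X.scalars k l) := by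
  intro x hx
  refine ⟨x, ?_, 0, zero_mem _, hx, zero_mem _, (add_zero x).symm⟩
  obtain ⟨c, hc⟩ := Submodule.mem_span_singleton.1 hx
  change (x : X.Mat k l) ∈ SuperMatrix.homog _ _ 0
  rw [show (x : X.Mat k l) = c • 1 from hc.symm]
  exact Submodule.smul_mem _ _ (one_mem_homog _ _)

theorem scalars_left (X : TwistedType) (k l : ℕ) :
    ∀ x, ∀ y ∈ X.scalars k l, (X.preAlg k l).br x y ∈ X.scalars k l := by
  intro x y hy
  obtain ⟨c, hc⟩ := Submodule.mem_span_singleton.1 hy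
  change SuperMatrix.br (x : X.Mat k l) (y : X.Mat k l) ∈ Submodule.span ℂ {(1 : X.Mat k l)}
  rw [show (y : X.Mat k l) = c • 1 from hc.symm, map_smul, (br_one _).1, smul_zero]
  exact zero_mem _

theorem scalars_right (X : TwistedType) (k l : ℕ) :
    ∀ x ∈ X.scalars k l, ∀ y, (X.preAlg k l).br x y ∈ X.scalars k l := by
  intro x hx y
  obtain ⟨c, hc⟩ := Submodule.mem_span_singleton.1 hx
  change SuperMatrix.br (x : X.Mat k l) (y : X.Mat k l) ∈ Submodule.span ℂ {(1 : X.Mat k l)}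
  rw [show (x : X.Mat k l) = c • 1 from hc.symm, map_smul, LinearMap.smul_apply, (br_one _).2,
    smul_zero]
  exact zero_mem _

/-- The vector space of the basic classical simple Lie superalgebra: `sl(m|n)` modulo its scalar
matrices, or `osp(2k+2|2ℓ)`. -/
abbrev FinSpace (X : TwistedType) (k l : ℕ) : Type := X.carrier k l ⧸ X.scalars k l

/-- The basic classical simple Lie superalgebra `𝔤` of type `A(2k,2ℓ-1)`, `A(2k-1,2ℓ-1)`,
`A(2k,2ℓ)` or `D(k+1,ℓ)`. -/
def finAlg (X : TwistedType) (k l : ℕ) : LieSuperalgebra (X.FinSpace k l) :=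
  (X.preAlg k l).quot (X.scalars k l) (X.scalars_graded k l) (X.scalars_left k l)
    (X.scalars_right k l)

theorem str_carrier (X : TwistedType) (k l : ℕ) {x : X.Mat k l} (hx : x ∈ X.carrier k l) :
    str x = 0 := by
  cases X
  · exact hx
  · exact hx
  · exact hx
  · have hx' : (orth.adj k l).map x = x := sub_eq_zero.1 hx
    have h := orth.str_adj k l x
    rw [hx'] at h
    linear_combination h / 2

/-- The supertrace form of `𝔤`. -/
def finForm (X : TwistedType) (k l : ℕ) : (X.finAlg k l).InvForm :=
  (strForm.sub (X.carrier k l) (X.carrier_graded k l) (X.carrier_closed k l)).quot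
    (X.scalars k l) (X.scalars_graded k l) (X.scalars_left k l) (X.scalars_right k l)
    (by
      intro x hx y
      obtain ⟨c, hc⟩ := Submodule.mem_span_singleton.1 hx
      change str ((x : X.Mat k l) * (y : X.Mat k l)) = 0
      rw [show (x : X.Mat k l) = c • 1 from hc.symm, smul_mul_assoc, one_mul, map_smul,
        X.str_carrier k l y.2, smul_zero])
    (by
      intro x y hy
      obtain ⟨c, hc⟩ := Submodule.mem_span_singleton.1 hy
      change str ((x : X.Mat k l) * (y : X.Mat k l)) = 0
      rw [show (y : X.Mat k l) = c • 1 from hc.symm, mul_smul_comm, mul_one, map_smul,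
        X.str_carrier k l x.2, smul_zero])

theorem superT_one {E O : Type} [Fintype E] [Fintype O] [DecidableEq E] [DecidableEq O] :
    superT (1 : Matrix (E ⊕ O) (E ⊕ O) ℂ) = 1 := by
  ext (i | i) (j | j) <;>
    simp [superT, Matrix.toBlocks₁₂, Matrix.toBlocks₂₁, Matrix.toBlocks₁₁, Matrix.toBlocks₂₂,
      Matrix.one_apply, eq_comm]

theorem autGl_one (X : TwistedType) (k l : ℕ) :
    (X.autGl k l).map 1 = 1 ∨ (X.autGl k l).map 1 = -1 := by
  have h : ∀ X : TwistedType, (X.adj k l).map 1 = -1 := by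
    intro X
    rw [adj_map, superT_one, one_mul, mul_eq_one_comm.1 (X.gram_mul_transpose k l)]
  cases X
  · exact Or.inr (h _)
  · exact Or.inr (h _)
  · exact Or.inr (h _)
  · left
    change (orth.swapConj k l).map 1 = 1
    rw [swapConj_map, one_mul, mul_eq_one_comm.1 (orth.swap_transpose_mul k l)]

/-- The automorphism `σ` of `𝔤`. -/
def aut (X : TwistedType) (k l : ℕ) : (X.finAlg k l).EvenEnd :=
  ((X.autGl k l).sub (X.carrier k l) (X.carrier_graded k l) (X.carrier_closed k l)
    (X.carrier_stable k l)).quot (X.scalars k l) (X.scalars_graded k l) (X.scalars_left k l)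
    (X.scalars_right k l) (by
      intro x hx
      obtain ⟨c, hc⟩ := Submodule.mem_span_singleton.1 hx
      change (X.autGl k l).map (x : X.Mat k l) ∈ Submodule.span ℂ {(1 : X.Mat k l)}
      rw [show (x : X.Mat k l) = c • 1 from hc.symm, map_smul]
      refine Submodule.smul_mem _ _ ?_
      rcases X.autGl_one k l with h | h <;> rw [h]
      · exact Submodule.mem_span_singleton_self _
      · exact neg_mem (Submodule.mem_span_singleton_self _))

/-- The vector space of the twisted affine Lie superalgebra
`⨁_p (𝔤^{[p]} ⊗ t^p) ⊕ ℂ c ⊕ ℂ d`. -/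
abbrev Alg (X : TwistedType) (k l : ℕ) : Type := twistedSubspace (X.aut k l) X.zeta

/-- The twisted affine Lie superalgebra `𝓛`. -/
def alg (X : TwistedType) (k l : ℕ) : LieSuperalgebra (X.Alg k l) :=
  twisted (X.finForm k l) (X.aut k l) X.zeta X.zeta_ne_zero

/-! ### The Cartan subalgebra and roots -/

/-- The space of tuples `(a, b, r, s)` parametrizing the Cartan subalgebra. -/
abbrev Cartan (k l : ℕ) : Type := (Fin k → ℂ) × (Fin l → ℂ) × ℂ × ℂ

/-- The diagonal matrix `diag(a, -a, 0 | b, -b, 0)`. -/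
def diag (X : TwistedType) (k l : ℕ) (h : Cartan k l) : X.Mat k l :=
  Matrix.diagonal (Sum.elim (Sum.elim (Sum.elim h.1 (-h.1)) 0)
    (Sum.elim (Sum.elim h.2.1 (-h.2.1)) 0))

theorem diag_str (X : TwistedType) (k l : ℕ) (h : Cartan k l) : str (X.diag k l h) = 0 := by
  simp [str, diag, Fintype.sum_sum_type]

theorem diag_adj (X : TwistedType) (k l : ℕ) (h : Cartan k l) :
    (X.adj k l).map (X.diag k l h) = X.diag k l h := by
  have h1 : superT (X.diag k l h) = X.diag k l h := by
    ext (i | i) (j | j)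
    · simp [superT, diag, Matrix.toBlocks₁₁, Matrix.diagonal_apply]; grind
    · simp [superT, diag, Matrix.toBlocks₂₁]
    · simp [superT, diag, Matrix.toBlocks₁₂]
    · simp [superT, diag, Matrix.toBlocks₂₂, Matrix.diagonal_apply]; grind
  have h2 : X.diag k l h * X.gram k l = -(X.gram k l * X.diag k l h) := by
    ext ((( i | i) | i) | ((i | i) | i)) (((j | j) | j) | ((j | j) | j)) <;>
      simp [diag, gram, Matrix.diagonal_mul, Matrix.mul_diagonal, Matrix.one_apply] <;> grind
  rw [adj_map, h1, h2, mul_neg, ← mul_assoc, mul_eq_one_comm.1 (X.gram_mul_transpose k l), one_mul,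
    neg_neg]

theorem diag_swapConj (X : TwistedType) (k l : ℕ) (h : Cartan k l) :
    (X.swapConj k l).map (X.diag k l h) = X.diag k l h := by
  have h2 : X.diag k l h * X.swap k l = X.swap k l * X.diag k l h := by
    ext ((( i | i) | i) | ((i | i) | i)) (((j | j) | j) | ((j | j) | j)) <;>
      simp [diag, swap, Matrix.diagonal_mul, Matrix.mul_diagonal, Matrix.one_apply] <;> grind
  rw [swapConj_map, swap_transpose, h2, ← mul_assoc]
  have := X.swap_transpose_mul k l
  rw [swap_transpose] at this
  rw [this, one_mul]

theorem diag_mem (X : TwistedType) (k l : ℕ) (h : Cartan k l) : X.diag k l h ∈ X.carrier k l := by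
  cases X
  · exact diag_str _ k l h
  · exact diag_str _ k l h
  · exact diag_str _ k l h
  · exact sub_eq_zero.2 (diag_adj _ k l h)

theorem diag_fixed (X : TwistedType) (k l : ℕ) (h : Cartan k l) :
    (X.autGl k l).map (X.diag k l h) = X.diag k l h := by
  cases X
  · exact diag_adj _ k l h
  · exact diag_adj _ k l h
  · exact diag_adj _ k l h
  · exact diag_swapConj _ k l h

/-- The class in `𝔤` of the diagonal matrix `diag(a, -a, 0 | b, -b, 0)`. -/
def finCartan (X : TwistedType) (k l : ℕ) : Cartan k l →ₗ[ℂ] X.FinSpace k l where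
  toFun h := (X.scalars k l).mkQ ⟨X.diag k l h, X.diag_mem k l h⟩
  map_add' h h' := by
    rw [← map_add]
    congr 1
    ext ((( i | i) | i) | ((i | i) | i)) (((j | j) | j) | ((j | j) | j)) <;>
      simp [diag, Matrix.diagonal_apply] <;> grind
  map_smul' c h := by
    rw [RingHom.id_apply, ← map_smul]
    congr 1
    ext ((( i | i) | i) | ((i | i) | i)) (((j | j) | j) | ((j | j) | j)) <;>
      simp [diag, Matrix.diagonal_apply]

/-- The embedding of the Cartan subalgebra `𝔥` of `𝓛`:
`(a, b, r, s) ↦ diag(a, -a, 0 | b, -b, 0) ⊗ 1 + r c + s d`. -/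
def cartan (X : TwistedType) (k l : ℕ) : Cartan k l →ₗ[ℂ] X.Alg k l :=
  LinearMap.codRestrict (twistedSubspace (X.aut k l) X.zeta)
    (LinearMap.prod ((Finsupp.lsingle 0).comp (X.finCartan k l))
      ((LinearMap.snd ℂ _ _).comp (LinearMap.snd ℂ _ _)))
    (by
      intro h p
      change Finsupp.single 0 (X.finCartan k l h) p ∈ _
      rw [Finsupp.single_apply]
      split_ifs with hp
      · subst hp
        change (X.aut k l).map _ = X.zeta ^ (0 : ℤ) • _
        rw [zpow_zero, one_smul]
        exact congrArg (X.scalars k l).mkQ (Subtype.ext (X.diag_fixed k l h))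
      · exact zero_mem _)

/-- The restriction to `𝔥` of the invariant form of `𝓛`. -/
def cartanForm (X : TwistedType) (k l : ℕ) (h h' : Cartan k l) : ℂ :=
  affineForm (X.finForm k l) (X.cartan k l h) (X.cartan k l h')

/-- The dual space `𝔥*`. -/
abbrev Weight (k l : ℕ) : Type := Module.Dual ℂ (Cartan k l)

/-- The element of `𝔥` representing a functional through the form, see `cartanForm_toCartan`. -/
def toCartan {k l : ℕ} (α : Weight k l) : Cartan k l :=
  (fun i => α (Pi.single i 1, 0, 0, 0) / 2, fun j => -(α (0, Pi.single j 1, 0, 0) / 2),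
    α (0, 0, 0, 1), α (0, 0, 1, 0))

theorem cartanForm_eq (X : TwistedType) (k l : ℕ) (h h' : Cartan k l) :
    X.cartanForm k l h h' = 2 * ∑ i, h.1 i * h'.1 i - 2 * ∑ j, h.2.1 j * h'.2.1 j +
      h.2.2.1 * h'.2.2.2 + h.2.2.2 * h'.2.2.1 := by
  have e : (X.finForm k l).loopForm (Finsupp.single 0 (X.finCartan k l h))
      (Finsupp.single 0 (X.finCartan k l h')) = str (X.diag k l h * X.diag k l h') := by
    rw [loopForm_single]
    simp only [add_zero, if_true]
    rfl
  change (X.finForm k l).loopForm (Finsupp.single 0 (X.finCartan k l h))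
      (Finsupp.single 0 (X.finCartan k l h')) + h.2.2.1 * h'.2.2.2 + h.2.2.2 * h'.2.2.1 = _
  rw [e]
  simp [str, diag, Fintype.sum_sum_type, ← two_mul]

theorem cartanForm_toCartan (X : TwistedType) {k l : ℕ} (α : Weight k l) (h : Cartan k l) :
    X.cartanForm k l (toCartan α) h = α h := by
  have hh : h = ∑ i, h.1 i • ((Pi.single i 1, 0, 0, 0) : Cartan k l) +
      ∑ j, h.2.1 j • ((0, Pi.single j 1, 0, 0) : Cartan k l) +
      h.2.2.1 • ((0, 0, 1, 0) : Cartan k l) + h.2.2.2 • ((0, 0, 0, 1) : Cartan k l) := by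
    ext i <;> simp [Prod.fst_sum, Prod.snd_sum, Finset.sum_apply, Pi.single_apply]
  rw [cartanForm_eq]
  conv_rhs => rw [hh]
  simp only [map_add, map_sum, map_smul, smul_eq_mul, toCartan, Finset.mul_sum,
    ← Finset.sum_neg_distrib, sub_eq_add_neg]
  have e1 : ∀ i, 2 * (α (Pi.single i 1, 0, 0, 0) / 2 * h.1 i) =
    h.1 i * α (Pi.single i 1, 0, 0, 0) := fun i => by ring
  have e2 : ∀ j, -(2 * (-(α (0, Pi.single j 1, 0, 0) / 2) * h.2.1 j)) =
    h.2.1 j * α (0, Pi.single j 1, 0, 0) := fun j => by ring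
  simp only [e1, e2]
  ring

/-- The form on `𝔥*` transferred from `𝔥`. -/
def weightForm {k l : ℕ} (α β : Weight k l) : ℂ := β (toCartan α)

/-- The root space `𝓛^α = {x | [h, x] = α(h) x for all h ∈ 𝔥}`. -/
def rootSpace (X : TwistedType) (k l : ℕ) (α : Weight k l) : Submodule ℂ (X.Alg k l) where
  carrier := {x | ∀ h, (X.alg k l).br (X.cartan k l h) x = α h • x}
  add_mem' := by
    intro x y hx hy h
    rw [map_add, hx h, hy h, smul_add]
  zero_mem' := by
    intro h
    rw [map_zero, smul_zero]
  smul_mem' := by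
    intro c x hx h
    rw [map_smul, hx h, smul_comm]

/-- The root system `R` of `𝓛`; by convention `0 ∈ R`, because `𝓛^0` contains `𝔥`. -/
def roots (X : TwistedType) (k l : ℕ) : Set (Weight k l) := {α | X.rootSpace k l α ≠ ⊥}

/-- Nonzero real roots. -/
def realRoots (X : TwistedType) (k l : ℕ) : Set (Weight k l) :=
  {α ∈ X.roots k l | weightForm α α ≠ 0}

/-- Imaginary roots (including `0`). -/
def imagRoots (X : TwistedType) (k l : ℕ) : Set (Weight k l) :=
  {α ∈ X.roots k l | ∀ β ∈ X.roots k l, weightForm α β = 0}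

/-- The functional `ε_i`. -/
def eps {k l : ℕ} (i : Fin k) : Weight k l :=
  (LinearMap.proj i).comp (LinearMap.fst ℂ _ _)

/-- The functional `δ_j`. -/
def del {k l : ℕ} (j : Fin l) : Weight k l :=
  (LinearMap.proj j).comp ((LinearMap.fst ℂ _ _).comp (LinearMap.snd ℂ _ _))

/-- The functional `δ`. -/
def delta {k l : ℕ} : Weight k l :=
  (LinearMap.snd ℂ _ _).comp ((LinearMap.snd ℂ _ _).comp (LinearMap.snd ℂ _ _))

end TwistedType
end

open scoped Pointwise

noncomputable section

namespace TwistedType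

/-! ### The even roots, as explicit sets -/

/-- `{±x_i}`. -/
def shortSet {k l n : ℕ} (x : Fin n → Weight k l) : Set (Weight k l) :=
  {y | ∃ i, y = x i ∨ y = -x i}

/-- `{±x_i ± x_j | i ≠ j}`. -/
def midSet {k l n : ℕ} (x : Fin n → Weight k l) : Set (Weight k l) :=
  {y | ∃ i j, i ≠ j ∧ (y = x i + x j ∨ y = x i - x j ∨ y = -x i - x j)}

/-- `{±2 x_i}`. -/
def longSet {k l n : ℕ} (x : Fin n → Weight k l) : Set (Weight k l) :=
  {y | ∃ i, y = 2 • x i ∨ y = -(2 • x i)}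

/-- `{±ε_i ± δ_j}`. -/
def mixedSet (k l : ℕ) : Set (Weight k l) :=
  {y | ∃ (i : Fin k) (j : Fin l), y = eps i + del j ∨ y = eps i - del j ∨
    y = -eps i + del j ∨ y = -eps i - del j}

/-- `D + (m ℤ + c) δ`. -/
def strip {k l : ℕ} (m c : ℤ) (D : Set (Weight k l)) : Set (Weight k l) :=
  {y | ∃ x ∈ D, ∃ n : ℤ, y = x + (m * n + c) • delta}

/-- The group `ℤ δ` of integral multiples of the basic imaginary root. -/
def zdelta (k l : ℕ) : Set (Weight k l) := strip 1 0 {0}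

/-- The set `R_0(1)`. -/
def evenRootsOne (k l : ℕ) : TwistedType → Set (Weight k l)
  | evenOdd | oddOdd =>
      strip (if l = 1 then 2 else 1) 0 {0} ∪ strip 1 0 (midSet del) ∪ strip 2 0 (longSet del)
  | evenEven =>
      strip 2 0 {0} ∪ strip 2 1 (shortSet del) ∪ strip 2 0 (midSet del) ∪ strip 4 0 (longSet del)
  | orth => strip 2 0 {0} ∪ strip 2 0 (midSet del) ∪ strip 2 0 (longSet del)

/-- The set `R_0(2)` for `k ≠ 0`. -/
def evenRootsTwo (k l : ℕ) : TwistedType → Set (Weight k l)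
  | evenOdd =>
      strip 1 0 {0} ∪ strip 1 0 (shortSet eps) ∪ strip 1 0 (midSet eps) ∪ strip 2 1 (longSet eps)
  | oddOdd =>
      strip (if k = 1 then 2 else 1) 0 {0} ∪ strip 1 0 (midSet eps) ∪ strip 2 1 (longSet eps)
  | evenEven =>
      strip 2 0 {0} ∪ strip 2 0 (shortSet eps) ∪ strip 2 0 (midSet eps) ∪ strip 4 2 (longSet eps)
  | orth => strip 1 0 {0} ∪ strip 1 0 (shortSet eps) ∪ strip 2 0 (midSet eps)

/-- The root systems `R_0(1)` (index `0`) and `R_0(2)` (index `1`, empty if `k = 0`) of the two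
affine components of the even part. -/
def evenRoots (X : TwistedType) (k l : ℕ) (i : Fin 2) : Set (Weight k l) :=
  if i = 0 then X.evenRootsOne k l else if k = 0 then ∅ else X.evenRootsTwo k l

/-- The finite set `Ṙ` with `R ⊆ Ṙ + ℤ δ`. -/
def dotRoots (k l : ℕ) : TwistedType → Set (Weight k l)
  | evenOdd | evenEven => {0} ∪ shortSet eps ∪ shortSet del ∪ midSet eps ∪ midSet del ∪
      longSet eps ∪ longSet del ∪ mixedSet k l
  | oddOdd => {0} ∪ midSet eps ∪ midSet del ∪ longSet eps ∪ longSet del ∪ mixedSet k l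
  | orth => {0} ∪ shortSet eps ∪ shortSet del ∪ midSet eps ∪ midSet del ∪
      longSet del ∪ mixedSet k l

/-- The finite root system `Ṙ_0(i)`. -/
def dotEvenRoots (X : TwistedType) (k l : ℕ) (i : Fin 2) : Set (Weight k l) :=
  {x ∈ X.dotRoots k l | ∃ σ ∈ zdelta k l, x + σ ∈ X.evenRoots k l i}

end TwistedType

/-! ### Closed and parabolic subsets -/

/-- `P` is a closed subset of `S`. -/
def IsClosedSubset {W : Type*} [AddCommGroup W] (P S : Set W) : Prop :=
  P ⊆ S ∧ (P + P) ∩ S ⊆ P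

/-- `P` is a parabolic subset of `S`. -/
def IsParabolicSubset {W : Type*} [AddCommGroup W] (P S : Set W) : Prop :=
  P ⊆ S ∧ P ∪ -P = S ∧ (P + P) ∩ S ⊆ P

/-! ### Modules -/

/-- A module structure on `M` over a Lie superalgebra, given by the representation map. No
compatible `ℤ/2`-grading of `M` is required. -/
structure LieSuperalgebra.Rep {V : Type*} [AddCommGroup V] [Module ℂ V] (A : LieSuperalgebra V)
    (M : Type*) [AddCommGroup M] [Module ℂ M] where
  toEnd : V →ₗ[ℂ] Module.End ℂ M
  map_br : ∀ {a b : ZMod 2} {x y : V}, x ∈ A.homog a → y ∈ A.homog b →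
    toEnd (A.br x y) = toEnd x * toEnd y - superSign a b • (toEnd y * toEnd x)

namespace TwistedType

variable {X : TwistedType} {k l : ℕ} {M : Type*} [AddCommGroup M] [Module ℂ M]

/-- The weight space `M^μ`. -/
def weightSpace (ρ : (X.alg k l).Rep M) (μ : Weight k l) : Submodule ℂ M where
  carrier := {v | ∀ h, ρ.toEnd (X.cartan k l h) v = μ h • v}
  add_mem' := by
    intro v w hv hw h
    rw [map_add, hv h, hw h, smul_add]
  zero_mem' := by
    intro h
    rw [map_zero, smul_zero]
  smul_mem' := by
    intro c v hv h
    rw [map_smul, hv h, smul_comm]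

open Classical in
/-- `M` is a weight module: it is the direct sum of its weight spaces. -/
def IsWeightModule (ρ : (X.alg k l).Rep M) : Prop := DirectSum.IsInternal (weightSpace ρ)

/-- The support of `M`. -/
def supp (ρ : (X.alg k l).Rep M) : Set (Weight k l) := {μ | weightSpace ρ μ ≠ ⊥}

/-- The set `R^in` of nonzero real roots whose nonzero root vectors act injectively. -/
def rootsIn (ρ : (X.alg k l).Rep M) : Set (Weight k l) :=
  {α ∈ X.realRoots k l | ∀ x ∈ X.rootSpace k l α, x ≠ 0 → Function.Injective (ρ.toEnd x)}

/-- The set `R^ln` of nonzero real roots whose nonzero root vectors act locally nilpotently. -/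
def rootsLn (ρ : (X.alg k l).Rep M) : Set (Weight k l) :=
  {α ∈ X.realRoots k l | ∀ x ∈ X.rootSpace k l α, x ≠ 0 →
    ∀ v : M, ∃ n : ℕ, (ρ.toEnd x ^ n) v = 0}

/-- The set `𝔅_M`. -/
def setB (ρ : (X.alg k l).Rep M) : Set (Weight k l) :=
  {α | α ∈ Submodule.span ℤ (X.roots k l) ∧
    ∀ μ ∈ supp ρ, {n : ℕ | 0 < n ∧ μ + n • α ∈ supp ρ}.Finite}

/-- The set `ℭ_M`. -/
def setC (ρ : (X.alg k l).Rep M) : Set (Weight k l) :=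
  {α | α ∈ Submodule.span ℤ (X.roots k l) ∧ ∀ μ ∈ supp ρ, α + μ ∈ supp ρ}

/-- `M` has shadow. -/
def HasShadow (ρ : (X.alg k l).Rep M) : Prop :=
  X.realRoots k l = rootsIn ρ ∪ rootsLn ρ ∧
    rootsLn ρ = setB ρ ∩ X.realRoots k l ∧ rootsIn ρ = setC ρ ∩ X.realRoots k l

/-- The set `R_{f-ln}` of full-locally nilpotent nonzero real roots. -/
def fullLn (ρ : (X.alg k l).Rep M) : Set (Weight k l) :=
  {α ∈ X.realRoots k l | (({α} : Set (Weight k l)) + zdelta k l) ∩ X.roots k l ⊆ rootsLn ρ}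

/-- The set `R_{f-in}` of full-injective nonzero real roots. -/
def fullIn (ρ : (X.alg k l).Rep M) : Set (Weight k l) :=
  {α ∈ X.realRoots k l | (({α} : Set (Weight k l)) + zdelta k l) ∩ X.roots k l ⊆ rootsIn ρ}

/-- The set `R_hyb` of hybrid nonzero real roots. -/
def hybridRoots (ρ : (X.alg k l).Rep M) : Set (Weight k l) :=
  X.realRoots k l \ (fullLn ρ ∪ fullIn ρ)

/-- The module is hybrid if all nonzero real roots are hybrid. -/
def IsHybrid (ρ : (X.alg k l).Rep M) : Prop := hybridRoots ρ = X.realRoots k l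

/-- The set `P = R_{f-ln} ∪ -R_{f-in} ∪ R_hyb ∪ ℤ δ`. -/
def setP (ρ : (X.alg k l).Rep M) : Set (Weight k l) :=
  fullLn ρ ∪ -fullIn ρ ∪ hybridRoots ρ ∪ zdelta k l

/-- The set `Ṗ_i` of all `x ∈ Ṙ_0(i)` such that `x + m δ ∈ P ∩ R_0(i)` for some integer `m`. -/
def dotP (ρ : (X.alg k l).Rep M) (i : Fin 2) : Set (Weight k l) :=
  {x ∈ X.dotEvenRoots k l i | ∃ m : ℤ, x + m • delta ∈ setP ρ ∩ X.evenRoots k l i}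

end TwistedType
end

/-! The argument trades the action of root vectors for a cone of weights. Let `shiftCone ρ` consist
of the weights having a positive multiple that translates the support into itself. It is closed
under addition and under multiplication and division by positive integers. Shadow then says that a
real root is injective exactly when it lies in the cone and locally nilpotent exactly when it does
not (`mem_rootsIn_iff`, `mem_rootsLn_iff`). This needs a nonempty support, which follows from
properness of `R^ln ∩ R_0(i)` (`supp_nonempty`).

The second tool is symmetry. If neither `α` nor `-α` lies in the cone, an `sl₂`-triple of weights
`±α`, or `±2α` when `α` is odd, acts locally nilpotently. The support is then stable under the
reflection in `α`, and so is the cone on weights of level zero (`exists_supp_reflection`,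
`reflection_mem_shiftCone`). Moreover the Cartan number of an injective root with respect to `α` is
an integer (`cartan_int`).

Next one passes to fibres `x + ℤδ`. The real roots are stable under shifts by `4δ`, and the cone
admits division, so a root is full-injective exactly when its whole fibre lies in the cone,
including the weights that are not roots. Hence the real part of `P` consists of the real `α` such
that `α + ℤδ` inside the cone implies `-α + ℤδ` inside the cone (`mem_setP_iff`). If `α` violates
this, then `-α` satisfies it vacuously, so `P ∪ -P` is everything.

Closedness (`fibreIn_neg_of_add`): let `γ ∈ α + β + ℤδ` with `α, β ∈ P`, and suppose that the fibre
of `γ` lies in the cone but that of `-γ` does not. Adding fibres shows that no weight of `-α + ℤδ`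
or `-β + ℤδ` is in the cone, so neither `α + ℤδ` nor `β + ℤδ` is contained in it. Real roots lie in
a positive or a negative definite block, so `α` or `β` has a positive Cartan number with `γ`.
Reflecting `γ` in a suitable shift of that root and dividing puts the fibre of the other root in the
cone, a contradiction.

Properness (`not_evenRoots_subset_setP`): if every nonempty `R_0(i)` were contained in `P`, a root
that is not hybrid would produce a real root of some `R_0(c)` none of whose shifts by `4ℤδ` is in
the cone. Reflections spread this property to nonorthogonal roots, and `R_0(c)` is connected under
nonorthogonality, so all its real roots would be locally nilpotent, against the hypothesis.

What precedes these arguments is the root system itself, computed from matrices. Up to sign `adj`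
permutes matrix units, so a matrix unit `E_{ij}` carries a root vector of degree `p` exactly under
an arithmetic condition, `Occurs i j p`. This yields the list of real roots, the even `sl₂`-triples,
the equality of the imaginary roots with `ℤδ`, and the link from real roots to `R_0(1)` and
`R_0(2)`. -/

noncomputable section

namespace TwistedType

open LieSuperalgebra SuperMatrix

/-! ### Weights of the natural representation -/

/-- The duality of the index set of one parity. -/
def halfStar {k p : ℕ} : Half k p → Half k p
  | Sum.inl (Sum.inl a) => Sum.inl (Sum.inr a)
  | Sum.inl (Sum.inr a) => Sum.inl (Sum.inl a)
  | Sum.inr o => Sum.inr o.rev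

/-- The duality of the index set: `i` and `star i` are paired by the Gram matrix. -/
def star {X : TwistedType} {k l : ℕ} : X.Idx k l → X.Idx k l := Sum.map halfStar halfStar

/-- The nonzero entries of the rows of the Gram matrix. -/
def gramSign {X : TwistedType} {k l : ℕ} : X.Idx k l → ℂ
  | Sum.inl _ => 1
  | Sum.inr (Sum.inl (Sum.inl _)) => 1
  | Sum.inr (Sum.inl (Sum.inr _)) => -1
  | Sum.inr (Sum.inr _) => 1

/-- The weights of the basis vectors of the natural representation. -/
def wt {X : TwistedType} {k l : ℕ} : X.Idx k l → Weight k l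
  | Sum.inl (Sum.inl (Sum.inl a)) => eps a
  | Sum.inl (Sum.inl (Sum.inr a)) => -eps a
  | Sum.inl (Sum.inr _) => 0
  | Sum.inr (Sum.inl (Sum.inl b)) => del b
  | Sum.inr (Sum.inl (Sum.inr b)) => -del b
  | Sum.inr (Sum.inr _) => 0

/-- The additional basis vectors, of weight zero. -/
def IsExtra {X : TwistedType} {k l : ℕ} : X.Idx k l → Prop
  | Sum.inl (Sum.inl _) => False
  | Sum.inl (Sum.inr _) => True
  | Sum.inr (Sum.inl _) => False
  | Sum.inr (Sum.inr _) => True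

/-- The coefficients of `adj`, see `adj_apply`. -/
def adjCoeff {X : TwistedType} {k l : ℕ} (i j : X.Idx k l) : ℂ :=
  -(gramSign (star i) * gramSign (star j) * superSign (par i) (par i + par j))

variable {X : TwistedType} {k l : ℕ}

/-! ### The index duality and the entries of `adj` -/

theorem halfStar_halfStar {k p : ℕ} (i : Half k p) : halfStar (halfStar i) = i := by
  rcases i with (i | i) | i <;> simp [halfStar]

@[simp] theorem star_star (i : X.Idx k l) : star (star i) = i := by
  rcases i with i | i <;> simp [star, halfStar_halfStar]

theorem star_inj {i j : X.Idx k l} : star i = star j ↔ i = j :=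
  ⟨fun h => by rw [← star_star i, h, star_star], fun h => h ▸ rfl⟩

theorem eq_star_comm {i j : X.Idx k l} : j = star i ↔ i = star j :=
  ⟨fun h => by rw [h, star_star], fun h => by rw [h, star_star]⟩

@[simp] theorem par_star (i : X.Idx k l) : par (star i) = par i := by
  rcases i with i | i <;> rfl

@[simp] theorem wt_star (i : X.Idx k l) : wt (star i) = -wt i := by
  rcases i with ((i | i) | i) | ((i | i) | i) <;> simp [star, halfStar, wt]

theorem gramSign_mul_self (i : X.Idx k l) : gramSign i * gramSign i = 1 := by
  rcases i with ((i | i) | i) | ((i | i) | i) <;> simp [gramSign]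

theorem gram_apply (i j : X.Idx k l) :
    X.gram k l i j = if j = star i then gramSign i else 0 := by
  rcases i with ((i | i) | i) | ((i | i) | i) <;> rcases j with ((j | j) | j) | ((j | j) | j) <;>
    simp [gram, star, halfStar, gramSign, rev, Matrix.one_apply, eq_comm]
  split_ifs <;> simp

theorem diag_eq (h : Cartan k l) : X.diag k l h = Matrix.diagonal (fun i => wt i h) := by
  unfold diag
  congr 1
  funext i
  rcases i with ((i | i) | i) | ((i | i) | i) <;> simp [wt, eps, del]

/-- Each row and column of the Gram matrix has one nonzero entry, at the dual index, so both matrix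
products collapse to a single term. -/
theorem adj_apply (x : X.Mat k l) (i j : X.Idx k l) :
    (X.adj k l).map x i j = adjCoeff i j * x (star j) (star i) := by
  have h1 : ∀ a : X.Idx k l, X.gram k l a i = if a = star i then gramSign (star i) else 0 := by
    intro a
    rw [gram_apply]
    by_cases h : a = star i
    · rw [if_pos h, if_pos (eq_star_comm.1 h), h]
    · rw [if_neg h, if_neg (fun h' => h (eq_star_comm.1 h'))]
  have h2 : ∀ a : X.Idx k l, X.gram k l a j = if a = star j then gramSign (star j) else 0 := by
    intro a
    rw [gram_apply]
    by_cases h : a = star j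
    · rw [if_pos h, if_pos (eq_star_comm.1 h), h]
    · rw [if_neg h, if_neg (fun h' => h (eq_star_comm.1 h'))]
  rw [adj_map, Matrix.neg_apply, Matrix.mul_apply]
  simp only [Matrix.transpose_apply, h1, ite_mul, zero_mul, Finset.sum_ite_eq', Finset.mem_univ,
    if_true, Matrix.mul_apply, h2, mul_ite, mul_zero]
  rw [superT_entry, par_star, par_star, adjCoeff]
  ring

theorem adj_single (i j : X.Idx k l) (c : ℂ) :
    (X.adj k l).map (Matrix.single i j c) =
      Matrix.single (star j) (star i) (adjCoeff (star j) (star i) * c) := by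
  ext a b
  rw [adj_apply, Matrix.single_apply, Matrix.single_apply]
  by_cases h : i = star b ∧ j = star a
  · rw [if_pos h, if_pos ⟨(eq_star_comm.1 h.2).symm, (eq_star_comm.1 h.1).symm⟩, h.1, h.2]
    simp
  · rw [if_neg h, if_neg (fun h' => h ⟨eq_star_comm.1 h'.2.symm, eq_star_comm.1 h'.1.symm⟩),
      mul_zero]

theorem adjCoeff_of_par_eq {i j : X.Idx k l} (h : par i = par j) :
    adjCoeff i j = -(gramSign (star i) * gramSign (star j)) := by
  have h01 : (0 : ZMod 2) ≠ 1 := by decide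
  rw [adjCoeff, h, CharTwo.add_self_eq_zero]
  simp [superSign, h01]

theorem adjCoeff_mul_self (i j : X.Idx k l) : adjCoeff i j * adjCoeff i j = 1 := by
  have h1 := gramSign_mul_self (star i)
  have h2 := gramSign_mul_self (star j)
  have h3 := superSign_mul_self (par i) (par i + par j)
  rw [adjCoeff]
  linear_combination (gramSign (star j) ^ 2 * superSign (par i) (par i + par j) ^ 2) * h1 +
    superSign (par i) (par i + par j) ^ 2 * h2 + h3

/-- The scalar by which the square of `adj` acts on the matrix unit `E_{ij}`. -/
def adjSq (i j : X.Idx k l) : ℂ := adjCoeff i j * adjCoeff (star j) (star i)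

theorem adjSq_comm (i j : X.Idx k l) : adjSq i j = adjSq j i := by
  simp only [adjSq, adjCoeff, star_star, par_star]
  rw [add_comm (par j) (par i)]
  ring

theorem adjSq_star (i j : X.Idx k l) : adjSq (star j) (star i) = adjSq i j := by
  simp only [adjSq, star_star]
  ring

theorem adjSq_mul_self (i j : X.Idx k l) : adjSq i j * adjSq i j = 1 := by
  have h1 := adjCoeff_mul_self i j
  have h2 := adjCoeff_mul_self (star j) (star i)
  rw [adjSq]
  linear_combination adjCoeff (star j) (star i) ^ 2 * h1 + h2

theorem adjSq_star_right (i : X.Idx k l) : adjSq i (star i) = 1 := by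
  rw [adjSq, star_star, adjCoeff_mul_self]

theorem adjCoeff_star_comm (i : X.Idx k l) :
    adjCoeff (star i) i = adjCoeff i (star i) := by
  rw [adjCoeff_of_par_eq (by simp), adjCoeff_of_par_eq (by simp), star_star]
  ring

theorem gramSign_star_extra {j : X.Idx k l} (hj : IsExtra j) :
    gramSign j = 1 ∧ gramSign (star j) = 1 := by
  rcases j with ((j | j) | j) | ((j | j) | j) <;> simp_all [IsExtra, gramSign, star, halfStar]

/-- Compares an odd weight `wt i` with its double: the scalar of the square of `adj` on `E_{ij}` is
the scalar of `adj` itself on `E_{i i*}`. -/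
theorem adjSq_extra {i j : X.Idx k l} (hj : IsExtra j) (hij : par i ≠ par j) :
    adjSq i j = adjCoeff i (star i) := by
  have h01 : (0 : ZMod 2) ≠ 1 := by decide
  have h11 : (1 : ZMod 2) + 1 = 0 := by decide
  rw [adjCoeff_of_par_eq (by simp)]
  simp only [adjSq, adjCoeff, star_star, par_star, gramSign_star_extra hj]
  rcases par_cases (par i) with hi | hi <;> rcases par_cases (par j) with hj | hj <;>
    simp_all [superSign]

/-! ### Degrees in which a matrix unit contributes a root -/

theorem zeta_zpow_four (n : ℤ) : X.zeta ^ (4 * n) = 1 := by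
  rw [zpow_mul]
  have : X.zeta ^ (4 : ℤ) = 1 := by
    cases X <;> simp [zeta] <;> norm_num [zpow_ofNat]
  rw [this, one_zpow]

theorem zeta_zpow_add (p q : ℤ) : X.zeta ^ (p + q) = X.zeta ^ p * X.zeta ^ q :=
  zpow_add₀ X.zeta_ne_zero p q

/-- The condition on `(i, j, p)` for a root vector of the form `(E_{ij} + ⋯) ⊗ t^p` to exist. -/
def Occurs (i j : X.Idx k l) (p : ℤ) : Prop :=
  (X = orth ∧ (IsExtra i ∨ IsExtra j)) ∨
    ((X = orth → Even p) ∧ X.zeta ^ (2 * p) = adjSq i j ∧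
      (j = star i → X.zeta ^ p = adjCoeff i j))

theorem Occurs.swap {i j : X.Idx k l} {p : ℤ} (h : Occurs i j p) : Occurs j i (-p) := by
  rcases h with ⟨h, h'⟩ | ⟨h1, h2, h3⟩
  · exact Or.inl ⟨h, h'.symm⟩
  · refine Or.inr ⟨fun h => by simpa using h1 h, ?_, ?_⟩
    · rw [adjSq_comm, ← h2, mul_neg, zpow_neg]
      have := adjSq_mul_self i j
      rw [← h2] at this
      exact inv_eq_of_mul_eq_one_left this
    · rintro rfl
      have h := h3 (star_star j).symm
      rw [zpow_neg, h, ← adjCoeff_star_comm j]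
      exact inv_eq_of_mul_eq_one_left (adjCoeff_mul_self _ _)

theorem isExtra_star {i : X.Idx k l} : IsExtra (star i) ↔ IsExtra i := by
  rcases i with ((j | j) | j) | ((j | j) | j) <;> simp [IsExtra, star, halfStar]

theorem Occurs.dual {i j : X.Idx k l} {p : ℤ} (h : Occurs i j p) :
    Occurs (star j) (star i) p := by
  rcases h with ⟨h, h'⟩ | ⟨h1, h2, h3⟩
  · exact Or.inl ⟨h, by rw [isExtra_star, isExtra_star]; exact h'.symm⟩
  · refine Or.inr ⟨h1, by rw [adjSq_star, h2], fun h => ?_⟩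
    rw [star_star, eq_comm, eq_star_comm] at h
    rw [← eq_star_comm] at h
    rw [h3 h, h, star_star]

theorem Occurs.add_four {i j : X.Idx k l} {p : ℤ} (h : Occurs i j p) (n : ℤ) :
    Occurs i j (p + 4 * n) := by
  rcases h with h | ⟨h1, h2, h3⟩
  · exact Or.inl h
  · refine Or.inr ⟨fun h => (h1 h).add ⟨2 * n, by ring⟩, ?_, fun h => ?_⟩
    · rw [mul_add, zeta_zpow_add, mul_left_comm, zeta_zpow_four, h2, mul_one]
    · rw [zeta_zpow_add, zeta_zpow_four, h3 h, mul_one]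

/-- By `adjSq_extra` the condition on the odd root `α = wt i + pδ` is the condition for `E_{i i*}`
in degree `2p`. Thus `2α` has an even root vector, on which the `sl₂`-argument for odd real roots
relies. -/
theorem Occurs.double {i j : X.Idx k l} {p : ℤ} (h : Occurs i j p) (hj : IsExtra j)
    (hij : par i ≠ par j) : Occurs i (star i) (2 * p) := by
  have h4 : X.zeta ^ (2 * (2 * p)) = adjSq i (star i) := by
    rw [adjSq_star_right, ← zeta_zpow_four (X := X) p]
    congr 1
    ring
  refine Or.inr ⟨fun _ => even_two_mul p, h4, fun _ => ?_⟩
  rcases h with ⟨rfl, -⟩ | ⟨h1, h2, h3⟩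
  · rw [adjCoeff_of_par_eq (by simp), star_star, zpow_mul]
    rcases i with ((i | i) | i) | ((i | i) | i) <;> rcases j with ((j | j) | j) | ((j | j) | j) <;>
      simp_all [IsExtra, par, zeta, gramSign, star, halfStar]
    -- The surviving cases name an additional odd basis vector, and `D(k+1,ℓ)` has none.
    all_goals first | exact Fin.elim0 (show Fin 0 from i) | exact Fin.elim0 (show Fin 0 from j)
  · rw [h2, adjSq_extra hj hij]

/-! ### Homogeneous elements of the loop algebra -/

/-- The matrices in `carrier` that represent elements of `𝔤^{[p]}`. -/
def eigenMat (X : TwistedType) (k l : ℕ) (p : ℤ) : Submodule ℂ (X.Mat k l) :=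
  X.carrier k l ⊓ (X.autGl k l).eigen X.zeta p

theorem mkQ_scalars_eq_zero (x : X.carrier k l) :
    (X.scalars k l).mkQ x = 0 ↔ (x : X.Mat k l) ∈ Submodule.span ℂ {(1 : X.Mat k l)} :=
  Submodule.Quotient.mk_eq_zero (X.scalars k l)

theorem finAlg_br_mkQ (x y : X.carrier k l) :
    (X.finAlg k l).br ((X.scalars k l).mkQ x) ((X.scalars k l).mkQ y) =
      (X.scalars k l).mkQ ⟨SuperMatrix.br x.1 y.1, X.carrier_closed k l _ x.2 _ y.2⟩ := rfl

theorem aut_mkQ (x : X.carrier k l) :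
    (X.aut k l).map ((X.scalars k l).mkQ x) =
      (X.scalars k l).mkQ ⟨(X.autGl k l).map x.1, X.carrier_stable k l _ x.2⟩ := rfl

/-- The element `x ⊗ t^p` of the twisted algebra. -/
def loopElt (p : ℤ) (x : X.Mat k l) (hx : x ∈ X.eigenMat k l p) : X.Alg k l :=
  ⟨(Finsupp.single p ((X.scalars k l).mkQ ⟨x, hx.1⟩), 0), by
    intro q
    change Finsupp.single p _ q ∈ _
    rw [Finsupp.single_apply]
    split_ifs with h
    · subst h
      exact congrArg (X.scalars k l).mkQ (Subtype.ext hx.2)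
    · exact zero_mem _⟩

theorem loopElt_ne_zero {p : ℤ} {x : X.Mat k l} (hx : x ∈ X.eigenMat k l p)
    (h : x ∉ Submodule.span ℂ {(1 : X.Mat k l)}) : loopElt p x hx ≠ 0 := by
  intro h0
  have h1 : Finsupp.single p ((X.scalars k l).mkQ ⟨x, hx.1⟩) = 0 :=
    congrArg (fun u : X.Alg k l => u.1.1) h0
  rw [Finsupp.single_eq_zero] at h1
  exact h ((mkQ_scalars_eq_zero _).1 h1)

theorem notMem_span_one {x : X.Mat k l} {i j : X.Idx k l} (hij : i ≠ j) (h : x i j ≠ 0) :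
    x ∉ Submodule.span ℂ {(1 : X.Mat k l)} := by
  intro hx
  obtain ⟨c, rfl⟩ := Submodule.mem_span_singleton.1 hx
  exact h (by simp [Matrix.one_apply_ne hij])

theorem notMem_span_one_of_diag {x : X.Mat k l} {i j : X.Idx k l} (h : x i i ≠ x j j) :
    x ∉ Submodule.span ℂ {(1 : X.Mat k l)} := by
  intro hx
  obtain ⟨c, rfl⟩ := Submodule.mem_span_singleton.1 hx
  exact h (by simp)

theorem diag_even (h : Cartan k l) : X.diag k l h ∈ SuperMatrix.homog _ _ 0 := by
  intro i j hij
  rw [diag_eq, Matrix.diagonal_apply_ne]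
  rintro rfl
  exact hij (CharTwo.add_self_eq_zero _)

theorem br_diag_apply (h : Cartan k l) (x : X.Mat k l) (i j : X.Idx k l) :
    SuperMatrix.br (X.diag k l h) x i j = (wt i h - wt j h) * x i j := by
  change (X.diag k l h * x - x * X.diag k l h +
    (2 : ℂ) • (oddPart x * oddPart (X.diag k l h))) i j = _
  rw [oddPart_of_even (diag_even h), mul_zero, smul_zero, add_zero, diag_eq, Matrix.sub_apply,
    Matrix.diagonal_mul, Matrix.mul_diagonal]
  ring

theorem diag_mem_eigenMat (h : Cartan k l) {p : ℤ} (hp : X.zeta ^ p = 1) :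
    X.diag k l h ∈ X.eigenMat k l p := by
  refine ⟨X.diag_mem k l h, ?_⟩
  change _ = X.zeta ^ p • _
  rw [hp, one_smul]
  exact X.diag_fixed k l h

theorem br_loopElt {p q : ℤ} {x y z : X.Mat k l} (hx : x ∈ X.eigenMat k l p)
    (hy : y ∈ X.eigenMat k l q) (hz : SuperMatrix.br x y = z) (hz' : z ∈ X.carrier k l) :
    ((X.alg k l).br (loopElt p x hx) (loopElt q y hy) : (ℤ →₀ X.FinSpace k l) × ℂ × ℂ) =
      (Finsupp.single (p + q) ((X.scalars k l).mkQ ⟨z, hz'⟩),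
        if p + q = 0 then (p : ℂ) * str (x * y) else 0, 0) := by
  subst hz
  change ((X.finAlg k l).loopBr (Finsupp.single p _) (Finsupp.single q _) + (0 : ℂ) • _ -
    (0 : ℂ) • _, (X.finForm k l).cocycle (Finsupp.single p _) (Finsupp.single q _), (0 : ℂ)) = _
  rw [loopBr_single, cocycle_single, zero_smul, zero_smul, add_zero, sub_zero]
  rfl

theorem br_cartan_loopElt {p : ℤ} {x : X.Mat k l} (hx : x ∈ X.eigenMat k l p) (h : Cartan k l)
    {c : ℂ} (hc : SuperMatrix.br (X.diag k l h) x = c • x) :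
    (X.alg k l).br (X.cartan k l h) (loopElt p x hx) =
      (c + p * h.2.2.2) • loopElt p x hx := by
  refine Subtype.ext ?_
  change ((X.finAlg k l).loopBr (Finsupp.single 0 _) (Finsupp.single p _) +
    h.2.2.2 • loopDeg _ (Finsupp.single p _) - (0 : ℂ) • _,
    (X.finForm k l).cocycle (Finsupp.single 0 _) (Finsupp.single p _), (0 : ℂ)) =
    (_ • Finsupp.single p _, _ • (0 : ℂ × ℂ))
  have e : (X.finAlg k l).br (X.finCartan k l h) ((X.scalars k l).mkQ ⟨x, hx.1⟩) =
      c • (X.scalars k l).mkQ ⟨x, hx.1⟩ := by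
    rw [← map_smul]
    exact (finAlg_br_mkQ _ _).trans (congrArg (X.scalars k l).mkQ (Subtype.ext hc))
  rw [loopBr_single, cocycle_single, loopDeg_single, e]
  generalize (X.scalars k l).mkQ ⟨x, hx.1⟩ = y
  ext1
  · simp [add_smul, smul_smul, mul_comm]
  · simp

theorem loopElt_mem_rootSpace {p : ℤ} {x : X.Mat k l} (hx : x ∈ X.eigenMat k l p)
    {ω : Weight k l} (h : ∀ i j, x i j ≠ 0 → wt i - wt j = ω) :
    loopElt p x hx ∈ X.rootSpace k l (ω + p • delta) := by
  intro c
  rw [br_cartan_loopElt hx c (c := ω c)]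
  · simp [delta]
  · ext i j
    rw [br_diag_apply, Matrix.smul_apply, smul_eq_mul]
    by_cases hij : x i j = 0
    · rw [hij, mul_zero, mul_zero]
    · rw [← h i j hij]; rfl

theorem loopElt_even {p : ℤ} {x : X.Mat k l} (hx : x ∈ X.eigenMat k l p)
    (h : x ∈ SuperMatrix.homog _ _ 0) : loopElt p x hx ∈ (X.alg k l).homog 0 := by
  change _ ∈ (X.finAlg k l).affineHomog 0
  rw [mem_affineHomog]
  refine ⟨fun q => ?_, fun h => (h rfl).elim⟩
  change Finsupp.single p _ q ∈ _
  rw [Finsupp.single_apply]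
  split_ifs with hq
  · exact ⟨⟨x, hx.1⟩, h, rfl⟩
  · exact zero_mem _

/-! ### Restrictions on roots -/

/-- The permutation of the index set given by `swap`. -/
def swapIdx : X.Idx k l → X.Idx k l := Sum.map (Sum.map id Fin.rev) id

theorem swap_apply (i j : X.Idx k l) :
    X.swap k l i j = if j = swapIdx i then 1 else 0 := by
  rcases i with ((i | i) | i) | ((i | i) | i) <;> rcases j with ((j | j) | j) | ((j | j) | j) <;>
    simp [swap, swapIdx, rev, Matrix.one_apply, eq_comm]

theorem swapConj_apply (x : X.Mat k l) (i j : X.Idx k l) :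
    (X.swapConj k l).map x i j = x (swapIdx i) (swapIdx j) := by
  rw [swapConj_map, Matrix.mul_apply]
  simp only [swap_apply, ite_mul, one_mul, zero_mul, Finset.sum_ite_eq', Finset.mem_univ,
    if_true, Matrix.mul_apply, Matrix.transpose_apply, mul_ite, mul_one, mul_zero]

theorem swapIdx_swapIdx (i : X.Idx k l) : swapIdx (swapIdx i) = i := by
  rcases i with (i | i) | i <;> simp [swapIdx]

theorem swapIdx_of_not_isExtra {i : X.Idx k l} (h : ¬ IsExtra i) : swapIdx i = i := by
  rcases i with ((i | i) | i) | ((i | i) | i) <;> simp_all [swapIdx, IsExtra]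

theorem wt_swapIdx (i : X.Idx k l) : wt (swapIdx i) = wt i := by
  rcases i with ((i | i) | i) | ((i | i) | i) <;> simp [swapIdx, wt]

theorem swapConj_single (i j : X.Idx k l) (c : ℂ) :
    (X.swapConj k l).map (Matrix.single i j c) =
      Matrix.single (swapIdx i) (swapIdx j) c := by
  ext a b
  rw [swapConj_apply, Matrix.single_apply, Matrix.single_apply]
  have h1 : i = swapIdx a ↔ swapIdx i = a :=
    ⟨fun h => by rw [h, swapIdx_swapIdx], fun h => by rw [← h, swapIdx_swapIdx]⟩
  have h2 : j = swapIdx b ↔ swapIdx j = b :=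
    ⟨fun h => by rw [h, swapIdx_swapIdx], fun h => by rw [← h, swapIdx_swapIdx]⟩
  simp only [h1, h2]

/-- `adj` exchanges the lines of `E_{ij}` and `E_{j* i*}`, and its square acts on them by `adjSq i
j`; an eigenvalue is therefore a square root of that scalar. When `j = i*` the lines coincide and
the eigenvalue is `adjCoeff i j`. -/
theorem occurs_of_adj {x : X.Mat k l} {p : ℤ} {i j : X.Idx k l} (hij : i ≠ j) (h : x i j ≠ 0)
    (hx : ∀ a b, a ≠ b → (X.adj k l).map x a b = X.zeta ^ p * x a b) (hp : X = orth → Even p) :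
    Occurs i j p := by
  have h1 := hx i j hij
  have h2 := hx (star j) (star i) (fun h => hij (star_inj.1 h).symm)
  rw [adj_apply] at h1 h2
  rw [star_star, star_star] at h2
  refine Or.inr ⟨hp, ?_, ?_⟩
  · rw [two_mul, zeta_zpow_add, adjSq]
    refine mul_right_cancel₀ h ?_
    linear_combination (-adjCoeff i j) * h2 - X.zeta ^ p * h1
  · rintro rfl
    rw [star_star] at h1
    exact (mul_right_cancel₀ h h1).symm

theorem even_of_neg_one_zpow {p : ℤ} (h : (-1 : ℂ) ^ p = 1) : Even p := by
  by_contra hp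
  rw [Int.not_even_iff_odd] at hp
  rw [hp.neg_one_zpow] at h
  norm_num at h

theorem occurs_of_mem {x : X.Mat k l} {p : ℤ} {i j : X.Idx k l} (hij : i ≠ j) (h : x i j ≠ 0)
    (hx : x ∈ X.carrier k l)
    (hσ : (X.autGl k l).map x - X.zeta ^ p • x ∈ Submodule.span ℂ {(1 : X.Mat k l)}) :
    Occurs i j p := by
  have hoff : ∀ a b, a ≠ b → (X.autGl k l).map x a b = X.zeta ^ p * x a b := by
    intro a b hab
    obtain ⟨c, hc⟩ := Submodule.mem_span_singleton.1 hσ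
    have := congrFun (congrFun hc a) b
    rw [Matrix.smul_apply, Matrix.one_apply_ne hab, smul_zero, Matrix.sub_apply,
      Matrix.smul_apply, smul_eq_mul] at this
    exact sub_eq_zero.1 this.symm
  cases X
  · exact occurs_of_adj hij h hoff (by simp)
  · exact occurs_of_adj hij h hoff (by simp)
  · exact occurs_of_adj hij h hoff (by simp)
  · by_cases he : IsExtra i ∨ IsExtra j
    · exact Or.inl ⟨rfl, he⟩
    · rw [not_or] at he
      have h1 : orth.zeta ^ p = 1 := by
        have := hoff i j hij
        rw [autGl, swapConj_apply, swapIdx_of_not_isExtra he.1, swapIdx_of_not_isExtra he.2] at this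
        exact (mul_right_cancel₀ h (this.symm.trans (one_mul _).symm))
      refine occurs_of_adj hij h (fun a b _ => ?_) (fun _ => even_of_neg_one_zpow h1)
      rw [h1, one_mul, show (orth.adj k l).map x = x from sub_eq_zero.1 hx]

/-- A nonzero off-diagonal entry of some coefficient of a root vector determines the root. If
instead a coefficient is diagonal, it commutes with `𝔥`, and only multiples of `δ` remain.
Throughout, equations in `𝔤` lift to matrices up to scalars. -/
theorem exists_of_mem_roots {α : Weight k l} (hα : α ∈ X.roots k l) :
    (∃ p : ℤ, α = p • delta) ∨
      ∃ (i j : X.Idx k l) (p : ℤ), i ≠ j ∧ α = wt i - wt j + p • delta ∧ Occurs i j p := by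
  obtain ⟨⟨⟨x, w⟩, hx⟩, hu, hne⟩ := Submodule.exists_mem_ne_zero_of_ne_bot hα
  by_cases h0 : α = 0
  · exact Or.inl ⟨0, by simp [h0]⟩
  have key : ∀ h, (X.finAlg k l).loopBr (Finsupp.single 0 (X.finCartan k l h)) x +
      h.2.2.2 • loopDeg _ x - w.2 • loopDeg _ (Finsupp.single 0 (X.finCartan k l h)) = α h • x ∧
      ((X.finForm k l).cocycle (Finsupp.single 0 (X.finCartan k l h)) x, (0 : ℂ)) = α h • w := by
    intro h
    have := congrArg Subtype.val (hu h)
    exact ⟨congrArg Prod.fst this, congrArg Prod.snd this⟩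
  -- A bracket with an element of `𝔥` has no component along `d`, and none along `c` because the
  -- cocycle vanishes on degree zero. Hence a root vector of nonzero weight has no component in `ℂc
  -- ⊕ ℂd`.
  have hw : w = 0 := by
    obtain ⟨h, hh⟩ : ∃ h, α h ≠ 0 := by
      by_contra! H
      exact h0 (LinearMap.ext H)
    have := (key h).2
    have hc : (X.finForm k l).cocycle (Finsupp.single 0 (X.finCartan k l h)) x = 0 := by
      simp [InvForm.cocycle]
    rw [hc, eq_comm, ← Prod.zero_eq_mk, smul_eq_zero] at this
    exact this.resolve_left hh
  subst hw
  have hx0 : x ≠ 0 := by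
    rintro rfl
    exact hne rfl
  obtain ⟨p, hp⟩ : ∃ p, x p ≠ 0 := by
    by_contra! H
    exact hx0 (Finsupp.ext H)
  obtain ⟨⟨y, hy⟩, hyx⟩ := (X.scalars k l).mkQ_surjective (x p)
  have hloop : ∀ (H : X.FinSpace k l) (x : ℤ →₀ X.FinSpace k l) (p : ℤ),
      (X.finAlg k l).loopBr (Finsupp.single 0 H) x p = (X.finAlg k l).br H (x p) := by
    intro H x p
    induction x using Finsupp.induction_linear with
    | zero => simp
    | add x y hx hy => simp [hx, hy]
    | single q x =>
      rw [loopBr_single, zero_add]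
      by_cases h : q = p
      · subst h; simp
      · simp [h]
  -- The eigenvector equation for the coefficient of `t^p`, lifted to matrices; `c` is the ambiguity
  -- coming from the quotient by scalars.
  have hbr : ∀ h : Cartan k l, ∃ c : ℂ, ∀ i j, (wt i h - wt j h) * y i j -
      (α h - p * h.2.2.2) * y i j = c * (1 : X.Mat k l) i j := by
    intro h
    have h1 := congrArg (fun f => f p) (key h).1
    simp only [Finsupp.coe_add, Pi.add_apply, Prod.snd_zero,
      zero_smul, sub_zero, hloop, Finsupp.smul_apply, loopDeg_apply] at h1
    rw [← hyx] at h1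
    have h2 : (X.scalars k l).mkQ (⟨SuperMatrix.br (X.diag k l h) y,
        X.carrier_closed k l _ (X.diag_mem k l h) _ hy⟩ - (α h - p * h.2.2.2) • ⟨y, hy⟩) = 0 := by
      rw [map_sub, map_smul, sub_smul, ← h1, mul_comm, ← smul_smul, add_sub_cancel_right]
      exact sub_eq_zero.2 (finAlg_br_mkQ ⟨_, X.diag_mem k l h⟩ ⟨y, hy⟩).symm
    obtain ⟨c, hc⟩ := Submodule.mem_span_singleton.1 ((mkQ_scalars_eq_zero _).1 h2)
    refine ⟨c, fun i j => ?_⟩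
    have := congrFun (congrFun hc i) j
    rw [← br_diag_apply]
    exact this.symm
  have hev : ∀ {ω : Weight k l}, (∀ h, ω h - (α h - p * h.2.2.2) = 0) → α = ω + p • delta := by
    intro ω H
    refine LinearMap.ext fun h => ?_
    have := H h
    simp only [LinearMap.add_apply, LinearMap.smul_apply, delta, LinearMap.comp_apply,
      LinearMap.snd_apply, zsmul_eq_mul]
    linear_combination -this
  by_cases hd : ∃ i j, i ≠ j ∧ y i j ≠ 0
  · obtain ⟨i, j, hij, hyij⟩ := hd
    refine Or.inr ⟨i, j, p, hij, hev fun h => ?_, occurs_of_mem hij hyij hy ?_⟩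
    · obtain ⟨c, hc⟩ := hbr h
      have := hc i j
      rw [Matrix.one_apply_ne hij, mul_zero, ← sub_mul] at this
      simpa [hyij] using this
    · have h1 : (X.aut k l).map (x p) = X.zeta ^ p • x p := hx p
      rw [← hyx, aut_mkQ, ← map_smul, ← sub_eq_zero, ← map_sub] at h1
      exact (mkQ_scalars_eq_zero _).1 h1
  · push Not at hd
    refine Or.inl ⟨p, ?_⟩
    by_contra hne'
    obtain ⟨h, hh⟩ : ∃ h : Cartan k l, α h - p * h.2.2.2 ≠ 0 := by
      by_contra! H
      refine hne' ((hev (ω := 0) fun h => ?_).trans (zero_add _))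
      rw [H h]; simp
    obtain ⟨c, hc⟩ := hbr h
    refine hp ?_
    rw [← hyx]
    -- On the diagonal the equation reads `-(α(h) - p h_d) y_{ii} = c` with a nonzero factor, where
    -- `h_d` is the `d`-coordinate of `h`. So `y` is a scalar matrix and its class vanishes.
    refine (mkQ_scalars_eq_zero _).2 (Submodule.mem_span_singleton.2
      ⟨-c / (α h - p * h.2.2.2), ?_⟩)
    ext i j
    change _ * (1 : X.Mat k l) i j = y i j
    by_cases hij : i = j
    · subst hij
      have := hc i i
      rw [Matrix.one_apply_eq] at this ⊢
      field_simp
      linear_combination this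
    · rw [Matrix.one_apply_ne hij, hd i j hij, mul_zero]

/-! ### Root vectors -/

/-- The matrix `ζ^p E_{ij} + a E_{j* i*}` which is an eigenvector of `adj`. -/
def rootMat (i j : X.Idx k l) (p : ℤ) : X.Mat k l :=
  Matrix.single i j (X.zeta ^ p) +
    Matrix.single (star j) (star i) (adjCoeff (star j) (star i))

theorem adj_rootMat {i j : X.Idx k l} {p : ℤ} (h : X.zeta ^ (2 * p) = adjSq i j) :
    (X.adj k l).map (rootMat i j p) = X.zeta ^ p • rootMat i j p := by
  have h' : adjCoeff i j * adjCoeff (star j) (star i) = X.zeta ^ p * X.zeta ^ p := by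
    rw [← zeta_zpow_add, ← two_mul, h, adjSq]
  rw [rootMat, map_add, adj_single, adj_single, star_star, star_star, h', add_comm, smul_add,
    Matrix.smul_single, Matrix.smul_single, smul_eq_mul, smul_eq_mul,
    mul_comm (X.zeta ^ p) (adjCoeff _ _)]

theorem rootMat_apply_ne {i j a b : X.Idx k l} {p : ℤ} (h : rootMat i j p a b ≠ 0) :
    (a = i ∧ b = j) ∨ (a = star j ∧ b = star i) := by
  by_contra H
  rw [not_or] at H
  refine h ?_
  rw [rootMat, Matrix.add_apply, Matrix.single_apply, Matrix.single_apply,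
    if_neg (fun h => H.1 ⟨h.1.symm, h.2.symm⟩), if_neg (fun h => H.2 ⟨h.1.symm, h.2.symm⟩),
    add_zero]

/-- Cancellation can only occur for `j = i*`, where the two matrix units of `rootMat` coincide. The
hypothesis makes their coefficients equal, so they add up. -/
theorem rootMat_self_ne_zero {i j : X.Idx k l} {p : ℤ}
    (h : j = star i → X.zeta ^ p = adjCoeff i j) : rootMat i j p i j ≠ 0 := by
  rw [rootMat, Matrix.add_apply, Matrix.single_apply_same, Matrix.single_apply]
  have hz : X.zeta ^ p ≠ 0 := zpow_ne_zero _ X.zeta_ne_zero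
  split_ifs with hs
  · have : j = star i := eq_star_comm.1 hs.1.symm ▸ rfl
    subst this
    rw [star_star, ← h rfl, ← two_mul]
    exact mul_ne_zero two_ne_zero hz
  · rwa [add_zero]

theorem str_single_of_ne {i j : X.Idx k l} (h : i ≠ j) (c : ℂ) :
    str (Matrix.single i j c) = 0 := by
  rw [str_eq]
  refine Finset.sum_eq_zero fun a _ => ?_
  rw [Matrix.single_apply, if_neg, mul_zero]
  rintro ⟨rfl, rfl⟩
  exact h rfl

theorem zeta_zpow_even_orth {p : ℤ} (h : Even p) : orth.zeta ^ p = 1 := h.neg_one_zpow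

theorem rootMat_mem {i j : X.Idx k l} {p : ℤ} (hij : i ≠ j) (he : X = orth → Even p)
    (hs : X = orth → ¬ IsExtra i ∧ ¬ IsExtra j) (h : X.zeta ^ (2 * p) = adjSq i j) :
    rootMat i j p ∈ X.eigenMat k l p := by
  have h1 := adj_rootMat h
  have h2 : str (rootMat i j p) = 0 := by
    rw [rootMat, map_add, str_single_of_ne hij,
      str_single_of_ne (fun h => hij (star_inj.1 h).symm), add_zero]
  cases X
  · exact ⟨h2, h1⟩
  · exact ⟨h2, h1⟩
  · exact ⟨h2, h1⟩
  · have hz := zeta_zpow_even_orth (he rfl)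
    rw [hz, one_smul] at h1
    refine ⟨sub_eq_zero.2 h1, ?_⟩
    change (orth.swapConj k l).map _ = orth.zeta ^ p • _
    have hi := (hs rfl).1
    have hj := (hs rfl).2
    rw [hz, one_smul, rootMat, map_add, swapConj_single, swapConj_single,
      swapIdx_of_not_isExtra hi, swapIdx_of_not_isExtra hj,
      swapIdx_of_not_isExtra (mt isExtra_star.1 hi), swapIdx_of_not_isExtra (mt isExtra_star.1 hj)]

/-- The root vectors of `D(k+1,ℓ)` which involve the additional basis vectors. -/
def orthMat (i j : orth.Idx k l) (p : ℤ) : orth.Mat k l :=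
  rootMat i j 0 + orth.zeta ^ p • (orth.swapConj k l).map (rootMat i j 0)

/-- For the involution `s = swapConj`, the element `x + ζ^p s(x)` is an eigenvector of eigenvalue
`ζ^p = ±1`. It remains fixed by `adj`, since `adj` fixes `x` and commutes with `s`. -/
theorem orthMat_mem {i j : orth.Idx k l} {p : ℤ} (h : adjSq i j = 1) :
    orthMat i j p ∈ orth.eigenMat k l p := by
  have h1 : (orth.adj k l).map (rootMat i j 0) = rootMat i j 0 := by
    rw [adj_rootMat (by simp [h]), zpow_zero, one_smul]
  have hz : orth.zeta ^ p * orth.zeta ^ p = 1 := by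
    rw [← mul_zpow]; simp [zeta]
  have hss : ∀ x, (orth.swapConj k l).map ((orth.swapConj k l).map x) = x := by
    intro x
    ext a b
    rw [swapConj_apply, swapConj_apply, swapIdx_swapIdx, swapIdx_swapIdx]
  constructor
  · change (orth.adj k l).map _ - _ = 0
    rw [orthMat, map_add, map_smul, adj_swapConj, h1, LinearMap.id_apply, sub_self]
  · change (orth.swapConj k l).map _ = orth.zeta ^ p • _
    rw [orthMat, map_add, map_smul, hss, smul_add, smul_smul, hz, one_smul, add_comm]

theorem adjSq_orth {i j : orth.Idx k l} (hj : IsExtra j) : adjSq i j = 1 := by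
  have h01 : (0 : ZMod 2) ≠ 1 := by decide
  have h11 : (1 : ZMod 2) + 1 = 0 := by decide
  rcases i with ((i | i) | i) | ((i | i) | i) <;> rcases j with ((j | j) | j) | ((j | j) | j) <;>
    simp_all [IsExtra, adjSq, adjCoeff, star, halfStar, superSign, par, gramSign] <;>
    first | exact Fin.elim0 (show Fin 0 from i) | exact Fin.elim0 (show Fin 0 from j)

theorem star_ne_of_extra {j : orth.Idx k l} (hj : IsExtra j) : star j ≠ j := by
  rcases j with ((j | j) | j) | ((j | j) | j)
  · exact hj.elim
  · exact hj.elim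
  · change Fin 2 at j
    intro h
    have : j.rev = j := Sum.inr.inj (Sum.inl.inj h)
    fin_cases j <;> simp [Fin.rev] at this
  · exact hj.elim
  · exact hj.elim
  · exact Fin.elim0 (show Fin 0 from j)

theorem swapIdx_of_isExtra {j : orth.Idx k l} (hj : IsExtra j) : swapIdx j = star j := by
  rcases j with ((j | j) | j) | ((j | j) | j)
  · exact hj.elim
  · exact hj.elim
  · rfl
  · exact hj.elim
  · exact hj.elim
  · exact Fin.elim0 (show Fin 0 from j)

theorem orthMat_eq {i j : orth.Idx k l} (p : ℤ) (hi : ¬ IsExtra i) (hj : IsExtra j) :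
    orthMat i j p = Matrix.single i j 1 +
      Matrix.single (star j) (star i) (adjCoeff (star j) (star i)) +
      orth.zeta ^ p • (Matrix.single i (star j) 1 +
        Matrix.single j (star i) (adjCoeff (star j) (star i))) := by
  have hj' : swapIdx (star j) = j := by rw [← swapIdx_of_isExtra hj, swapIdx_swapIdx]
  rw [orthMat, rootMat, map_add, swapConj_single, swapConj_single, hj', swapIdx_of_isExtra hj,
    swapIdx_of_not_isExtra hi, swapIdx_of_not_isExtra (mt isExtra_star.1 hi), zpow_zero]

theorem orthMat_self {i j : orth.Idx k l} (p : ℤ) (hi : ¬ IsExtra i) (hj : IsExtra j) :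
    orthMat i j p i j ≠ 0 := by
  have h1 : star j ≠ i := fun h => hi (h ▸ isExtra_star.2 hj)
  have h2 : j ≠ i := fun h => hi (h ▸ hj)
  rw [orthMat_eq p hi hj]
  simp [h1, h2, star_ne_of_extra hj]

theorem isExtra_of_wt_eq_zero {i : X.Idx k l} (h : IsExtra i) : wt i = 0 := by
  rcases i with ((i | i) | i) | ((i | i) | i) <;> simp_all [IsExtra, wt]

theorem rootMat_wt {i j a b : X.Idx k l} {p : ℤ} (h : rootMat i j p a b ≠ 0) :
    wt a - wt b = (wt i - wt j : Weight k l) := by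
  rcases rootMat_apply_ne h with ⟨rfl, rfl⟩ | ⟨rfl, rfl⟩
  · rfl
  · rw [wt_star, wt_star]; abel

theorem orthMat_wt {i j a b : orth.Idx k l} {p : ℤ} (h : orthMat i j p a b ≠ 0) :
    wt a - wt b = (wt i - wt j : Weight k l) := by
  by_cases h1 : rootMat i j 0 a b = 0
  · rw [orthMat, Matrix.add_apply, h1, zero_add, Matrix.smul_apply, swapConj_apply] at h
    rw [← wt_swapIdx a, ← wt_swapIdx b]
    exact rootMat_wt (right_ne_zero_of_smul h)
  · exact rootMat_wt h1

/-- In the orthosymplectic case one can assume that an additional basis vector stands second. -/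
theorem orth_extra_cases {i j : orth.Idx k l} (hw : wt i ≠ wt j) (h : IsExtra i ∨ IsExtra j) :
    (¬ IsExtra i ∧ IsExtra j) ∨ (¬ IsExtra (star j) ∧ IsExtra (star i)) := by
  rw [isExtra_star, isExtra_star]
  by_cases hi : IsExtra i <;> by_cases hj : IsExtra j
  · exact (hw (by rw [isExtra_of_wt_eq_zero hi, isExtra_of_wt_eq_zero hj])).elim
  · exact Or.inr ⟨hj, hi⟩
  · exact Or.inl ⟨hi, hj⟩
  · simp_all

theorem mem_roots_of_mat {p : ℤ} {x : X.Mat k l} (hx : x ∈ X.eigenMat k l p) {ω : Weight k l}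
    (h : ∀ i j, x i j ≠ 0 → wt i - wt j = ω) (h1 : x ∉ Submodule.span ℂ {(1 : X.Mat k l)}) :
    ω + p • delta ∈ X.roots k l :=
  (Submodule.ne_bot_iff _).2 ⟨_, loopElt_mem_rootSpace hx h, loopElt_ne_zero hx h1⟩

/-- Converse to `exists_of_mem_roots`. The root vector is `rootMat`, except when the orthosymplectic
swap moves an index; then it is `orthMat`, whose nonvanishing uses that exactly one index is
additional, hence the condition on weights. -/
theorem Occurs.mem_roots {i j : X.Idx k l} {p : ℤ} (h : Occurs i j p) (hij : i ≠ j)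
    (hw : X = orth → wt i ≠ wt j) : wt i - wt j + p • delta ∈ X.roots k l := by
  by_cases hs : X = orth → ¬ IsExtra i ∧ ¬ IsExtra j
  · have h' : (X = orth → Even p) ∧ X.zeta ^ (2 * p) = adjSq i j ∧
        (j = star i → X.zeta ^ p = adjCoeff i j) := by
      rcases h with ⟨h, h'⟩ | h
      · have := hs h
        tauto
      · exact h
    exact mem_roots_of_mat (rootMat_mem hij h'.1 hs h'.2.1) (fun _ _ => rootMat_wt)
      (notMem_span_one hij (rootMat_self_ne_zero h'.2.2))
  · have : X = orth := by tauto
    subst this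
    rcases orth_extra_cases (hw rfl) (by tauto) with ⟨hi, hj⟩ | ⟨hj, hi⟩
    · exact mem_roots_of_mat (orthMat_mem (adjSq_orth hj)) (fun _ _ => orthMat_wt)
        (notMem_span_one hij (orthMat_self p hi hj))
    · have e : (wt i - wt j : Weight k l) = wt (star j) - wt (star i) := by
        rw [wt_star, wt_star]; abel
      rw [e]
      exact mem_roots_of_mat (orthMat_mem (adjSq_orth hi)) (fun _ _ => orthMat_wt)
        (notMem_span_one (fun h => hij (star_inj.1 h).symm) (orthMat_self p hj hi))

/-! ### `𝔰𝔩₂`-triples -/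

/-- Every coordinate of `𝔥` sits on two dual basis vectors, so the supertrace form counts it twice,
with the sign of the parity; inverting gives `sgn i / 2`. An additional index has weight zero, which
agrees with the right side only if the index is self-dual. -/
theorem diag_toCartan_wt {i : X.Idx k l} (h : ¬ IsExtra i ∨ star i = i) :
    X.diag k l (toCartan (wt i)) =
      (sgn i / 2) • (Matrix.single i i 1 - Matrix.single (star i) (star i) 1) := by
  by_cases he : IsExtra i
  · rw [h.resolve_left (not_not.2 he), isExtra_of_wt_eq_zero he, sub_self, smul_zero, diag_eq]
    have : toCartan (0 : Weight k l) = 0 := by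
      ext <;> simp [toCartan]
    rw [this]
    simp
  · ext a b
    rw [diag_eq, Matrix.smul_apply, Matrix.sub_apply, Matrix.single_apply, Matrix.single_apply,
      Matrix.diagonal_apply]
    rcases i with ((i | i) | i) | ((i | i) | i) <;> rcases a with ((a | a) | a) | ((a | a) | a) <;>
    rcases b with ((b | b) | b) | ((b | b) | b) <;>
      simp_all [IsExtra, wt, toCartan, eps, del, star, halfStar, sgn, Pi.single_apply] <;>
      grind

theorem toCartan_sub (α β : Weight k l) : toCartan (α - β) = toCartan α - toCartan β := by
  ext <;> simp [toCartan] <;> ring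

theorem diag_sub (h h' : Cartan k l) : X.diag k l (h - h') = X.diag k l h - X.diag k l h' := by
  rw [diag_eq, diag_eq, diag_eq, Matrix.diagonal_sub]
  simp

theorem br_of_even {x y : X.Mat k l} (hx : x ∈ SuperMatrix.homog _ _ 0) :
    SuperMatrix.br x y = x * y - y * x := by
  change x * y - y * x + (2 : ℂ) • (oddPart y * oddPart x) = _
  rw [oddPart_of_even hx, mul_zero, smul_zero, add_zero]

theorem br_rootMat {i j : X.Idx k l} {p : ℤ} (hij : i ≠ j) (hpar : par i = par j)
    (h : j = star i → X.zeta ^ p = adjCoeff i j) (hi : ¬ IsExtra i ∨ star i = i)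
    (hj : ¬ IsExtra j ∨ star j = j) :
    ∃ c : ℂ, c ≠ 0 ∧ rootMat i j p * rootMat j i (-p) - rootMat j i (-p) * rootMat i j p =
      c • X.diag k l (toCartan (wt i - wt j)) := by
  have hz : X.zeta ^ p ≠ 0 := zpow_ne_zero _ X.zeta_ne_zero
  have hs : ∀ i : X.Idx k l, sgn i * sgn i = 1 := by rintro (i | i) <;> simp [sgn]
  have hsij : sgn i = sgn j := by
    rcases i with i | i <;> rcases j with j | j <;> simp_all [sgn, par]
  have hs0 : sgn i ≠ 0 := by
    intro h; simpa [h] using hs i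
  have hA : adjCoeff (star j) (star i) * adjCoeff (star i) (star j) = 1 := by
    rw [adjCoeff_of_par_eq (by simp [hpar]), adjCoeff_of_par_eq (by simp [hpar]), star_star,
      star_star]
    linear_combination (gramSign j * gramSign j) * gramSign_mul_self i + gramSign_mul_self j
  rw [toCartan_sub, diag_sub, diag_toCartan_wt hi, diag_toCartan_wt hj, ← hsij]
  by_cases hji : j = star i
  · subst hji
    -- Here `rootMat` is `2 ζ^p E_{i i*}`, so the commutator is `4 (E_{ii} - E_{i*i*})`, while the
    -- weight `2 wt i` is represented by `sgn i (E_{ii} - E_{i*i*})`.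
    refine ⟨4 * sgn i, mul_ne_zero (by norm_num) hs0, ?_⟩
    have hp := h rfl
    have hA' : adjCoeff (star i) i = X.zeta ^ p := by rw [hp, adjCoeff_star_comm]
    have hm : X.zeta ^ (-p) = X.zeta ^ p := by
      rw [zpow_neg, hp]
      exact inv_eq_of_mul_eq_one_left (adjCoeff_mul_self _ _)
    have hp2 : X.zeta ^ p * X.zeta ^ p = 1 := by rw [hp, adjCoeff_mul_self]
    simp only [rootMat, star_star, hm, hA', ← hp, mul_add, add_mul,
      Matrix.single_mul_single_same, hp2]
    have := hs i
    ext a b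
    simp only [Matrix.sub_apply, Matrix.add_apply, Matrix.smul_apply, smul_eq_mul]
    linear_combination (-2 * (Matrix.single i i (1:ℂ) a b -
      Matrix.single (star i) (star i) (1:ℂ) a b) * 2) * this
  · refine ⟨2 * sgn i, mul_ne_zero two_ne_zero hs0, ?_⟩
    have hij' : i ≠ star j := fun h => hji (eq_star_comm.2 h)
    have hp1 : X.zeta ^ p * X.zeta ^ (-p) = 1 := by rw [← zeta_zpow_add, add_neg_cancel, zpow_zero]
    have hp2 : X.zeta ^ (-p) * X.zeta ^ p = 1 := by rw [mul_comm, hp1]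
    have hA2 := hA
    rw [mul_comm] at hA2
    simp only [rootMat, mul_add, add_mul, Matrix.single_mul_single_same,
      Matrix.single_mul_single_of_ne _ _ _ _ hji, Matrix.single_mul_single_of_ne _ _ _ _ hij',
      Matrix.single_mul_single_of_ne _ _ _ _ (Ne.symm hji),
      Matrix.single_mul_single_of_ne _ _ _ _ (Ne.symm hij'), hp1, hp2, hA, hA2, add_zero, zero_add]
    have := hs i
    ext a b
    simp only [Matrix.sub_apply, Matrix.add_apply, Matrix.smul_apply, smul_eq_mul]
    linear_combination (-(Matrix.single i i (1:ℂ) a b - Matrix.single (star i) (star i) (1:ℂ) a b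
      - Matrix.single j j (1:ℂ) a b + Matrix.single (star j) (star j) (1:ℂ) a b)) * this

theorem orthMat_even {i j : orth.Idx k l} {p : ℤ} (hpar : par i = par j) :
    orthMat i j p ∈ SuperMatrix.homog _ _ 0 := by
  intro a b hab
  by_contra h
  refine hab ?_
  have hp : ∀ i : orth.Idx k l, par (swapIdx i) = par i := by rintro (i | i) <;> rfl
  have h1 : ∀ a b, rootMat i j 0 a b ≠ 0 → par a = par b := by
    intro a b h
    rcases rootMat_apply_ne h with ⟨rfl, rfl⟩ | ⟨rfl, rfl⟩
    · exact hpar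
    · rw [par_star, par_star, hpar]
  suffices par a = par b by rw [this, CharTwo.add_self_eq_zero]
  by_cases h2 : rootMat i j 0 a b = 0
  · rw [orthMat, Matrix.add_apply, h2, zero_add, Matrix.smul_apply, swapConj_apply] at h
    rw [← hp a, ← hp b]
    exact h1 _ _ (right_ne_zero_of_smul h)
  · exact h1 _ _ h2

theorem rootMat_even {i j : X.Idx k l} {p : ℤ} (hpar : par i = par j) :
    rootMat i j p ∈ SuperMatrix.homog _ _ 0 := by
  intro a b hab
  by_contra h
  refine hab ?_
  rcases rootMat_apply_ne h with ⟨rfl, rfl⟩ | ⟨rfl, rfl⟩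
  · rw [hpar, CharTwo.add_self_eq_zero]
  · rw [par_star, par_star, hpar, CharTwo.add_self_eq_zero]

theorem adjCoeff_even {i j : X.Idx k l} (hi : par i = 0) (hj : par j = 0) :
    adjCoeff i j = -1 := by
  have h01 : (0 : ZMod 2) ≠ 1 := by decide
  rcases i with i | i <;> rcases j with j | j <;>
    simp_all [par, adjCoeff, gramSign, superSign, star]

theorem orth_par_extra {j : orth.Idx k l} (hj : IsExtra j) : par j = 0 := by
  rcases j with ((j | j) | j) | ((j | j) | j)
  · exact hj.elim
  · exact hj.elim
  · rfl
  · exact hj.elim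
  · exact hj.elim
  · exact Fin.elim0 (show Fin 0 from j)

theorem br_orthMat {i j : orth.Idx k l} (p : ℤ) (hi : ¬ IsExtra i) (hj : IsExtra j)
    (hpar : par i = par j) :
    orthMat i j p * orthMat (star i) (star j) (-p) -
        orthMat (star i) (star j) (-p) * orthMat i j p =
      (-4 : ℂ) • orth.diag k l (toCartan (wt i - wt j)) := by
  have hj0 := orth_par_extra hj
  have hi0 : par i = 0 := hpar.trans hj0
  have hsgn : sgn i = 1 := by rcases i with i | i <;> simp_all [sgn, par]
  have hm : orth.zeta ^ (-p) = orth.zeta ^ p := by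
    rw [zpow_neg, ← inv_zpow]; norm_num [zeta]
  have hz : orth.zeta ^ p * orth.zeta ^ p = 1 := by
    rw [← mul_zpow]; simp [zeta]
  have h1 : i ≠ j := fun h => hi (h ▸ hj)
  have h2 : i ≠ star j := fun h => hi (h ▸ isExtra_star.2 hj)
  have h3 : star i ≠ j := fun h => hi (isExtra_star.1 (h ▸ hj))
  have h4 : star i ≠ star j := fun h => h1 (star_inj.1 h)
  have h5 : star j ≠ j := star_ne_of_extra hj
  rw [isExtra_of_wt_eq_zero hj, sub_zero, diag_toCartan_wt (Or.inl hi), hsgn,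
    orthMat_eq p hi hj, orthMat_eq (-p) (mt isExtra_star.1 hi) (isExtra_star.2 hj), hm,
    star_star, star_star, adjCoeff_even (by simpa using hj0) (by simpa using hi0),
    adjCoeff_even hj0 hi0]
  simp only [mul_add, add_mul, smul_mul_assoc, mul_smul_comm, smul_add,
    Matrix.single_mul_single_same, Matrix.single_mul_single_of_ne _ _ _ _ h1,
    Matrix.single_mul_single_of_ne _ _ _ _ h1.symm, Matrix.single_mul_single_of_ne _ _ _ _ h2,
    Matrix.single_mul_single_of_ne _ _ _ _ h2.symm, Matrix.single_mul_single_of_ne _ _ _ _ h3,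
    Matrix.single_mul_single_of_ne _ _ _ _ h3.symm, Matrix.single_mul_single_of_ne _ _ _ _ h4,
    Matrix.single_mul_single_of_ne _ _ _ _ h4.symm, Matrix.single_mul_single_of_ne _ _ _ _ h5,
    Matrix.single_mul_single_of_ne _ _ _ _ h5.symm, smul_smul, hz, smul_zero, add_zero, zero_add]
  ext a b
  simp only [Matrix.sub_apply, Matrix.add_apply, Matrix.smul_apply, smul_eq_mul,
    Matrix.single_apply]
  split_ifs <;> ring

theorem star_extra_of_one (hp : X.p ≤ 1) (hq : X.q ≤ 1) {i : X.Idx k l} (hi : IsExtra i) :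
    star i = i := by
  rcases i with ((j | j) | j) | ((j | j) | j)
  · exact hi.elim
  · exact hi.elim
  · have : j.rev = j := Fin.ext (by have := j.2; have := j.rev.2; omega)
    simp [star, halfStar, this]
  · exact hi.elim
  · exact hi.elim
  · have : j.rev = j := Fin.ext (by have := j.2; have := j.rev.2; omega)
    simp [star, halfStar, this]

/-- Indices of equal parity give even root vectors, so the superbracket is the ordinary commutator
and the products of matrix units can be evaluated directly. -/
theorem exists_even_triple {i j : X.Idx k l} {p : ℤ} (h : Occurs i j p) (hw : wt i ≠ wt j)
    (hpar : par i = par j) :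
    ∃ e ∈ X.eigenMat k l p, ∃ f ∈ X.eigenMat k l (-p), e ∈ SuperMatrix.homog _ _ 0 ∧
      f ∈ SuperMatrix.homog _ _ 0 ∧ (∀ a b, e a b ≠ 0 → wt a - wt b = wt i - wt j) ∧
      (∀ a b, f a b ≠ 0 → wt a - wt b = wt j - wt i) ∧
      e ∉ Submodule.span ℂ {(1 : X.Mat k l)} ∧ f ∉ Submodule.span ℂ {(1 : X.Mat k l)} ∧
      ∃ c : ℂ, c ≠ 0 ∧ e * f - f * e = c • X.diag k l (toCartan (wt i - wt j)) := by
  have hij : i ≠ j := fun h => hw (h ▸ rfl)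
  by_cases hs : X = orth → ¬ IsExtra i ∧ ¬ IsExtra j
  · have key : ∀ {i j p}, Occurs i j p → (X = orth → ¬ IsExtra (i : X.Idx k l) ∧ ¬ IsExtra j) →
        (X = orth → Even p) ∧ X.zeta ^ (2 * p) = adjSq i j ∧
        (j = star i → X.zeta ^ p = adjCoeff i j) := by
      intro i j p h hs
      rcases h with ⟨h, h'⟩ | h
      · have := hs h
        tauto
      · exact h
    obtain ⟨h1, h2, h3⟩ := key h hs
    obtain ⟨h1', h2', h3'⟩ := key h.swap (fun h => (hs h).symm)
    have hfix : ∀ i : X.Idx k l, (X = orth → ¬ IsExtra i) → ¬ IsExtra i ∨ star i = i := by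
      intro i hi
      by_cases he : IsExtra i
      · refine Or.inr ?_
        cases X
        · exact star_extra_of_one (by decide) (by decide) he
        · exact star_extra_of_one (by decide) (by decide) he
        · exact star_extra_of_one (by decide) (by decide) he
        · exact (hi rfl he).elim
      · exact Or.inl he
    exact ⟨_, rootMat_mem hij h1 hs h2, _, rootMat_mem hij.symm h1' (fun h => (hs h).symm) h2',
      rootMat_even hpar, rootMat_even hpar.symm, fun _ _ => rootMat_wt, fun _ _ => rootMat_wt,
      notMem_span_one hij (rootMat_self_ne_zero h3),
      notMem_span_one hij.symm (rootMat_self_ne_zero h3'),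
      br_rootMat hij hpar h3 (hfix i fun h => (hs h).1) (hfix j fun h => (hs h).2)⟩
  · have : X = orth := by tauto
    subst this
    have main : ∀ {i j : orth.Idx k l}, ¬ IsExtra i → IsExtra j → par i = par j →
        ∃ e ∈ orth.eigenMat k l p, ∃ f ∈ orth.eigenMat k l (-p), e ∈ SuperMatrix.homog _ _ 0 ∧
        f ∈ SuperMatrix.homog _ _ 0 ∧ (∀ a b, e a b ≠ 0 → wt a - wt b = wt i - wt j) ∧
        (∀ a b, f a b ≠ 0 → wt a - wt b = wt j - wt i) ∧
        e ∉ Submodule.span ℂ {(1 : orth.Mat k l)} ∧ f ∉ Submodule.span ℂ {(1 : orth.Mat k l)} ∧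
        ∃ c : ℂ, c ≠ 0 ∧ e * f - f * e = c • orth.diag k l (toCartan (wt i - wt j)) := by
      intro i j hi hj hpar
      have hi' := mt isExtra_star.1 hi
      have hj' := isExtra_star.2 hj
      -- The opposite vector is built on `(i*, j*)` rather than `(j, i)`: the weight is the same,
      -- and the additional index stays second, as `orthMat_eq` requires.
      refine ⟨_, orthMat_mem (adjSq_orth hj), _, orthMat_mem (adjSq_orth hj'),
        orthMat_even hpar, orthMat_even (by rw [par_star, par_star, hpar]),
        fun _ _ => orthMat_wt, fun a b h => ?_, notMem_span_one ?_ (orthMat_self p hi hj),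
        notMem_span_one ?_ (orthMat_self (-p) hi' hj'), -4, by norm_num, br_orthMat p hi hj hpar⟩
      · rw [orthMat_wt h, wt_star, wt_star]; abel
      · rintro rfl
        exact hi hj
      · intro h
        exact hi' (h ▸ hj')
    rcases orth_extra_cases hw (by tauto) with ⟨hi, hj⟩ | ⟨hj, hi⟩
    · exact main hi hj hpar
    · have e1 : (wt i - wt j : Weight k l) = wt (star j) - wt (star i) := by
        rw [wt_star, wt_star]; abel
      have e2 : (wt j - wt i : Weight k l) = wt (star i) - wt (star j) := by
        rw [wt_star, wt_star]; abel
      rw [e1, e2]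
      exact main hj hi (by rw [par_star, par_star, hpar])

theorem wt_central (i : X.Idx k l) (r s : ℂ) : wt i (0, 0, r, s) = 0 := by
  rcases i with ((i | i) | i) | ((i | i) | i) <;> simp [wt, eps, del]

theorem toCartan_add_delta (α : Weight k l) (p : ℤ) :
    toCartan (α + p • delta) = toCartan α + (0, 0, (p : ℂ), 0) := by
  ext <;> simp [toCartan, delta]

theorem diag_eq_of_central (h : Cartan k l) (c s : ℂ) :
    X.diag k l (h + (0, 0, c, s)) = X.diag k l h := by
  simp [diag]

theorem diag_smul (c : ℂ) (h : Cartan k l) : X.diag k l (c • h) = c • X.diag k l h := by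
  rw [diag_eq, diag_eq, ← Matrix.diagonal_smul]
  congr 1
  ext i
  simp

/-- The cocycle adds a multiple of the central element to the coroot. Testing only against weights
that vanish on that element, as all roots do, makes the multiple irrelevant. -/
theorem exists_sl2 {i j : X.Idx k l} {p : ℤ} (h : Occurs i j p) (hw : wt i ≠ wt j)
    (hpar : par i = par j) {α : Weight k l} (hα : α = wt i - wt j + p • delta)
    (hn : weightForm α α ≠ 0) :
    ∃ e ∈ X.rootSpace k l α, ∃ f ∈ X.rootSpace k l (-α), e ≠ 0 ∧ f ≠ 0 ∧
      e ∈ (X.alg k l).homog 0 ∧ f ∈ (X.alg k l).homog 0 ∧ ∃ c : Cartan k l,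
      (X.alg k l).br e f = X.cartan k l c ∧
      ∀ γ : Weight k l, γ (0, 0, 1, 0) = 0 → γ c = 2 * weightForm α γ / weightForm α α := by
  obtain ⟨e, he, f, hf, he0, hf0, hew, hfw, hen, hfn, c, hc, hef⟩ := exists_even_triple h hw hpar
  -- Chosen so that `α` takes the value `2` on the bracket.
  set r : ℂ := 2 / (weightForm α α * c) with hr
  have hr0 : r ≠ 0 := div_ne_zero two_ne_zero (mul_ne_zero hn hc)
  have hα' : -α = wt j - wt i + (-p) • delta := by rw [hα, neg_smul]; abel
  refine ⟨loopElt p e he, hα ▸ loopElt_mem_rootSpace he hew, r • loopElt (-p) f hf,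
    Submodule.smul_mem _ _ (hα' ▸ loopElt_mem_rootSpace hf hfw), loopElt_ne_zero he hen,
    smul_ne_zero hr0 (loopElt_ne_zero hf hfn), loopElt_even he he0,
    Submodule.smul_mem _ _ (loopElt_even hf hf0),
    r • (c • toCartan (wt i - wt j) + (0, 0, (p : ℂ) * str (e * f), 0)), ?_, ?_⟩
  · have hbr : SuperMatrix.br e f = X.diag k l (c • toCartan (wt i - wt j)) := by
      rw [br_of_even he0, hef, diag_smul]
    rw [map_smul, map_smul]
    congr 1
    refine Subtype.ext ?_
    rw [br_loopElt he hf hbr (X.diag_mem k l _), add_neg_cancel, if_pos rfl]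
    refine Prod.ext (congrArg (Finsupp.single 0) (congrArg (X.scalars k l).mkQ (Subtype.ext ?_))) ?_
    · exact (diag_eq_of_central _ _ _).symm
    · change _ = (c • toCartan (wt i - wt j) + (0, 0, (p : ℂ) * str (e * f), 0) : Cartan k l).2.2
      ext <;> simp [toCartan, wt_central]
  · intro γ hγ
    have h1 : toCartan α = toCartan (wt i - wt j) + (0, 0, (p : ℂ), 0) := by
      rw [hα, toCartan_add_delta]
    have h2 : ∀ z : ℂ, γ (0, 0, z, 0) = 0 := by
      intro z
      have : ((0, 0, z, 0) : Cartan k l) = z • (0, 0, 1, 0) := by simp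
      rw [this, map_smul, hγ, smul_zero]
    have h3 : weightForm α γ = γ (toCartan (wt i - wt j)) := by
      rw [weightForm, h1, map_add, h2, add_zero]
    rw [map_smul, map_add, h2, add_zero, map_smul, ← h3, hr, smul_eq_mul, smul_eq_mul]
    field_simp

/-! ### The form on weights -/

/-- The coordinate of a weight at `ε_a`. -/
def epsCoord {k l : ℕ} (a : Fin k) : Weight k l →ₗ[ℂ] ℂ :=
  LinearMap.applyₗ ((Pi.single a 1, 0, 0, 0) : Cartan k l)

/-- The coordinate of a weight at `δ_b`. -/
def delCoord {k l : ℕ} (b : Fin l) : Weight k l →ₗ[ℂ] ℂ :=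
  LinearMap.applyₗ ((0, Pi.single b 1, 0, 0) : Cartan k l)

/-- The value of a weight on the central element. -/
def level {k l : ℕ} : Weight k l →ₗ[ℂ] ℂ :=
  LinearMap.applyₗ ((0, 0, 1, 0) : Cartan k l)

/-- The value of a weight on the degree element. -/
def degree {k l : ℕ} : Weight k l →ₗ[ℂ] ℂ :=
  LinearMap.applyₗ ((0, 0, 0, 1) : Cartan k l)

theorem weight_apply (β : Weight k l) (h : Cartan k l) :
    β h = ∑ a, h.1 a * epsCoord a β + ∑ b, h.2.1 b * delCoord b β + h.2.2.1 * level β +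
      h.2.2.2 * degree β := by
  have hh : h = ∑ i, h.1 i • ((Pi.single i 1, 0, 0, 0) : Cartan k l) +
      ∑ j, h.2.1 j • ((0, Pi.single j 1, 0, 0) : Cartan k l) +
      h.2.2.1 • ((0, 0, 1, 0) : Cartan k l) + h.2.2.2 • ((0, 0, 0, 1) : Cartan k l) := by
    ext i <;> simp [Prod.fst_sum, Prod.snd_sum, Finset.sum_apply, Pi.single_apply]
  conv_lhs => rw [hh]
  simp only [map_add, map_sum, map_smul, smul_eq_mul]
  rfl

theorem weight_ext {α β : Weight k l} (h1 : ∀ a, epsCoord a α = epsCoord a β)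
    (h2 : ∀ b, delCoord b α = delCoord b β) (h3 : level α = level β)
    (h4 : degree α = degree β) : α = β := by
  refine LinearMap.ext fun h => ?_
  rw [weight_apply, weight_apply β]
  simp only [h1, h2, h3, h4]

theorem weightForm_eq (α β : Weight k l) :
    weightForm α β = (∑ a, epsCoord a α * epsCoord a β) / 2 -
      (∑ b, delCoord b α * delCoord b β) / 2 + degree α * level β + level α * degree β := by
  rw [weightForm, weight_apply]
  simp only [toCartan, Finset.sum_div, neg_mul, Finset.sum_neg_distrib, ← sub_eq_add_neg]
  congr 2
  congr 1
  · exact Finset.sum_congr rfl fun _ _ => div_mul_eq_mul_div _ _ _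
  · exact Finset.sum_congr rfl fun _ _ => div_mul_eq_mul_div _ _ _

theorem weightForm_comm (α β : Weight k l) : weightForm α β = weightForm β α := by
  rw [weightForm_eq, weightForm_eq]
  simp only [mul_comm (epsCoord _ α), mul_comm (delCoord _ α)]
  ring

theorem weightForm_add_right (α β γ : Weight k l) :
    weightForm α (β + γ) = weightForm α β + weightForm α γ := rfl

theorem weightForm_zsmul_right (α β : Weight k l) (n : ℤ) :
    weightForm α (n • β) = n * weightForm α β := by
  change (n • β) _ = _
  simp [weightForm]

theorem weightForm_neg_right (α β : Weight k l) :
    weightForm α (-β) = -weightForm α β := rfl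

theorem weightForm_add_left (α β γ : Weight k l) :
    weightForm (α + β) γ = weightForm α γ + weightForm β γ := by
  rw [weightForm_comm, weightForm_add_right, weightForm_comm γ, weightForm_comm γ]

theorem weightForm_zsmul_left (α β : Weight k l) (n : ℤ) :
    weightForm (n • α) β = n * weightForm α β := by
  rw [weightForm_comm, weightForm_zsmul_right, weightForm_comm]

theorem weightForm_neg_left (α β : Weight k l) :
    weightForm (-α) β = -weightForm α β := by
  rw [weightForm_comm, weightForm_neg_right, weightForm_comm]

theorem weightForm_delta_left (β : Weight k l) : weightForm delta β = level β := by
  have : toCartan (delta : Weight k l) = (0, 0, 1, 0) := by ext <;> simp [toCartan, delta]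
  rw [weightForm, this]
  rfl

theorem weightForm_delta_right (β : Weight k l) : weightForm β delta = level β := by
  rw [weightForm_comm, weightForm_delta_left]

@[simp] theorem level_delta : level (delta : Weight k l) = 0 := by simp [level, delta]

@[simp] theorem level_wt (i : X.Idx k l) : level (wt i) = 0 := wt_central i 1 0

@[simp] theorem degree_wt (i : X.Idx k l) : degree (wt i) = 0 := wt_central i 0 1

@[simp] theorem degree_delta : degree (delta : Weight k l) = 1 := by simp [degree, delta]

@[simp] theorem epsCoord_delta (a : Fin k) : epsCoord a (delta : Weight k l) = 0 := by
  simp [epsCoord, delta]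

@[simp] theorem delCoord_delta (b : Fin l) : delCoord b (delta : Weight k l) = 0 := by
  simp [delCoord, delta]

@[simp] theorem epsCoord_eps (a a' : Fin k) :
    epsCoord a (eps a' : Weight k l) = if a' = a then 1 else 0 := by
  simp [epsCoord, eps, Pi.single_apply]

@[simp] theorem epsCoord_del (a : Fin k) (b : Fin l) : epsCoord a (del b : Weight k l) = 0 := by
  simp [epsCoord, del]

@[simp] theorem delCoord_eps (a : Fin k) (b : Fin l) : delCoord b (eps a : Weight k l) = 0 := by
  simp [delCoord, eps]

@[simp] theorem delCoord_del (b b' : Fin l) :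
    delCoord b (del b' : Weight k l) = if b' = b then 1 else 0 := by
  simp [delCoord, del, Pi.single_apply]

theorem weightForm_eps (a : Fin k) (β : Weight k l) : weightForm (eps a) β = epsCoord a β / 2 := by
  rw [weightForm_eq]
  have h1 : degree (eps a : Weight k l) = 0 := by simp [degree, eps]
  have h2 : level (eps a : Weight k l) = 0 := by simp [level, eps]
  simp [h1, h2]

theorem weightForm_del (b : Fin l) (β : Weight k l) :
    weightForm (del b) β = -(delCoord b β / 2) := by
  rw [weightForm_eq]
  have h1 : degree (del b : Weight k l) = 0 := by simp [degree, del]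
  have h2 : level (del b : Weight k l) = 0 := by simp [level, del]
  simp [h1, h2]

theorem level_of_mem_roots {α : Weight k l} (h : α ∈ X.roots k l) : level α = 0 := by
  rcases exists_of_mem_roots h with ⟨p, rfl⟩ | ⟨i, j, p, -, rfl, -⟩ <;> simp

theorem weightForm_add_zsmul_delta {α : Weight k l} (h : level α = 0) (p : ℤ) :
    weightForm (α + p • delta) (α + p • delta) = weightForm α α := by
  simp only [weightForm_add_left, weightForm_add_right, weightForm_zsmul_left,
    weightForm_zsmul_right, weightForm_delta_left, weightForm_delta_right, h, level_delta,
    map_add, map_zsmul]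
  simp

/-! ### Classification of the real roots -/

theorem mem_realRoots_iff {α : Weight k l} :
    α ∈ X.realRoots k l ↔ weightForm α α ≠ 0 ∧
      ∃ (i j : X.Idx k l) (p : ℤ), α = wt i - wt j + p • delta ∧ Occurs i j p := by
  constructor
  · rintro ⟨h, hn⟩
    refine ⟨hn, ?_⟩
    rcases exists_of_mem_roots h with ⟨p, rfl⟩ | ⟨i, j, p, -, e, ho⟩
    · simp [weightForm_zsmul_left, weightForm_delta_left, map_zsmul] at hn
    · exact ⟨i, j, p, e, ho⟩
  · rintro ⟨hn, i, j, p, rfl, ho⟩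
    have hw : (wt i : Weight k l) ≠ wt j := by
      intro h
      rw [h, sub_self, zero_add] at hn
      simp [weightForm_zsmul_left, weightForm_delta_left, map_zsmul] at hn
    exact ⟨ho.mem_roots (fun h => hw (h ▸ rfl)) fun _ => hw, hn⟩

theorem neg_mem_realRoots {α : Weight k l} (h : α ∈ X.realRoots k l) : -α ∈ X.realRoots k l := by
  rw [mem_realRoots_iff] at h ⊢
  obtain ⟨hn, i, j, p, rfl, ho⟩ := h
  refine ⟨by rwa [weightForm_neg_left, weightForm_neg_right, neg_neg], j, i, -p, ?_, ho.swap⟩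
  rw [neg_smul]; abel

/-- Since `ζ⁴ = 1` in all four families, `4δ` is a common period of the real roots. It need not be
minimal; the arguments on fibres only need some period. -/
theorem add_four_mem_realRoots {α : Weight k l} (h : α ∈ X.realRoots k l) (n : ℤ) :
    α + (4 * n) • delta ∈ X.realRoots k l := by
  have h0 := level_of_mem_roots h.1
  rw [mem_realRoots_iff] at h ⊢
  obtain ⟨hn, i, j, p, rfl, ho⟩ := h
  exact ⟨by rwa [weightForm_add_zsmul_delta h0], i, j, p + 4 * n, by rw [add_smul]; abel,
    ho.add_four n⟩

theorem mem_realRoots_of_add {α : Weight k l} (h : α ∈ X.realRoots k l) {n : ℤ}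
    (hn : α + n • delta ∈ X.roots k l) : α + n • delta ∈ X.realRoots k l :=
  ⟨hn, by rw [weightForm_add_zsmul_delta (level_of_mem_roots h.1)]; exact h.2⟩

theorem ne_zero_of_mem_realRoots {α : Weight k l} (h : α ∈ X.realRoots k l) (n : ℤ) :
    α ≠ n • delta := by
  rintro rfl
  exact h.2 (by simp [weightForm_zsmul_left, weightForm_delta_left, map_zsmul])

theorem sgn_par {i j : X.Idx k l} : par i = par j ↔ (sgn i : ℂ) = sgn j := by
  rcases i with i | i <;> rcases j with j | j <;> norm_num [sgn, par]

theorem weightForm_wt_self {i : X.Idx k l} (h : ¬ IsExtra i) :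
    weightForm (wt i : Weight k l) (wt i) = sgn i / 2 := by
  rcases i with ((i | i) | i) | ((i | i) | i) <;>
    simp_all [IsExtra, wt, sgn, weightForm_neg_left, weightForm_neg_right, weightForm_eps,
      weightForm_del, neg_div]

theorem weightForm_wt_of_par_ne {i j : X.Idx k l} (h : par i ≠ par j) :
    weightForm (wt i : Weight k l) (wt j) = 0 := by
  have h0 : ∀ β : Weight k l, weightForm 0 β = 0 := by
    intro β; simp [weightForm_eq]
  rcases i with ((i | i) | i) | ((i | i) | i) <;> rcases j with ((j | j) | j) | ((j | j) | j) <;>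
    simp_all [wt, par, weightForm_neg_left, weightForm_neg_right, weightForm_eps,
      weightForm_del]

/-- The indices of a real root can be chosen with equal parity, or with an additional basis vector
of the other parity in the second place. -/
theorem exists_of_mem_realRoots {α : Weight k l} (h : α ∈ X.realRoots k l) :
    ∃ (i j : X.Idx k l) (p : ℤ), wt i ≠ wt j ∧ α = wt i - wt j + p • delta ∧ Occurs i j p ∧
      ¬ IsExtra i ∧ (IsExtra j ∨ par i = par j) := by
  rw [mem_realRoots_iff] at h
  obtain ⟨hn, i, j, p, rfl, ho⟩ := h
  have hw : (wt i : Weight k l) ≠ wt j := by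
    intro h
    rw [h, sub_self, zero_add] at hn
    simp [weightForm_zsmul_left, weightForm_delta_left, map_zsmul] at hn
  by_cases hi : IsExtra i
  · refine ⟨star j, star i, p, ?_, ?_, ho.dual, ?_, Or.inl (isExtra_star.2 hi)⟩
    · rw [wt_star, wt_star]
      exact fun h => hw (neg_injective h).symm
    · rw [wt_star, wt_star]; abel
    · rw [isExtra_star]
      intro hj
      exact hw (by rw [isExtra_of_wt_eq_zero hi, isExtra_of_wt_eq_zero hj])
  · refine ⟨i, j, p, hw, rfl, ho, hi, ?_⟩
    -- With nonadditional indices of different parity the norms `1/2` and `-1/2` cancel, and the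
    -- root would be isotropic.
    by_contra H
    rw [not_or] at H
    refine hn ?_
    rw [weightForm_add_zsmul_delta (by simp), sub_eq_add_neg, weightForm_add_left,
      weightForm_add_right, weightForm_add_right, weightForm_neg_left, weightForm_neg_left,
      weightForm_neg_right, weightForm_neg_right, weightForm_wt_of_par_ne H.2,
      weightForm_wt_of_par_ne (Ne.symm H.2), weightForm_wt_self hi, weightForm_wt_self H.1]
    rcases i with i | i <;> rcases j with j | j <;> simp_all [sgn, par] <;> norm_num

theorem coord_wt_int (i : X.Idx k l) :
    (∀ a, ∃ n : ℤ, epsCoord a (wt i) = n) ∧ ∀ b, ∃ n : ℤ, delCoord b (wt i) = n := by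
  have h1 : ∀ (p : Prop) [Decidable p], ∃ n : ℤ, (if p then 1 else 0 : ℂ) = n := by
    intro p _
    exact ⟨if p then 1 else 0, by simp⟩
  have h2 : ∀ (p : Prop) [Decidable p], ∃ n : ℤ, -(if p then 1 else 0 : ℂ) = n := by
    intro p _
    exact ⟨-if p then 1 else 0, by simp⟩
  have h3 : ∃ n : ℤ, (0 : ℂ) = n := ⟨0, by simp⟩
  rcases i with ((i | i) | i) | ((i | i) | i) <;>
    simp only [wt, map_neg, map_zero, epsCoord_eps, epsCoord_del, delCoord_eps, delCoord_del,
      neg_zero, h1, h2, h3, implies_true, and_self]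

theorem coord_int {α : Weight k l} (h : α ∈ X.realRoots k l) :
    (∀ a, ∃ n : ℤ, epsCoord a α = n) ∧ ∀ b, ∃ n : ℤ, delCoord b α = n := by
  rw [mem_realRoots_iff] at h
  obtain ⟨hn, i, j, p, rfl, ho⟩ := h
  constructor
  · intro a
    obtain ⟨n, hn⟩ := (coord_wt_int i).1 a
    obtain ⟨m, hm⟩ := (coord_wt_int j).1 a
    exact ⟨n - m, by simp [hn, hm]⟩
  · intro a
    obtain ⟨n, hn⟩ := (coord_wt_int i).2 a
    obtain ⟨m, hm⟩ := (coord_wt_int j).2 a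
    exact ⟨n - m, by simp [hn, hm]⟩

theorem coord_eq_zero {i j : X.Idx k l} (h : IsExtra j ∨ par i = par j) (p : ℤ) :
    (∀ b, delCoord b (wt i - wt j + p • delta) = 0) ∨
      ∀ a, epsCoord a (wt i - wt j + p • delta) = 0 := by
  rcases i with ((i | i) | i) | ((i | i) | i) <;> rcases j with ((j | j) | j) | ((j | j) | j) <;>
    simp_all [IsExtra, par, wt]

/-- Modulo `δ`, a nonisotropic root involves only the `ε_a` or only the `δ_b`, with integral
coordinates. The form is positive on the first kind and negative on the second. -/
theorem realRoots_definite {α : Weight k l} (h : α ∈ X.realRoots k l) :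
    ((∀ b, delCoord b α = 0) ∧ ∃ r : ℝ, 0 < r ∧ weightForm α α = r) ∨
      ((∀ a, epsCoord a α = 0) ∧ ∃ r : ℝ, r < 0 ∧ weightForm α α = r) := by
  have hn := h.2
  have hl := level_of_mem_roots h.1
  obtain ⟨h1, h2⟩ := coord_int h
  choose u hu using h1
  choose v hv using h2
  rw [weightForm_eq, hl] at hn
  simp only [weightForm_eq, hl]
  obtain ⟨i, j, p, -, rfl, -, -, hij⟩ := exists_of_mem_realRoots h
  rcases coord_eq_zero hij p with h0 | h0
  · refine Or.inl ⟨h0, ?_⟩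
    simp only [h0, hu] at hn ⊢
    refine ⟨(∑ a, (u a : ℝ) * u a) / 2, ?_, by push_cast; simp⟩
    refine lt_of_le_of_ne (div_nonneg (Finset.sum_nonneg fun _ _ => mul_self_nonneg _) two_pos.le)
      fun h => hn ?_
    have := congrArg (fun r : ℝ => (r : ℂ)) h
    push_cast at this
    simp [← this]
  · refine Or.inr ⟨h0, ?_⟩
    simp only [h0, hv] at hn ⊢
    refine ⟨-((∑ a, (v a : ℝ) * v a) / 2), ?_, by push_cast; simp⟩
    rw [neg_lt_zero]
    refine lt_of_le_of_ne (div_nonneg (Finset.sum_nonneg fun _ _ => mul_self_nonneg _) two_pos.le)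
      fun h => hn ?_
    have := congrArg (fun r : ℝ => (r : ℂ)) h
    push_cast at this
    simp [← this]

theorem weightForm_self_eq_zero {α : Weight k l} (h1 : ∀ a, epsCoord a α = 0)
    (h2 : ∀ b, delCoord b α = 0) (h3 : level α = 0) : weightForm α α = 0 := by
  simp [weightForm_eq, h1, h2, h3]

/-- If a real root is the sum of two others modulo `δ`, then one of them has a positive Cartan
integer with the sum. -/
theorem re_cartan_pos {α β γ : Weight k l} (hα : α ∈ X.realRoots k l) (hβ : β ∈ X.realRoots k l)
    (hγ : γ ∈ X.realRoots k l) {s : ℤ} (h : γ = α + β + s • delta) :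
    0 < (2 * weightForm α γ / weightForm α α).re ∨
      0 < (2 * weightForm β γ / weightForm β β).re := by
  have key : ∀ {r : ℝ} {z : ℂ}, 0 < r * z.re → r ≠ 0 → 0 < (2 * z / r).re := by
    intro r z h hr
    rw [Complex.div_ofReal_re, Complex.mul_re]
    simp only [Complex.re_ofNat, Complex.im_ofNat, zero_mul, sub_zero]
    have : 2 * z.re / r = 2 * (r * z.re) / (r * r) := by field_simp
    rw [this]
    exact div_pos (mul_pos two_pos h) (mul_self_pos.2 hr)
  -- When all three roots lie in the same definite block, one summand has the sign of `(γ, γ)`,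
  -- which is also the sign of `(α, α)` and `(β, β)`.
  have hsum : weightForm α γ + weightForm β γ = weightForm γ γ := by
    have hγ0 := level_of_mem_roots hγ.1
    nth_rewrite 3 [h]
    rw [weightForm_add_left, weightForm_add_left, weightForm_zsmul_left, weightForm_delta_left,
      hγ0]
    ring
  have e1 : ∀ a, epsCoord a γ = epsCoord a α + epsCoord a β := by intro a; rw [h]; simp
  have e2 : ∀ b, delCoord b γ = delCoord b α + delCoord b β := by intro a; rw [h]; simp
  have lα := level_of_mem_roots hα.1
  have lβ := level_of_mem_roots hβ.1
  have lγ := level_of_mem_roots hγ.1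
  rcases realRoots_definite hα with ⟨hα1, r, hr, hαr⟩ | ⟨hα1, r, hr, hαr⟩ <;>
  rcases realRoots_definite hβ with ⟨hβ1, r', hr', hβr⟩ | ⟨hβ1, r', hr', hβr⟩ <;>
  rcases realRoots_definite hγ with ⟨hγ1, t, ht, hγt⟩ | ⟨hγ1, t, ht, hγt⟩
  · rw [hαr, hβr]
    rw [hγt] at hsum
    have := congrArg Complex.re hsum
    rw [Complex.add_re, Complex.ofReal_re] at this
    by_cases hp : 0 < (weightForm α γ).re
    · exact Or.inl (key (mul_pos hr hp) hr.ne')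
    · exact Or.inr (key (mul_pos hr' (by linarith)) hr'.ne')
  -- In each of the six mixed cases one of the three roots has only zero coordinates, hence norm
  -- zero.
  · exact (hγ.2 (weightForm_self_eq_zero hγ1 (fun b => by rw [e2, hα1, hβ1, add_zero]) lγ)).elim
  · refine (hβ.2 (weightForm_self_eq_zero hβ1 (fun b => ?_) lβ)).elim
    simpa [hα1, hγ1] using (e2 b).symm
  · refine (hα.2 (weightForm_self_eq_zero (fun b => ?_) hα1 lα)).elim
    simpa [hβ1, hγ1] using (e1 b).symm
  · refine (hα.2 (weightForm_self_eq_zero hα1 (fun b => ?_) lα)).elim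
    simpa [hβ1, hγ1] using (e2 b).symm
  · refine (hβ.2 (weightForm_self_eq_zero (fun b => ?_) hβ1 lβ)).elim
    simpa [hα1, hγ1] using (e1 b).symm
  · exact (hγ.2 (weightForm_self_eq_zero (fun b => by rw [e1, hα1, hβ1, add_zero]) hγ1 lγ)).elim
  · rw [hαr, hβr]
    rw [hγt] at hsum
    have := congrArg Complex.re hsum
    rw [Complex.add_re, Complex.ofReal_re] at this
    by_cases hp : (weightForm α γ).re < 0
    · exact Or.inl (key (mul_pos_of_neg_of_neg hr hp) hr.ne)
    · exact Or.inr (key (mul_pos_of_neg_of_neg hr' (by linarith)) hr'.ne)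

/-! ### Values of the structure constants -/

theorem gramSign_mul_star {i : X.Idx k l} (h : ¬ IsExtra i) :
    gramSign i * gramSign (star i) = sgn i := by
  rcases i with ((i | i) | i) | ((i | i) | i) <;> simp_all [IsExtra, star, halfStar, gramSign, sgn]

theorem adjCoeff_star_right {i : X.Idx k l} (h : ¬ IsExtra i) :
    adjCoeff i (star i) = -sgn i := by
  rw [adjCoeff_of_par_eq (by simp), star_star, mul_comm, gramSign_mul_star h]

theorem sgn_mul_self (i : X.Idx k l) : (sgn i : ℂ) * sgn i = 1 := by
  rcases i with i | i <;> simp [sgn]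

theorem adjSq_of_par_eq {i j : X.Idx k l} (hi : ¬ IsExtra i) (hj : ¬ IsExtra j)
    (h : par i = par j) : adjSq i j = 1 := by
  rw [adjSq, adjCoeff_of_par_eq h, adjCoeff_of_par_eq (by simp [h]), star_star, star_star]
  have h1 := gramSign_mul_star hi
  have h2 := gramSign_mul_star hj
  rw [← sgn_par.1 h] at h2
  have h3 := sgn_mul_self i
  linear_combination (gramSign j * gramSign (star j)) * h1 + sgn i * h2 + h3

theorem zeta_zpow_two_mul (hX : X ≠ evenEven) (p : ℤ) : X.zeta ^ (2 * p) = 1 := by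
  rw [zpow_mul]
  cases X <;> simp_all [zeta]

theorem zeta_zpow_of_even (hX : X ≠ evenEven) {p : ℤ} (hp : Even p) : X.zeta ^ p = 1 := by
  obtain ⟨q, rfl⟩ := hp
  rw [← two_mul, zeta_zpow_two_mul hX]

theorem zeta_zpow_of_odd (hX : X ≠ evenEven) {p : ℤ} (hp : Odd p) : X.zeta ^ p = -1 := by
  have : X.zeta = -1 := by cases X <;> simp_all [zeta]
  rw [this, hp.neg_one_zpow]

theorem zeta_zpow_two_mul_evenEven (p : ℤ) : evenEven.zeta ^ (2 * p) = (-1) ^ p := by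
  rw [zpow_mul]
  congr 1
  exact Complex.I_sq

theorem zeta_zpow_four_add_two (n : ℤ) : evenEven.zeta ^ (4 * n + 2) = -1 := by
  rw [zeta_zpow_add, zeta_zpow_four, one_mul]
  exact Complex.I_sq

/-- Together with `occurs_long_iff` and `occurs_short_iff` this evaluates `Occurs` as a condition on
the degree alone, one for each length of root, to be compared with the strips that make up `R_0(i)`.
-/
theorem occurs_mid_iff {i j : X.Idx k l} (hi : ¬ IsExtra i) (hj : ¬ IsExtra j)
    (h : par i = par j) (hij : j ≠ star i) (p : ℤ) :
    Occurs i j p ↔ (X = orth ∨ X = evenEven → Even p) := by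
  simp only [Occurs, adjSq_of_par_eq hi hj h, hij, hi, hj, or_self, and_false, false_or,
    IsEmpty.forall_iff, and_true]
  by_cases hX : X = evenEven
  · subst hX
    rw [zeta_zpow_two_mul_evenEven]
    simp only [reduceCtorEq, IsEmpty.forall_iff, true_and, or_true, true_imp_iff]
    exact ⟨even_of_neg_one_zpow, fun h => h.neg_one_zpow⟩
  · simp [zeta_zpow_two_mul hX, hX]

theorem occurs_long_iff {i : X.Idx k l} (hi : ¬ IsExtra i) (p : ℤ) :
    Occurs i (star i) p ↔ (X = orth → Even p) ∧ X.zeta ^ p = -sgn i := by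
  simp only [Occurs, isExtra_star, hi, or_self, and_false, false_or, true_imp_iff,
    adjCoeff_star_right hi, adjSq_star_right]
  refine ⟨fun h => ⟨h.1, h.2.2⟩, fun h => ⟨h.1, ?_, h.2⟩⟩
  rw [two_mul, zeta_zpow_add, h.2, neg_mul_neg, sgn_mul_self]

theorem weightForm_wt_wt {i j : X.Idx k l} (hi : ¬ IsExtra i) (hj : ¬ IsExtra j)
    (h1 : i ≠ j) (h2 : j ≠ star i) : weightForm (wt i : Weight k l) (wt j) = 0 := by
  rcases i with ((i | i) | i) | ((i | i) | i) <;> rcases j with ((j | j) | j) | ((j | j) | j) <;>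
    simp_all [wt, IsExtra, star, halfStar, weightForm_neg_left, weightForm_neg_right,
      weightForm_eps, weightForm_del, eq_comm]

theorem sgn_ne_zero (i : X.Idx k l) : (sgn i : ℂ) ≠ 0 := by
  rcases i with i | i <;> simp [sgn]

theorem mid_mem_realRoots {i j : X.Idx k l} (hi : ¬ IsExtra i) (hj : ¬ IsExtra j)
    (h : par i = par j) (hij : i ≠ j) (hij' : j ≠ star i) {p : ℤ}
    (hp : X = orth ∨ X = evenEven → Even p) :
    wt i - wt j + p • delta ∈ X.realRoots k l := by
  rw [mem_realRoots_iff]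
  refine ⟨?_, i, j, p, rfl, (occurs_mid_iff hi hj h hij' p).2 hp⟩
  rw [weightForm_add_zsmul_delta (by simp), sub_eq_add_neg, weightForm_add_left,
    weightForm_add_right, weightForm_add_right, weightForm_neg_left, weightForm_neg_left,
    weightForm_neg_right, weightForm_neg_right, weightForm_wt_wt hi hj hij hij',
    weightForm_comm (wt j), weightForm_wt_wt hi hj hij hij', weightForm_wt_self hi,
    weightForm_wt_self hj, ← sgn_par.1 h]
  simpa using sgn_ne_zero i

theorem long_mem_realRoots {i : X.Idx k l} (hi : ¬ IsExtra i) {p : ℤ}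
    (hX : X = orth → Even p) (hp : X.zeta ^ p = -sgn i) :
    2 • wt i + p • delta ∈ X.realRoots k l := by
  rw [mem_realRoots_iff]
  refine ⟨?_, i, star i, p, ?_, (occurs_long_iff hi p).2 ⟨hX, hp⟩⟩
  · rw [weightForm_add_zsmul_delta (by simp), two_smul, weightForm_add_left,
      weightForm_add_right, weightForm_wt_self hi]
    have := sgn_ne_zero i
    ring_nf
    simpa using this
  · rw [wt_star, sub_neg_eq_add, two_smul]

theorem short_mem_realRoots {i j : X.Idx k l} (hi : ¬ IsExtra i) (hj : IsExtra j) {p : ℤ}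
    (h : Occurs i j p) : wt i + p • delta ∈ X.realRoots k l := by
  rw [mem_realRoots_iff]
  refine ⟨?_, i, j, p, ?_, h⟩
  · rw [weightForm_add_zsmul_delta (by simp), weightForm_wt_self hi]
    simpa using sgn_ne_zero i
  · rw [isExtra_of_wt_eq_zero hj, sub_zero]

theorem adjSq_extra_of_par_eq {i j : X.Idx k l} (hi : ¬ IsExtra i) (hj : IsExtra j)
    (h : par i = par j) : adjSq i j = sgn i := by
  rw [adjSq, adjCoeff_of_par_eq h, adjCoeff_of_par_eq (by simp [h]), star_star, star_star,
    (gramSign_star_extra hj).1, (gramSign_star_extra hj).2]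
  linear_combination gramSign_mul_star hi

theorem occurs_short_iff {i j : X.Idx k l} (hi : ¬ IsExtra i) (hj : IsExtra j) (p : ℤ) :
    Occurs i j p ↔ (X = orth ∨ X.zeta ^ (2 * p) = if par j = 0 then 1 else -1) := by
  have hs : j ≠ star i := by
    rintro rfl
    exact hi (isExtra_star.1 hj)
  have hsq : adjSq i j = if par j = 0 then 1 else -1 := by
    by_cases h : par i = par j
    · rw [adjSq_extra_of_par_eq hi hj h, ← h]
      rcases i with i | i <;> simp [par, sgn]
    · rw [adjSq_extra hj h, adjCoeff_star_right hi]
      rcases i with i | i <;> rcases j with j | j <;> simp_all [par, sgn]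
  rw [Occurs, hsq]
  have := zeta_zpow_two_mul (X := orth) (by simp) p
  by_cases hX : X = orth
  · simp [hX, hj]
  · simp [hX, hs]

/-! ### Indices and the explicit root sets -/

theorem mem_shortSet_eps {y : Weight k l} (X : TwistedType) :
    y ∈ shortSet (eps : Fin k → Weight k l) ↔
      ∃ i : X.Idx k l, ¬ IsExtra i ∧ par i = 0 ∧ y = wt i := by
  constructor
  · rintro ⟨a, rfl | rfl⟩
    · exact ⟨Sum.inl (Sum.inl (Sum.inl a)), by simp [IsExtra], rfl, rfl⟩
    · exact ⟨Sum.inl (Sum.inl (Sum.inr a)), by simp [IsExtra], rfl, rfl⟩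
  · rintro ⟨((i | i) | i) | ((i | i) | i), h1, h2, rfl⟩ <;> simp_all [IsExtra, par]
    · exact ⟨i, Or.inl rfl⟩
    · exact ⟨i, Or.inr rfl⟩

theorem mem_shortSet_del {y : Weight k l} (X : TwistedType) :
    y ∈ shortSet (del : Fin l → Weight k l) ↔
      ∃ i : X.Idx k l, ¬ IsExtra i ∧ par i = 1 ∧ y = wt i := by
  constructor
  · rintro ⟨a, rfl | rfl⟩
    · exact ⟨Sum.inr (Sum.inl (Sum.inl a)), by simp [IsExtra], rfl, rfl⟩
    · exact ⟨Sum.inr (Sum.inl (Sum.inr a)), by simp [IsExtra], rfl, rfl⟩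
  · rintro ⟨((i | i) | i) | ((i | i) | i), h1, h2, rfl⟩ <;> simp_all [IsExtra, par]
    · exact ⟨i, Or.inl rfl⟩
    · exact ⟨i, Or.inr rfl⟩

theorem mem_longSet_eps {y : Weight k l} (X : TwistedType) :
    y ∈ longSet (eps : Fin k → Weight k l) ↔
      ∃ i : X.Idx k l, ¬ IsExtra i ∧ par i = 0 ∧ y = 2 • wt i := by
  constructor
  · rintro ⟨a, rfl | rfl⟩
    · exact ⟨Sum.inl (Sum.inl (Sum.inl a)), by simp [IsExtra], rfl, rfl⟩
    · exact ⟨Sum.inl (Sum.inl (Sum.inr a)), by simp [IsExtra], rfl, (smul_neg _ _).symm⟩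
  · rintro ⟨((i | i) | i) | ((i | i) | i), h1, h2, rfl⟩ <;> simp_all [IsExtra, par]
    · exact ⟨i, Or.inl rfl⟩
    · exact ⟨i, Or.inr (smul_neg _ _)⟩

theorem mem_longSet_del {y : Weight k l} (X : TwistedType) :
    y ∈ longSet (del : Fin l → Weight k l) ↔
      ∃ i : X.Idx k l, ¬ IsExtra i ∧ par i = 1 ∧ y = 2 • wt i := by
  constructor
  · rintro ⟨a, rfl | rfl⟩
    · exact ⟨Sum.inr (Sum.inl (Sum.inl a)), by simp [IsExtra], rfl, rfl⟩
    · exact ⟨Sum.inr (Sum.inl (Sum.inr a)), by simp [IsExtra], rfl, (smul_neg _ _).symm⟩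
  · rintro ⟨((i | i) | i) | ((i | i) | i), h1, h2, rfl⟩ <;> simp_all [IsExtra, par]
    · exact ⟨i, Or.inl rfl⟩
    · exact ⟨i, Or.inr (smul_neg _ _)⟩

theorem mem_midSet_eps {y : Weight k l} (X : TwistedType) :
    y ∈ midSet (eps : Fin k → Weight k l) ↔ ∃ i j : X.Idx k l, ¬ IsExtra i ∧ ¬ IsExtra j ∧
      par i = 0 ∧ par j = 0 ∧ i ≠ j ∧ j ≠ star i ∧ y = wt i - wt j := by
  constructor
  · rintro ⟨a, b, hab, rfl | rfl | rfl⟩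
    · exact ⟨Sum.inl (Sum.inl (Sum.inl a)), Sum.inl (Sum.inl (Sum.inr b)), by simp [IsExtra],
        by simp [IsExtra], rfl, rfl, by simp, by simp [star, halfStar, hab.symm], by simp [wt]⟩
    · exact ⟨Sum.inl (Sum.inl (Sum.inl a)), Sum.inl (Sum.inl (Sum.inl b)), by simp [IsExtra],
        by simp [IsExtra], rfl, rfl, by simp [hab], by simp [star, halfStar], by simp [wt]⟩
    · exact ⟨Sum.inl (Sum.inl (Sum.inr a)), Sum.inl (Sum.inl (Sum.inl b)), by simp [IsExtra],
        by simp [IsExtra], rfl, rfl, by simp, by simp [star, halfStar, hab.symm], by simp [wt]⟩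
  · rintro ⟨((i | i) | i) | ((i | i) | i), ((j | j) | j) | ((j | j) | j), h1, h2, h3, h4, h5, h6,
      rfl⟩ <;> simp_all [IsExtra, par, star, halfStar, wt]
    · exact ⟨i, j, h5, Or.inr (Or.inl rfl)⟩
    · exact ⟨i, j, Ne.symm h6, Or.inl rfl⟩
    · exact ⟨i, j, Ne.symm h6, Or.inr (Or.inr rfl)⟩
    · exact ⟨j, i, Ne.symm h5, Or.inr (Or.inl (by abel))⟩

theorem mem_midSet_del {y : Weight k l} (X : TwistedType) :
    y ∈ midSet (del : Fin l → Weight k l) ↔ ∃ i j : X.Idx k l, ¬ IsExtra i ∧ ¬ IsExtra j ∧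
      par i = 1 ∧ par j = 1 ∧ i ≠ j ∧ j ≠ star i ∧ y = wt i - wt j := by
  constructor
  · rintro ⟨a, b, hab, rfl | rfl | rfl⟩
    · exact ⟨Sum.inr (Sum.inl (Sum.inl a)), Sum.inr (Sum.inl (Sum.inr b)), by simp [IsExtra],
        by simp [IsExtra], rfl, rfl, by simp, by simp [star, halfStar, hab.symm], by simp [wt]⟩
    · exact ⟨Sum.inr (Sum.inl (Sum.inl a)), Sum.inr (Sum.inl (Sum.inl b)), by simp [IsExtra],
        by simp [IsExtra], rfl, rfl, by simp [hab], by simp [star, halfStar], by simp [wt]⟩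
    · exact ⟨Sum.inr (Sum.inl (Sum.inr a)), Sum.inr (Sum.inl (Sum.inl b)), by simp [IsExtra],
        by simp [IsExtra], rfl, rfl, by simp, by simp [star, halfStar, hab.symm], by simp [wt]⟩
  · rintro ⟨((i | i) | i) | ((i | i) | i), ((j | j) | j) | ((j | j) | j), h1, h2, h3, h4, h5, h6,
      rfl⟩ <;> simp_all [IsExtra, par, star, halfStar, wt]
    · exact ⟨i, j, h5, Or.inr (Or.inl rfl)⟩
    · exact ⟨i, j, Ne.symm h6, Or.inl rfl⟩
    · exact ⟨i, j, Ne.symm h6, Or.inr (Or.inr rfl)⟩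
    · exact ⟨j, i, Ne.symm h5, Or.inr (Or.inl (by abel))⟩

/-! ### The sets `R_0(i)` consist of roots -/

theorem strip_midSet_eps_subset {m c : ℤ}
    (h : X = orth ∨ X = evenEven → ∀ n : ℤ, Even (m * n + c)) :
    strip m c (midSet eps) ⊆ X.realRoots k l := by
  rintro _ ⟨x, hx, n, rfl⟩
  obtain ⟨i, j, hi, hj, pi, pj, hij, hij', rfl⟩ := (mem_midSet_eps X).1 hx
  exact mid_mem_realRoots hi hj (pi.trans pj.symm) hij hij' fun hX => h hX n

theorem strip_midSet_del_subset {m c : ℤ}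
    (h : X = orth ∨ X = evenEven → ∀ n : ℤ, Even (m * n + c)) :
    strip m c (midSet del) ⊆ X.realRoots k l := by
  rintro _ ⟨x, hx, n, rfl⟩
  obtain ⟨i, j, hi, hj, pi, pj, hij, hij', rfl⟩ := (mem_midSet_del X).1 hx
  exact mid_mem_realRoots hi hj (pi.trans pj.symm) hij hij' fun hX => h hX n

theorem sgn_of_par_zero {i : X.Idx k l} (h : par i = 0) : (sgn i : ℂ) = 1 := by
  rcases i with i | i <;> simp_all [par, sgn]

theorem sgn_of_par_one {i : X.Idx k l} (h : par i = 1) : (sgn i : ℂ) = -1 := by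
  rcases i with i | i <;> simp_all [par, sgn]

theorem strip_longSet_eps_subset {m c : ℤ} (hX : X ≠ orth)
    (h : ∀ n : ℤ, X.zeta ^ (m * n + c) = -1) :
    strip m c (longSet eps) ⊆ X.realRoots k l := by
  rintro _ ⟨x, hx, n, rfl⟩
  obtain ⟨i, hi, pi, rfl⟩ := (mem_longSet_eps X).1 hx
  exact long_mem_realRoots hi (fun h => (hX h).elim) (by rw [h, sgn_of_par_zero pi])

theorem strip_longSet_del_subset {m c : ℤ} (hX : X = orth → ∀ n : ℤ, Even (m * n + c))
    (h : ∀ n : ℤ, X.zeta ^ (m * n + c) = 1) :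
    strip m c (longSet del) ⊆ X.realRoots k l := by
  rintro _ ⟨x, hx, n, rfl⟩
  obtain ⟨i, hi, pi, rfl⟩ := (mem_longSet_del X).1 hx
  exact long_mem_realRoots hi (fun h => hX h n) (by rw [h, sgn_of_par_one pi, neg_neg])

theorem strip_shortSet_eps_subset {m c : ℤ} {j : X.Idx k l} (hj : IsExtra j)
    (h : ∀ n : ℤ, X = orth ∨ X.zeta ^ (2 * (m * n + c)) = if par j = 0 then 1 else -1) :
    strip m c (shortSet eps) ⊆ X.realRoots k l := by
  rintro _ ⟨x, hx, n, rfl⟩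
  obtain ⟨i, hi, pi, rfl⟩ := (mem_shortSet_eps X).1 hx
  exact short_mem_realRoots hi hj ((occurs_short_iff hi hj _).2 (h n))

theorem strip_shortSet_del_subset {m c : ℤ} {j : X.Idx k l} (hj : IsExtra j)
    (h : ∀ n : ℤ, X = orth ∨ X.zeta ^ (2 * (m * n + c)) = if par j = 0 then 1 else -1) :
    strip m c (shortSet del) ⊆ X.realRoots k l := by
  rintro _ ⟨x, hx, n, rfl⟩
  obtain ⟨i, hi, pi, rfl⟩ := (mem_shortSet_del X).1 hx
  exact short_mem_realRoots hi hj ((occurs_short_iff hi hj _).2 (h n))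

theorem mem_zdelta {y : Weight k l} : y ∈ zdelta k l ↔ ∃ n : ℤ, y = n • delta := by
  simp [zdelta, strip]

theorem strip_zero_subset {m : ℤ} : strip m 0 {0} ⊆ zdelta k l := by
  rintro _ ⟨x, rfl, n, rfl⟩
  exact mem_zdelta.2 ⟨m * n, by simp⟩

theorem evenRootsOne_subset (X : TwistedType) :
    X.evenRootsOne k l ⊆ zdelta k l ∪ X.realRoots k l := by
  cases X
  · refine Set.union_subset (Set.union_subset (strip_zero_subset.trans Set.subset_union_left)
      (.trans ?_ Set.subset_union_right)) (.trans ?_ Set.subset_union_right)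
    · exact strip_midSet_del_subset (by simp)
    · exact strip_longSet_del_subset (by simp)
        fun n => by rw [add_zero, zeta_zpow_two_mul (by simp)]
  · refine Set.union_subset (Set.union_subset (strip_zero_subset.trans Set.subset_union_left)
      (.trans ?_ Set.subset_union_right)) (.trans ?_ Set.subset_union_right)
    · exact strip_midSet_del_subset (by simp)
    · exact strip_longSet_del_subset (by simp)
        fun n => by rw [add_zero, zeta_zpow_two_mul (by simp)]
  · refine Set.union_subset (Set.union_subset (Set.union_subset
      (strip_zero_subset.trans Set.subset_union_left)
      (.trans ?_ Set.subset_union_right)) (.trans ?_ Set.subset_union_right))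
      (.trans ?_ Set.subset_union_right)
    · refine strip_shortSet_del_subset (j := Sum.inr (Sum.inr (0 : Fin 1))) (by simp [IsExtra])
        fun n => Or.inr ?_
      rw [zeta_zpow_two_mul_evenEven, (odd_two_mul_add_one n).neg_one_zpow]
      simp [par]
    · exact strip_midSet_del_subset fun _ n => by simp
    · exact strip_longSet_del_subset (by simp) fun n => by rw [add_zero, zeta_zpow_four]
  · refine Set.union_subset (Set.union_subset (strip_zero_subset.trans Set.subset_union_left)
      (.trans ?_ Set.subset_union_right)) (.trans ?_ Set.subset_union_right)
    · exact strip_midSet_del_subset fun _ n => by simp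
    · exact strip_longSet_del_subset (fun _ n => by simp)
        fun n => by rw [add_zero, zeta_zpow_two_mul (by simp)]

theorem evenRootsTwo_subset (X : TwistedType) :
    X.evenRootsTwo k l ⊆ zdelta k l ∪ X.realRoots k l := by
  cases X
  · refine Set.union_subset (Set.union_subset (Set.union_subset
      (strip_zero_subset.trans Set.subset_union_left)
      (.trans ?_ Set.subset_union_right)) (.trans ?_ Set.subset_union_right))
      (.trans ?_ Set.subset_union_right)
    · refine strip_shortSet_eps_subset (j := Sum.inl (Sum.inr (0 : Fin 1))) (by simp [IsExtra])
        fun n => Or.inr ?_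
      rw [zeta_zpow_two_mul (by simp)]
      simp [par]
    · exact strip_midSet_eps_subset (by simp)
    · exact strip_longSet_eps_subset (by simp)
        fun n => zeta_zpow_of_odd (by simp) (odd_two_mul_add_one n)
  · refine Set.union_subset (Set.union_subset (strip_zero_subset.trans Set.subset_union_left)
      (.trans ?_ Set.subset_union_right)) (.trans ?_ Set.subset_union_right)
    · exact strip_midSet_eps_subset (by simp)
    · exact strip_longSet_eps_subset (by simp)
        fun n => zeta_zpow_of_odd (by simp) (odd_two_mul_add_one n)
  · refine Set.union_subset (Set.union_subset (Set.union_subset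
      (strip_zero_subset.trans Set.subset_union_left)
      (.trans ?_ Set.subset_union_right)) (.trans ?_ Set.subset_union_right))
      (.trans ?_ Set.subset_union_right)
    · refine strip_shortSet_eps_subset (j := Sum.inl (Sum.inr (0 : Fin 1))) (by simp [IsExtra])
        fun n => Or.inr ?_
      rw [zeta_zpow_two_mul_evenEven, add_zero, (even_two_mul n).neg_one_zpow]
      simp [par]
    · exact strip_midSet_eps_subset fun _ n => by simp
    · exact strip_longSet_eps_subset (by simp) zeta_zpow_four_add_two
  · refine Set.union_subset (Set.union_subset (strip_zero_subset.trans Set.subset_union_left)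
      (.trans ?_ Set.subset_union_right)) (.trans ?_ Set.subset_union_right)
    · exact strip_shortSet_eps_subset (j := Sum.inl (Sum.inr (0 : Fin 2))) (by simp [IsExtra])
        fun n => Or.inl rfl
    · exact strip_midSet_eps_subset fun _ n => by simp

theorem evenRoots_subset (X : TwistedType) (c : Fin 2) :
    X.evenRoots k l c ⊆ zdelta k l ∪ X.realRoots k l := by
  rw [evenRoots]
  split_ifs
  · exact evenRootsOne_subset X
  · exact Set.empty_subset _
  · exact evenRootsTwo_subset X

/-! ### Symmetry and finite parts of the sets `R_0(i)` -/

theorem neg_mem_strip {m c : ℤ} {D : Set (Weight k l)} (hc : m ∣ 2 * c)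
    (hD : ∀ x ∈ D, -x ∈ D) : ∀ y ∈ strip m c D, -y ∈ strip m c D := by
  rintro _ ⟨x, hx, n, rfl⟩
  obtain ⟨d, hd⟩ := hc
  refine ⟨-x, hD x hx, -n - d, ?_⟩
  rw [neg_add, ← neg_smul]
  congr 2
  linear_combination -hd

theorem neg_mem_shortSet {n : ℕ} {x : Fin n → Weight k l} : ∀ y ∈ shortSet x, -y ∈ shortSet x := by
  rintro _ ⟨i, rfl | rfl⟩
  · exact ⟨i, Or.inr rfl⟩
  · exact ⟨i, Or.inl (neg_neg _)⟩

theorem neg_mem_midSet {n : ℕ} {x : Fin n → Weight k l} : ∀ y ∈ midSet x, -y ∈ midSet x := by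
  rintro _ ⟨i, j, hij, rfl | rfl | rfl⟩
  · exact ⟨i, j, hij, Or.inr (Or.inr (by abel))⟩
  · exact ⟨j, i, hij.symm, Or.inr (Or.inl (by abel))⟩
  · exact ⟨i, j, hij, Or.inl (by abel)⟩

theorem neg_mem_singleton_zero : ∀ y ∈ ({0} : Set (Weight k l)), -y ∈ ({0} : Set (Weight k l)) := by
  rintro _ rfl
  simp

theorem neg_mem_union {A B : Set (Weight k l)} (hA : ∀ y ∈ A, -y ∈ A) (hB : ∀ y ∈ B, -y ∈ B) :
    ∀ y ∈ A ∪ B, -y ∈ A ∪ B := by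
  rintro y (h | h)
  · exact Or.inl (hA y h)
  · exact Or.inr (hB y h)

theorem neg_mem_evenRoots (X : TwistedType) (c : Fin 2) :
    ∀ y ∈ X.evenRoots k l c, -y ∈ X.evenRoots k l c := by
  rw [evenRoots]
  split_ifs
  · cases X <;> unfold evenRootsOne <;>
      repeat' first
        | apply neg_mem_union
        | exact neg_mem_strip (by norm_num) neg_mem_singleton_zero
        | exact neg_mem_strip (by norm_num) neg_mem_shortSet
        | exact neg_mem_strip (by norm_num) neg_mem_midSet
  · simp
  · cases X <;> unfold evenRootsTwo <;>
      repeat' first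
        | apply neg_mem_union
        | exact neg_mem_strip (by norm_num) neg_mem_singleton_zero
        | exact neg_mem_strip (by norm_num) neg_mem_shortSet
        | exact neg_mem_strip (by norm_num) neg_mem_midSet

theorem neg_mem_mixedSet : ∀ y ∈ mixedSet k l, -y ∈ mixedSet k l := by
  rintro _ ⟨i, j, rfl | rfl | rfl | rfl⟩
  · exact ⟨i, j, Or.inr (Or.inr (Or.inr (by abel)))⟩
  · exact ⟨i, j, Or.inr (Or.inr (Or.inl (by abel)))⟩
  · exact ⟨i, j, Or.inr (Or.inl (by abel))⟩
  · exact ⟨i, j, Or.inl (by abel)⟩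

theorem neg_mem_dotRoots (X : TwistedType) : ∀ y ∈ X.dotRoots k l, -y ∈ X.dotRoots k l := by
  cases X <;> unfold dotRoots <;>
    repeat' first
      | apply neg_mem_union
      | exact neg_mem_singleton_zero
      | exact neg_mem_shortSet
      | exact neg_mem_midSet
      | exact neg_mem_mixedSet

theorem exists_dot_of_mem_evenRoots {c : Fin 2} {y : Weight k l} (h : y ∈ X.evenRoots k l c) :
    ∃ x ∈ X.dotRoots k l, ∃ n : ℤ, y = x + n • delta := by
  have key : ∀ {m c : ℤ} {D : Set (Weight k l)}, D ⊆ X.dotRoots k l → y ∈ strip m c D →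
      ∃ x ∈ X.dotRoots k l, ∃ n : ℤ, y = x + n • delta := by
    rintro m c D hD ⟨x, hx, n, rfl⟩
    exact ⟨x, hD hx, _, rfl⟩
  rw [evenRoots] at h
  split_ifs at h
  · cases X
    · rcases h with (h | h) | h <;> refine key ?_ h <;> intro x hx <;> (simp only [dotRoots, Set.mem_union]; tauto)
    · rcases h with (h | h) | h <;> refine key ?_ h <;> intro x hx <;> (simp only [dotRoots, Set.mem_union]; tauto)
    · rcases h with ((h | h) | h) | h <;> refine key ?_ h <;> intro x hx <;> (simp only [dotRoots, Set.mem_union]; tauto)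
    · rcases h with (h | h) | h <;> refine key ?_ h <;> intro x hx <;> (simp only [dotRoots, Set.mem_union]; tauto)
  · exact h.elim
  · cases X
    · rcases h with ((h | h) | h) | h <;> refine key ?_ h <;> intro x hx <;> (simp only [dotRoots, Set.mem_union]; tauto)
    · rcases h with (h | h) | h <;> refine key ?_ h <;> intro x hx <;> (simp only [dotRoots, Set.mem_union]; tauto)
    · rcases h with ((h | h) | h) | h <;> refine key ?_ h <;> intro x hx <;> (simp only [dotRoots, Set.mem_union]; tauto)
    · rcases h with (h | h) | h <;> refine key ?_ h <;> intro x hx <;> (simp only [dotRoots, Set.mem_union]; tauto)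

/-! ### Connectedness of `R_0(i)` -/

theorem epsCoord_strip_del {m c : ℤ} {D : Set (Weight k l)} (a : Fin k)
    (h : ∀ x ∈ D, epsCoord a x = 0) : ∀ y ∈ strip m c D, epsCoord a y = 0 := by
  rintro _ ⟨x, hx, n, rfl⟩
  simp [h x hx]

theorem delCoord_strip_eps {m c : ℤ} {D : Set (Weight k l)} (b : Fin l)
    (h : ∀ x ∈ D, delCoord b x = 0) : ∀ y ∈ strip m c D, delCoord b y = 0 := by
  rintro _ ⟨x, hx, n, rfl⟩
  simp [h x hx]

theorem epsCoord_sets_del (a : Fin k) : (∀ x ∈ shortSet (del : Fin l → Weight k l), epsCoord a x = 0) ∧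
    (∀ x ∈ midSet (del : Fin l → Weight k l), epsCoord a x = 0) ∧
    ∀ x ∈ longSet (del : Fin l → Weight k l), epsCoord a x = 0 := by
  refine ⟨?_, ?_, ?_⟩
  · rintro _ ⟨i, rfl | rfl⟩ <;> simp
  · rintro _ ⟨i, j, -, rfl | rfl | rfl⟩ <;> simp
  · rintro _ ⟨i, rfl | rfl⟩ <;> simp

theorem delCoord_sets_eps (b : Fin l) : (∀ x ∈ shortSet (eps : Fin k → Weight k l), delCoord b x = 0) ∧
    (∀ x ∈ midSet (eps : Fin k → Weight k l), delCoord b x = 0) ∧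
    ∀ x ∈ longSet (eps : Fin k → Weight k l), delCoord b x = 0 := by
  refine ⟨?_, ?_, ?_⟩
  · rintro _ ⟨i, rfl | rfl⟩ <;> simp
  · rintro _ ⟨i, j, -, rfl | rfl | rfl⟩ <;> simp
  · rintro _ ⟨i, rfl | rfl⟩ <;> simp

theorem epsCoord_evenRootsOne {y : Weight k l} (h : y ∈ X.evenRootsOne k l) (a : Fin k) :
    epsCoord a y = 0 := by
  have h0 : ∀ x ∈ ({0} : Set (Weight k l)), epsCoord a x = 0 := by rintro _ rfl; simp
  obtain ⟨h1, h2, h3⟩ := epsCoord_sets_del (k := k) (l := l) a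
  cases X
  · rcases h with (h | h) | h
    exacts [epsCoord_strip_del a h0 y h, epsCoord_strip_del a h2 y h, epsCoord_strip_del a h3 y h]
  · rcases h with (h | h) | h
    exacts [epsCoord_strip_del a h0 y h, epsCoord_strip_del a h2 y h, epsCoord_strip_del a h3 y h]
  · rcases h with ((h | h) | h) | h
    exacts [epsCoord_strip_del a h0 y h, epsCoord_strip_del a h1 y h, epsCoord_strip_del a h2 y h,
      epsCoord_strip_del a h3 y h]
  · rcases h with (h | h) | h
    exacts [epsCoord_strip_del a h0 y h, epsCoord_strip_del a h2 y h, epsCoord_strip_del a h3 y h]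

theorem delCoord_evenRootsTwo {y : Weight k l} (h : y ∈ X.evenRootsTwo k l) (b : Fin l) :
    delCoord b y = 0 := by
  have h0 : ∀ x ∈ ({0} : Set (Weight k l)), delCoord b x = 0 := by rintro _ rfl; simp
  obtain ⟨h1, h2, h3⟩ := delCoord_sets_eps (k := k) (l := l) b
  cases X
  · rcases h with ((h | h) | h) | h
    exacts [delCoord_strip_eps b h0 y h, delCoord_strip_eps b h1 y h, delCoord_strip_eps b h2 y h,
      delCoord_strip_eps b h3 y h]
  · rcases h with (h | h) | h
    exacts [delCoord_strip_eps b h0 y h, delCoord_strip_eps b h2 y h, delCoord_strip_eps b h3 y h]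
  · rcases h with ((h | h) | h) | h
    exacts [delCoord_strip_eps b h0 y h, delCoord_strip_eps b h1 y h, delCoord_strip_eps b h2 y h,
      delCoord_strip_eps b h3 y h]
  · rcases h with (h | h) | h
    exacts [delCoord_strip_eps b h0 y h, delCoord_strip_eps b h1 y h, delCoord_strip_eps b h2 y h]

theorem mem_strip_of_mem {m : ℤ} (c : ℤ) {D : Set (Weight k l)} {x : Weight k l} (h : x ∈ D) :
    x + c • delta ∈ strip m c D := ⟨x, h, 0, by simp⟩

/-- These roots, proportional to `δ_b` modulo `δ`, are the hubs in `spread` and the test vectors in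
`imagRoots_eq`. -/
theorem exists_special_del (X : TwistedType) (b : Fin l) :
    ∃ m n : ℤ, m ≠ 0 ∧ m • del b + n • delta ∈ X.evenRootsOne k l := by
  have hs : (del b : Weight k l) ∈ shortSet del := ⟨b, Or.inl rfl⟩
  have hl : (2 : ℕ) • (del b : Weight k l) ∈ longSet del := ⟨b, Or.inl rfl⟩
  cases X
  · exact ⟨2, 0, two_ne_zero, Or.inr (mem_strip_of_mem 0 hl)⟩
  · exact ⟨2, 0, two_ne_zero, Or.inr (mem_strip_of_mem 0 hl)⟩
  · exact ⟨1, 1, one_ne_zero, Or.inl (Or.inl (Or.inr (by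
      rw [one_smul ℤ (del b)]; exact mem_strip_of_mem 1 hs)))⟩
  · exact ⟨2, 0, two_ne_zero, Or.inr (mem_strip_of_mem 0 hl)⟩

theorem exists_special_eps (X : TwistedType) (a : Fin k) :
    ∃ m n : ℤ, m ≠ 0 ∧ m • eps a + n • delta ∈ X.evenRootsTwo k l := by
  have hs : (eps a : Weight k l) ∈ shortSet eps := ⟨a, Or.inl rfl⟩
  have hl : (2 : ℕ) • (eps a : Weight k l) ∈ longSet eps := ⟨a, Or.inl rfl⟩
  cases X
  · exact ⟨2, 1, two_ne_zero, Or.inr (mem_strip_of_mem 1 hl)⟩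
  · exact ⟨2, 1, two_ne_zero, Or.inr (mem_strip_of_mem 1 hl)⟩
  · exact ⟨2, 2, two_ne_zero, Or.inr (mem_strip_of_mem 2 hl)⟩
  · exact ⟨1, 0, one_ne_zero, Or.inl (Or.inr (by
      rw [one_smul ℤ (eps a)]; exact mem_strip_of_mem 0 hs))⟩

theorem mid_del_mem (X : TwistedType) {b b' : Fin l} (h : b ≠ b') :
    (del b + del b' : Weight k l) ∈ X.evenRootsOne k l := by
  have hm : (del b + del b' : Weight k l) ∈ midSet del := ⟨b, b', h, Or.inl rfl⟩
  have key : ∀ m : ℤ, (del b + del b' : Weight k l) ∈ strip m 0 (midSet del) := fun m => by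
    simpa using mem_strip_of_mem (m := m) 0 hm
  cases X
  · exact Or.inl (Or.inr (key 1))
  · exact Or.inl (Or.inr (key 1))
  · exact Or.inl (Or.inr (key 2))
  · exact Or.inl (Or.inr (key 2))

theorem mid_eps_mem (X : TwistedType) {a a' : Fin k} (h : a ≠ a') :
    (eps a + eps a' : Weight k l) ∈ X.evenRootsTwo k l := by
  have hm : (eps a + eps a' : Weight k l) ∈ midSet eps := ⟨a, a', h, Or.inl rfl⟩
  have key : ∀ m : ℤ, (eps a + eps a' : Weight k l) ∈ strip m 0 (midSet eps) := fun m => by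
    simpa using mem_strip_of_mem (m := m) 0 hm
  cases X
  · exact Or.inl (Or.inr (key 1))
  · exact Or.inl (Or.inr (key 1))
  · exact Or.inl (Or.inr (key 2))
  · exact Or.inr (key 2)

theorem mem_realRoots_of_evenRoots {S : Set (Weight k l)} (hS : S ⊆ zdelta k l ∪ X.realRoots k l)
    {y : Weight k l} (hy : y ∈ S) {i : Weight k l →ₗ[ℂ] ℂ} (hi : i delta = 0) (h : i y ≠ 0) :
    y ∈ X.realRoots k l := by
  refine (hS hy).resolve_left fun h0 => ?_
  obtain ⟨n, rfl⟩ := mem_zdelta.1 h0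
  exact h (by rw [map_zsmul, hi, smul_zero])

/-- A property that spreads between non-orthogonal real roots of `S` holds for all real roots of
`S`, if every real root of `S` is non-orthogonal to one of the roots `m x_b + n δ`, and if `S`
contains the roots `x_b + x_b'`. -/
theorem spread {N : ℕ} (x : Fin N → Weight k l) (coord : Fin N → Weight k l →ₗ[ℂ] ℂ)
    (hx : ∀ b b', coord b (x b') = if b' = b then 1 else 0) (hd : ∀ b, coord b delta = 0)
    (r : ℂ) (hr : r ≠ 0) (hf : ∀ b y, weightForm (x b) y = r * coord b y)
    {S : Set (Weight k l)} (hS : S ⊆ zdelta k l ∪ X.realRoots k l)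
    (hco : ∀ y ∈ S, y ∈ X.realRoots k l → ∃ b, coord b y ≠ 0)
    (hsp : ∀ b, ∃ m n : ℤ, m ≠ 0 ∧ m • x b + n • delta ∈ S)
    (hmid : ∀ b b', b ≠ b' → x b + x b' ∈ S) {Q : Weight k l → Prop}
    (hQ : ∀ y ∈ S, ∀ z ∈ S, y ∈ X.realRoots k l → z ∈ X.realRoots k l → weightForm y z ≠ 0 →
      Q y → Q z) {y z : Weight k l} (hy : y ∈ S) (hz : z ∈ S) (hy' : y ∈ X.realRoots k l)
    (hz' : z ∈ X.realRoots k l) (h : Q y) : Q z := by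
  choose m n hm hs using hsp
  have hsc : ∀ b b', coord b (m b' • x b' + n b' • delta) = if b' = b then (m b' : ℂ) else 0 := by
    intro b b'
    simp [hx, hd]
  have hsf : ∀ b, ∀ w ∈ X.realRoots k l, coord b w ≠ 0 →
      weightForm (m b • x b + n b • delta) w ≠ 0 := by
    intro b w hw hbw
    rw [weightForm_add_left, weightForm_zsmul_left, weightForm_zsmul_left, weightForm_delta_left,
      level_of_mem_roots hw.1, hf, mul_zero, add_zero]
    exact mul_ne_zero (Int.cast_ne_zero.2 (hm b)) (mul_ne_zero hr hbw)
  have hsr : ∀ b, m b • x b + n b • delta ∈ X.realRoots k l := fun b =>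
    mem_realRoots_of_evenRoots hS (hs b) (hd b) (by
      rw [hsc, if_pos rfl]; exact Int.cast_ne_zero.2 (hm b))
  obtain ⟨b, hb⟩ := hco y hy hy'
  obtain ⟨b', hb'⟩ := hco z hz hz'
  -- A root with nonzero coordinate at `b` is not orthogonal to the hub `m_b x_b + n_b δ`. The
  -- property therefore travels from `y` to a hub, between hubs, and from a hub to `z`.
  have h1 : Q (m b • x b + n b • delta) :=
    hQ y hy _ (hs b) hy' (hsr b) (by rw [weightForm_comm]; exact hsf b y hy' hb) h
  suffices Q (m b' • x b' + n b' • delta) from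
    hQ _ (hs b') z hz (hsr b') hz' (hsf b' z hz' hb') this
  by_cases hbb : b = b'
  · rwa [← hbb]
  -- Distinct hubs are orthogonal to each other; the root `x_b + x_{b'}` is orthogonal to neither
  -- and joins them.
  · have c1 : coord b (x b + x b') = 1 := by simp [hx, Ne.symm hbb]
    have c2 : coord b' (x b + x b') = 1 := by simp [hx, hbb]
    have hr' : x b + x b' ∈ X.realRoots k l :=
      mem_realRoots_of_evenRoots hS (hmid b b' hbb) (hd b) (by rw [c1]; exact one_ne_zero)
    refine hQ _ (hmid b b' hbb) _ (hs b') hr' (hsr b') ?_ (hQ _ (hs b) _ (hmid b b' hbb)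
      (hsr b) hr' (hsf b _ hr' (by rw [c1]; exact one_ne_zero)) h1)
    rw [weightForm_comm]
    exact hsf b' _ hr' (by rw [c2]; exact one_ne_zero)

theorem evenRoots_spread {c : Fin 2} {Q : Weight k l → Prop}
    (hQ : ∀ y ∈ X.evenRoots k l c, ∀ z ∈ X.evenRoots k l c, y ∈ X.realRoots k l →
      z ∈ X.realRoots k l → weightForm y z ≠ 0 → Q y → Q z) {y z : Weight k l}
    (hy : y ∈ X.evenRoots k l c) (hz : z ∈ X.evenRoots k l c) (hy' : y ∈ X.realRoots k l)
    (hz' : z ∈ X.realRoots k l) (h : Q y) : Q z := by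
  rw [evenRoots] at hQ hy hz
  split_ifs at hQ hy hz
  · refine spread del delCoord (fun b b' => delCoord_del b b') delCoord_delta (-(1 / 2))
      (by norm_num) (fun b y => by rw [weightForm_del]; ring) (evenRootsOne_subset X)
      (fun y hy hr => ?_) (exists_special_del X) (fun b b' => mid_del_mem X) hQ hy hz hy' hz' h
    by_contra! H
    exact hr.2 (weightForm_self_eq_zero (epsCoord_evenRootsOne hy) H (level_of_mem_roots hr.1))
  · exact hy.elim
  · refine spread eps epsCoord (fun b b' => epsCoord_eps b b') epsCoord_delta (1 / 2)
      (by norm_num) (fun b y => by rw [weightForm_eps]; ring) (evenRootsTwo_subset X)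
      (fun y hy hr => ?_) (exists_special_eps X) (fun b b' => mid_eps_mem X) hQ hy hz hy' hz' h
    by_contra! H
    exact hr.2 (weightForm_self_eq_zero H (delCoord_evenRootsTwo hy) (level_of_mem_roots hr.1))

/-! ### Imaginary roots -/

/-- On diagonal matrices `adj` permutes the entries by the duality and changes their sign, so
self-dual diagonals have eigenvalue `-1`. -/
theorem diagonal_mem_eigenMat {X : TwistedType} (hX : X ≠ orth) {d : X.Idx k l → ℂ} {p : ℤ}
    (hs : str (Matrix.diagonal d) = 0) (hd : ∀ i, d (star i) = d i) (hp : X.zeta ^ p = -1) :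
    Matrix.diagonal d ∈ X.eigenMat k l p := by
  have h1 : (X.adj k l).map (Matrix.diagonal d) = X.zeta ^ p • Matrix.diagonal d := by
    ext i j
    rw [adj_apply, hp, Matrix.smul_apply, smul_eq_mul]
    by_cases hij : i = j
    · subst hij
      rw [Matrix.diagonal_apply_eq, Matrix.diagonal_apply_eq, adjCoeff_of_par_eq rfl, hd,
        gramSign_mul_self]
    · rw [Matrix.diagonal_apply_ne _ hij, Matrix.diagonal_apply_ne _
        (fun h => hij (star_inj.1 h).symm), mul_zero, mul_zero]
  cases X
  · exact ⟨hs, h1⟩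
  · exact ⟨hs, h1⟩
  · exact ⟨hs, h1⟩
  · exact (hX rfl).elim

theorem delta_mem_roots_of_diagonal {X : TwistedType} {p : ℤ} {d : X.Idx k l → ℂ}
    (h : Matrix.diagonal d ∈ X.eigenMat k l p) {i j : X.Idx k l} (hd : d i ≠ d j) :
    p • delta ∈ X.roots k l := by
  have := mem_roots_of_mat h (ω := 0) (fun a b hab => ?_)
    (notMem_span_one_of_diag (i := i) (j := j) (by simpa using hd))
  · rwa [zero_add] at this
  · by_cases e : a = b
    · rw [e, sub_self]
    · exact (hab (Matrix.diagonal_apply_ne _ e)).elim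

theorem delta_mem_roots_of_zeta_eq_one (hl : 1 ≤ l) {p : ℤ} (hp : X.zeta ^ p = 1) :
    p • (delta : Weight k l) ∈ X.roots k l := by
  have h := diag_mem_eigenMat (X := X) ((0, Pi.single ⟨0, hl⟩ 1, 0, 0) : Cartan k l) hp
  rw [diag_eq] at h
  refine delta_mem_roots_of_diagonal h (i := Sum.inr (Sum.inl (Sum.inl ⟨0, hl⟩)))
    (j := Sum.inr (Sum.inl (Sum.inr ⟨0, hl⟩))) ?_
  simp only [wt, del]
  norm_num

theorem str_diagonal (d : X.Idx k l → ℂ) : str (Matrix.diagonal d) =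
    ∑ a, (d (Sum.inl (Sum.inl (Sum.inl a))) + d (Sum.inl (Sum.inl (Sum.inr a)))) +
      ∑ o, d (Sum.inl (Sum.inr o)) -
      (∑ b, (d (Sum.inr (Sum.inl (Sum.inl b))) + d (Sum.inr (Sum.inl (Sum.inr b)))) +
      ∑ o, d (Sum.inr (Sum.inr o))) := by
  change ∑ i, Matrix.diagonal d _ _ - ∑ i, Matrix.diagonal d _ _ = _
  simp only [Matrix.diagonal_apply_eq, Fintype.sum_sum_type, Finset.sum_add_distrib]

/-- A diagonal matrix supported on the basis vectors of weights `±ε_a`, `±δ_b` and on the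
additional even basis vectors. -/
def symDiag {X : TwistedType} {k l : ℕ} (u : Fin k → ℂ) (b : Fin l) (v : ℂ) : X.Idx k l → ℂ
  | Sum.inl (Sum.inl (Sum.inl a)) => u a
  | Sum.inl (Sum.inl (Sum.inr a)) => u a
  | Sum.inl (Sum.inr _) => v
  | Sum.inr (Sum.inl (Sum.inl b')) => if b' = b then 1 else 0
  | Sum.inr (Sum.inl (Sum.inr b')) => if b' = b then 1 else 0
  | Sum.inr (Sum.inr _) => 0

theorem symDiag_star {u : Fin k → ℂ} {b : Fin l} {v : ℂ} (i : X.Idx k l) :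
    symDiag u b v (star i) = symDiag u b v i := by
  rcases i with ((i | i) | i) | ((i | i) | i) <;> rfl

theorem str_symDiag {u : Fin k → ℂ} {b : Fin l} {v : ℂ} :
    str (Matrix.diagonal (symDiag u b v : X.Idx k l → ℂ)) = 2 * ∑ a, u a + X.p * v - 2 := by
  rw [str_diagonal]
  simp [symDiag, ← two_mul, Finset.mul_sum]

/-- The diagonal matrix with entries `1` and `-1` at the two additional even basis vectors. -/
def orthDiag : orth.Idx k l → ℂ
  | Sum.inl (Sum.inr o) => if o.val = 0 then 1 else -1
  | _ => 0

/-- A nonscalar matrix of weight zero is needed in every degree. If `ζ^p = 1`, an element of the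
Cartan subalgebra serves. If `ζ^p = -1` outside the orthosymplectic case, one takes a self-dual
diagonal matrix of supertrace zero. The odd degrees of `D(k+1,ℓ)^(2)` use the two additional even
vectors, those of `A(2k,2ℓ)^(4)` an odd matrix joining the two additional vectors of opposite
parity. -/
theorem delta_mem_roots (hX : X.Admissible k l) (p : ℤ) : p • delta ∈ X.roots k l := by
  have hl : 1 ≤ l := by
    cases X
    exacts [hX, hX.2.1, hX, hX]
  let b : Fin l := ⟨0, hl⟩
  by_cases h1 : X.zeta ^ p = 1
  · exact delta_mem_roots_of_zeta_eq_one hl h1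
  have hodd : X ≠ evenEven → Odd p := fun h => by
    by_contra hp
    rw [Int.not_odd_iff_even] at hp
    exact h1 (zeta_zpow_of_even h hp)
  have main : ∀ {X : TwistedType}, X ≠ orth → X.p = 1 → X.zeta ^ p = -1 →
      p • (delta : Weight k l) ∈ X.roots k l := by
    intro X hX hp h
    have o : Fin X.p := ⟨0, by omega⟩
    refine delta_mem_roots_of_diagonal (diagonal_mem_eigenMat hX ?_
      (symDiag_star (u := 0) (b := b) (v := 2)) h) (i := Sum.inl (Sum.inr o))
      (j := Sum.inr (Sum.inl (Sum.inl b))) (by simp [symDiag])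
    rw [str_symDiag, hp]
    simp
  cases X
  · exact main (by simp) rfl (zeta_zpow_of_odd (by simp) (hodd (by simp)))
  · obtain ⟨hk, -, hkl⟩ := hX
    have hstr : str (Matrix.diagonal (symDiag (Pi.single ⟨0, hk⟩ 1) b 0 : oddOdd.Idx k l → ℂ)) =
        0 := by
      rw [str_symDiag]
      simp
    have h := diagonal_mem_eigenMat (X := oddOdd) (by simp) hstr symDiag_star
      (zeta_zpow_of_odd (by simp) (hodd (by simp)))
    -- The matrix is the identity on one even and one odd pair. It is nonscalar because a second odd
    -- or a second even pair carries the entry `0`; the exclusion of `(k, ℓ) = (1, 1)` guarantees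
    -- such a pair.
    by_cases hk1 : k = 1
    · have hl1 : 1 < l := by
        by_contra H
        exact hkl (by rw [hk1]; congr 1; omega)
      refine delta_mem_roots_of_diagonal h (i := Sum.inr (Sum.inl (Sum.inl b)))
        (j := Sum.inr (Sum.inl (Sum.inl ⟨1, hl1⟩))) ?_
      simp [symDiag, b]
    · refine delta_mem_roots_of_diagonal h (i := Sum.inr (Sum.inl (Sum.inl b)))
        (j := Sum.inl (Sum.inl (Sum.inl ⟨1, by omega⟩))) ?_
      simp [symDiag]
  · rcases Int.even_or_odd p with hp | hp
    · refine main (by simp) rfl ?_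
      obtain ⟨q, rfl⟩ := hp
      rw [← two_mul, zeta_zpow_two_mul_evenEven] at h1 ⊢
      rcases Int.even_or_odd q with hq | hq
      · exact (h1 hq.neg_one_zpow).elim
      · exact hq.neg_one_zpow
    · have ho : Occurs (Sum.inl (Sum.inr (0 : Fin 1)) : evenEven.Idx k l)
          (Sum.inr (Sum.inr (0 : Fin 1))) p := by
        refine Or.inr ⟨by simp, ?_, by simp [star]⟩
        rw [zeta_zpow_two_mul_evenEven, hp.neg_one_zpow]
        have h01 : (0 : ZMod 2) ≠ 1 := by decide
        simp [adjSq, adjCoeff, gramSign, star, halfStar, superSign, par, h01]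
      simpa [wt] using ho.mem_roots (by simp) (by simp)
  · have hp := hodd (by simp)
    have hstr : (Matrix.diagonal orthDiag : orth.Mat k l) ∈ orth.eigenMat k l p := by
      constructor
      · refine sub_eq_zero.2 ?_
        ext i j
        rw [adj_apply]
        by_cases hij : i = j
        · subst hij
          rw [Matrix.diagonal_apply_eq, LinearMap.id_apply, Matrix.diagonal_apply_eq,
            adjCoeff_of_par_eq rfl, gramSign_mul_self]
          rcases i with ((i | i) | i) | ((i | i) | i)
          · simp [star, halfStar, orthDiag]
          · simp [star, halfStar, orthDiag]
          · change Fin 2 at i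
            fin_cases i <;> simp [star, halfStar, orthDiag, Fin.rev, TwistedType.p]
          · simp [star, halfStar, orthDiag]
          · simp [star, halfStar, orthDiag]
          · exact Fin.elim0 (show Fin 0 from i)
        · rw [LinearMap.id_apply, Matrix.diagonal_apply_ne _ hij, Matrix.diagonal_apply_ne _
            (fun h => hij (star_inj.1 h).symm), mul_zero]
      · change (orth.swapConj k l).map _ = orth.zeta ^ p • _
        ext i j
        rw [swapConj_apply, zeta_zpow_of_odd (by simp) hp, Matrix.smul_apply]
        by_cases hij : i = j
        · subst hij
          rw [Matrix.diagonal_apply_eq, Matrix.diagonal_apply_eq]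
          rcases i with ((i | i) | i) | ((i | i) | i)
          · simp [swapIdx, orthDiag]
          · simp [swapIdx, orthDiag]
          · change Fin 2 at i
            fin_cases i
            · change (if (1 : ℕ) = 0 then (1 : ℂ) else -1) = -1 * if (0 : ℕ) = 0 then 1 else -1
              norm_num
            · change (if (0 : ℕ) = 0 then (1 : ℂ) else -1) = -1 * if (1 : ℕ) = 0 then 1 else -1
              norm_num
          · simp [swapIdx, orthDiag]
          · simp [swapIdx, orthDiag]
          · exact Fin.elim0 (show Fin 0 from i)
        · rw [Matrix.diagonal_apply_ne _ hij, smul_zero, Matrix.diagonal_apply_ne]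
          intro h
          exact hij (by rw [← swapIdx_swapIdx i, h, swapIdx_swapIdx])
    refine delta_mem_roots_of_diagonal hstr (i := Sum.inl (Sum.inr (0 : Fin 2)))
      (j := Sum.inl (Sum.inr (1 : Fin 2))) ?_
    norm_num [orthDiag]

/-- Orthogonality to the special roots at every `δ_b` and `ε_a` kills all finite coordinates.
Conversely, pairing with `δ` is evaluation on the central element, where every root vanishes. -/
theorem imagRoots_eq (hX : X.Admissible k l) : X.imagRoots k l = zdelta k l := by
  ext α
  constructor
  · rintro ⟨h, h0⟩
    rcases exists_of_mem_roots h with ⟨p, rfl⟩ | ⟨i, j, p, -, e, -⟩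
    · exact mem_zdelta.2 ⟨p, rfl⟩
    have hl := level_of_mem_roots h
    have h1 : ∀ b, delCoord b α = 0 := by
      intro b
      obtain ⟨m, n, hm, hs⟩ := exists_special_del (k := k) X b
      have hr : m • del b + n • delta ∈ X.realRoots k l :=
        mem_realRoots_of_evenRoots (evenRootsOne_subset X) hs (delCoord_delta b)
          (by simpa using hm)
      have := h0 _ hr.1
      rw [weightForm_add_right, weightForm_zsmul_right, weightForm_zsmul_right,
        weightForm_delta_right, hl, weightForm_comm, weightForm_del] at this
      simpa [hm] using this
    have h2 : ∀ a, epsCoord a α = 0 := by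
      intro a
      obtain ⟨m, n, hm, hs⟩ := exists_special_eps (l := l) X a
      have hr : m • eps a + n • delta ∈ X.realRoots k l :=
        mem_realRoots_of_evenRoots (evenRootsTwo_subset X) hs (epsCoord_delta a)
          (by simpa using hm)
      have := h0 _ hr.1
      rw [weightForm_add_right, weightForm_zsmul_right, weightForm_zsmul_right,
        weightForm_delta_right, hl, weightForm_comm, weightForm_eps] at this
      simpa [hm] using this
    refine mem_zdelta.2 ⟨p, weight_ext (fun a => ?_) (fun b => ?_) ?_ ?_⟩
    · rw [h2]; simp
    · rw [h1]; simp
    · rw [hl]; simp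
    · rw [e]; simp
  · intro h
    obtain ⟨p, rfl⟩ := mem_zdelta.1 h
    refine ⟨delta_mem_roots hX p, fun β hβ => ?_⟩
    rw [weightForm_zsmul_left, weightForm_delta_left, level_of_mem_roots hβ, mul_zero]

/-! ### From real roots to the sets `R_0(i)` -/

theorem ne_zero_of_par_zero {i : X.Idx k l} (hi : ¬ IsExtra i) (h : par i = 0) : k ≠ 0 := by
  rcases i with ((i | i) | i) | ((i | i) | i) <;> simp [IsExtra, par] at hi h
  · exact fun hk => (hk ▸ i).elim0
  · exact fun hk => (hk ▸ i).elim0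

theorem evenRoots_one (h : k ≠ 0) : X.evenRoots k l 1 = X.evenRootsTwo k l := by
  simp [evenRoots, h]

theorem evenRoots_zero : X.evenRoots k l 0 = X.evenRootsOne k l := by
  simp [evenRoots]

theorem oddOdd_not_isExtra (i : oddOdd.Idx k l) : ¬ IsExtra i := by
  rcases i with ((i | i) | i) | ((i | i) | i)
  · exact id
  · exact id
  · exact Fin.elim0 (show Fin 0 from i)
  · exact id
  · exact id
  · exact Fin.elim0 (show Fin 0 from i)

/-- Up to multiples of `δ`, a real root or its double belongs to one of the sets `R_0(i)`. -/
theorem exists_mem_evenRoots {α : Weight k l} (h : α ∈ X.realRoots k l) :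
    ∃ c : Fin 2, (∃ n : ℤ, α + n • delta ∈ X.evenRoots k l c) ∨
      (2 • α ∈ X.evenRoots k l c ∧ ∀ n : ℤ, α + n • delta ∈ X.realRoots k l) := by
  obtain ⟨i, j, p, hw, rfl, ho, hi, hj⟩ := exists_of_mem_realRoots h
  have hpar : ∀ i : X.Idx k l, par i = 0 ∨ par i = 1 := by
    rintro (i | i)
    · exact Or.inl rfl
    · exact Or.inr rfl
  have shift : ∀ x : Weight k l, ∀ n : ℤ, x + p • delta + (n - p) • delta = x + n • delta := by
    intro x n
    rw [add_assoc, ← add_smul]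
    congr 2
    ring
  by_cases hje : IsExtra j
  · rw [isExtra_of_wt_eq_zero hje, sub_zero] at h ⊢
    rcases hpar i with pi | pi
    · refine ⟨1, Or.inl ⟨0 - p, ?_⟩⟩
      rw [shift, evenRoots_one (ne_zero_of_par_zero hi pi)]
      have hm := (mem_shortSet_eps X).2 ⟨i, hi, pi, rfl⟩
      cases X
      · exact Or.inl (Or.inl (Or.inr (mem_strip_of_mem 0 hm)))
      · exact (oddOdd_not_isExtra j hje).elim
      · exact Or.inl (Or.inl (Or.inr (mem_strip_of_mem 0 hm)))
      · exact Or.inl (Or.inr (mem_strip_of_mem 0 hm))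
    · refine ⟨0, ?_⟩
      rw [evenRoots_zero]
      have hm := (mem_shortSet_del X).2 ⟨i, hi, pi, rfl⟩
      have hl := (mem_longSet_del X).2 ⟨i, hi, pi, rfl⟩
      -- In `A(2k,2ℓ-1)^(2)` and `D(k+1,ℓ)^(2)` no shift of the odd root `±δ_b + pδ` lies in
      -- `R_0(1)`, but its double does. That all shifts are roots is recorded because it later
      -- transfers fullness of `α` to `2α`.
      have double : ∀ (Y : TwistedType) (hY : Y ≠ evenEven) (i j : Y.Idx k l) (hi : ¬ IsExtra i)
          (pi : par i = 1) (hj : IsExtra j) (hZ : Y = orth ∨ par j = 0),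
          ∀ n : ℤ, wt i + p • delta + n • delta ∈ Y.realRoots k l := by
        intro Y hY i j hi pi hj hZ n
        rw [add_assoc, ← add_smul]
        refine short_mem_realRoots hi hj ((occurs_short_iff hi hj _).2 ?_)
        rcases hZ with hZ | hZ
        · exact Or.inl hZ
        · rw [if_pos hZ]
          exact Or.inr (zeta_zpow_two_mul hY _)
      have hl' : ∀ {m : ℤ}, m = 2 →
          2 • (wt i + p • delta : Weight k l) ∈ strip m 0 (longSet del) := by
        rintro _ rfl
        exact ⟨_, hl, p, by rw [smul_add, add_zero, mul_smul]; norm_cast⟩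
      cases X
      · refine Or.inr ⟨Or.inr (hl' rfl), double _ (by simp) i j hi pi hje (Or.inr ?_)⟩
        rcases j with ((j | j) | j) | ((j | j) | j) <;> simp [IsExtra, par] at hje ⊢
        exact Fin.elim0 (show Fin 0 from j)
      · exact (oddOdd_not_isExtra j hje).elim
      · refine Or.inl ⟨1 - p, ?_⟩
        rw [shift]
        exact Or.inl (Or.inl (Or.inr (mem_strip_of_mem 1 hm)))
      · exact Or.inr ⟨Or.inr (hl' rfl), double _ (by simp) i j hi pi hje (Or.inl rfl)⟩
  have hij := hj.resolve_left hje
  have hne : i ≠ j := fun e => hw (by rw [e])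
  by_cases hs : j = star i
  · subst hs
    have e2 : (wt i - wt (star i) : Weight k l) = 2 • wt i := by
      rw [wt_star, sub_neg_eq_add, two_smul]
    rw [e2]
    rcases hpar i with pi | pi
    · refine ⟨1, Or.inl ?_⟩
      rw [evenRoots_one (ne_zero_of_par_zero hi pi)]
      have hm := (mem_longSet_eps X).2 ⟨i, hi, pi, rfl⟩
      cases X
      · exact ⟨1 - p, by rw [shift]; exact Or.inr (mem_strip_of_mem 1 hm)⟩
      · exact ⟨1 - p, by rw [shift]; exact Or.inr (mem_strip_of_mem 1 hm)⟩
      · exact ⟨2 - p, by rw [shift]; exact Or.inr (mem_strip_of_mem 2 hm)⟩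
      · obtain ⟨h1, h2⟩ := (occurs_long_iff hi p).1 ho
        rw [zeta_zpow_of_even (by simp) (h1 rfl), sgn_of_par_zero pi] at h2
        norm_num at h2
    · refine ⟨0, Or.inl ⟨0 - p, ?_⟩⟩
      rw [evenRoots_zero, shift]
      have hm := (mem_longSet_del X).2 ⟨i, hi, pi, rfl⟩
      cases X <;> exact Or.inr (mem_strip_of_mem 0 hm)
  · rcases hpar i with pi | pi
    · refine ⟨1, Or.inl ⟨0 - p, ?_⟩⟩
      rw [shift, evenRoots_one (ne_zero_of_par_zero hi pi)]
      have hm := (mem_midSet_eps X).2 ⟨i, j, hi, hje, pi, hij ▸ pi, hne, hs, rfl⟩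
      cases X
      · exact Or.inl (Or.inr (mem_strip_of_mem 0 hm))
      · exact Or.inl (Or.inr (mem_strip_of_mem 0 hm))
      · exact Or.inl (Or.inr (mem_strip_of_mem 0 hm))
      · exact Or.inr (mem_strip_of_mem 0 hm)
    · refine ⟨0, Or.inl ⟨0 - p, ?_⟩⟩
      rw [shift, evenRoots_zero]
      have hm := (mem_midSet_del X).2 ⟨i, j, hi, hje, pi, hij ▸ pi, hne, hs, rfl⟩
      cases X
      · exact Or.inl (Or.inr (mem_strip_of_mem 0 hm))
      · exact Or.inl (Or.inr (mem_strip_of_mem 0 hm))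
      · exact Or.inl (Or.inr (mem_strip_of_mem 0 hm))
      · exact Or.inl (Or.inr (mem_strip_of_mem 0 hm))

end TwistedType
end

noncomputable section

/-! ### Locally nilpotent `sl₂`-triples -/

attribute [local instance] LieRing.ofAssociativeRing

section Sl2

variable {M : Type*} [AddCommGroup M] [Module ℂ M]

/-- Raising `v` by `e` as often as possible gives a primitive vector. Local nilpotence of `f` forces
its weight to be a natural number `N`, and the lowering string from it does not vanish within `N`
steps. -/
theorem IsSl2Triple.exists_pow_ne_zero {h e f : Module.End ℂ M} (t : IsSl2Triple h e f) {v : M}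
    (hv : v ≠ 0) {z : ℂ} (hz : h v = z • v) (he : ∀ w : M, ∃ n : ℕ, (e ^ n) w = 0)
    (hf : ∀ w : M, ∃ n : ℕ, (f ^ n) w = 0) :
    ∃ a N : ℕ, z + 2 * a = N ∧ ∀ j ≤ N, (f ^ j) ((e ^ a) v) ≠ 0 := by
  obtain ⟨a, ha, ha'⟩ := Nat.exists_not_and_succ_of_not_zero_of_exists
    (p := fun n => (e ^ n) v = 0) (by simpa using hv) (he v)
  have P : t.HasPrimitiveVectorWith ((e ^ a) v) (z + 2 * a) := by
    refine ⟨ha, ?_, ?_⟩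
    · have := IsSl2Triple.lie_h_pow_toEnd_e (R := ℂ) (M := M) t (m := v) (μ := z) (by simpa using hz) a
      simpa using this
    · rw [pow_succ'] at ha'
      exact ha'
  have hN : ∃ N : ℕ, z + 2 * a = N := by
    obtain ⟨n, hn₁, hn₂⟩ := Nat.exists_not_and_succ_of_not_zero_of_exists
      (p := fun n => (f ^ n) ((e ^ a) v) = 0) (by simpa using ha) (hf _)
    refine ⟨n, ?_⟩
    have := P.lie_e_pow_succ_toEnd_f n
    simp only [LieModule.toEnd_module_end, LieHom.id_apply, Module.End.lie_apply] at this
    rw [hn₂, map_zero, eq_comm, smul_eq_zero_iff_left hn₁, mul_eq_zero, sub_eq_zero] at this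
    exact this.resolve_left (Nat.cast_add_one_ne_zero n)
  obtain ⟨N, hN⟩ := hN
  refine ⟨a, N, hN, fun j hj => ?_⟩
  have := P.pow_toEnd_f_ne_zero_of_eq_nat hN hj
  simpa using this

end Sl2

/-! ### Reflection symmetry of the support -/

namespace TwistedType

open LieSuperalgebra SuperMatrix

variable {X : TwistedType} {k l : ℕ}

theorem cartan_even (h : Cartan k l) : X.cartan k l h ∈ (X.alg k l).homog 0 := by
  change _ ∈ (X.finAlg k l).affineHomog 0
  rw [mem_affineHomog]
  refine ⟨fun q => ?_, fun h => (h rfl).elim⟩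
  change Finsupp.single 0 _ q ∈ _
  rw [Finsupp.single_apply]
  split_ifs with hq
  · refine ⟨⟨X.diag k l h, X.diag_mem k l h⟩, ?_, rfl⟩
    exact diag_even h
  · exact zero_mem _

variable {M : Type*} [AddCommGroup M] [Module ℂ M] {ρ : (X.alg k l).Rep M}

theorem rep_br {x y : X.Alg k l} (hx : x ∈ (X.alg k l).homog 0) (hy : y ∈ (X.alg k l).homog 0) :
    ρ.toEnd ((X.alg k l).br x y) = ρ.toEnd x * ρ.toEnd y - ρ.toEnd y * ρ.toEnd x := by
  rw [ρ.map_br hx hy]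
  simp [superSign]

theorem apply_mem_weightSpace {x : X.Alg k l} (hx : x ∈ (X.alg k l).homog 0) {α μ : Weight k l}
    (hα : x ∈ X.rootSpace k l α) {v : M} (hv : v ∈ weightSpace ρ μ) :
    ρ.toEnd x v ∈ weightSpace ρ (α + μ) := by
  intro h
  have h1 := LinearMap.congr_fun (rep_br (ρ := ρ) (cartan_even (X := X) h) hx) v
  rw [hα h, map_smul, LinearMap.smul_apply, LinearMap.sub_apply, Module.End.mul_apply,
    Module.End.mul_apply, hv h, map_smul] at h1
  rw [LinearMap.add_apply, add_smul, h1]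
  abel

theorem pow_apply_mem_weightSpace {x : X.Alg k l} (hx : x ∈ (X.alg k l).homog 0)
    {α μ : Weight k l} (hα : x ∈ X.rootSpace k l α) {v : M} (hv : v ∈ weightSpace ρ μ) (n : ℕ) :
    (ρ.toEnd x ^ n) v ∈ weightSpace ρ (n • α + μ) := by
  induction n with
  | zero => simpa using hv
  | succ n ih =>
    rw [pow_succ', Module.End.mul_apply, succ_nsmul', add_assoc]
    exact apply_mem_weightSpace hx hα ih

theorem mem_supp_of_ne_zero {μ : Weight k l} {v : M} (hv : v ∈ weightSpace ρ μ) (h : v ≠ 0) :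
    μ ∈ supp ρ := fun e => h (by rwa [e, Submodule.mem_bot] at hv)

/-- The support is stable under the reflection in a root `α` such that there is an `sl₂`-triple
which acts locally nilpotently and whose nilpotent elements have weights `±α`. -/
theorem supp_reflection {α : Weight k l} {e f : X.Alg k l} (he : e ∈ X.rootSpace k l α)
    (hf : f ∈ X.rootSpace k l (-α)) (he0 : e ∈ (X.alg k l).homog 0)
    (hf0 : f ∈ (X.alg k l).homog 0) {c : Cartan k l} (hef : (X.alg k l).br e f = X.cartan k l c)
    (hc : α c = 2) (hen : ∀ v : M, ∃ n : ℕ, (ρ.toEnd e ^ n) v = 0)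
    (hfn : ∀ v : M, ∃ n : ℕ, (ρ.toEnd f ^ n) v = 0) {μ : Weight k l} (hμ : μ ∈ supp ρ) :
    ∃ z : ℤ, μ c = z ∧ μ - z • α ∈ supp ρ := by
  obtain ⟨v, hv, hv0⟩ := Submodule.exists_mem_ne_zero_of_ne_bot hμ
  -- If this value is zero the reflection fixes `μ`. Otherwise it shows that the coroot acts
  -- nontrivially, as `IsSl2Triple` demands.
  by_cases h0 : μ c = 0
  · exact ⟨0, by simpa using h0, by simpa using hμ⟩
  have t : IsSl2Triple (ρ.toEnd (X.cartan k l c)) (ρ.toEnd e) (ρ.toEnd f) := by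
    refine ⟨fun h => ?_, ?_, ?_, ?_⟩
    · have := hv c
      rw [h, LinearMap.zero_apply, eq_comm, smul_eq_zero] at this
      exact this.elim h0 hv0
    · rw [Ring.lie_def, ← rep_br he0 hf0, hef]
    · rw [Ring.lie_def, ← rep_br (cartan_even c) he0, he c, hc, map_smul]
      norm_cast
    · rw [Ring.lie_def, ← rep_br (cartan_even c) hf0, hf c, LinearMap.neg_apply, hc, map_smul]
      module
  obtain ⟨a, N, hN, hj⟩ := t.exists_pow_ne_zero hv0 (hv c) hen hfn
  obtain ⟨b, N', hN', hj'⟩ := t.symm.exists_pow_ne_zero hv0 (z := -μ c)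
    (by rw [LinearMap.neg_apply, hv c, neg_smul]) hfn hen
  have hz : μ c = ((N - 2 * a : ℤ) : ℂ) := by
    push_cast
    linear_combination hN
  have hNN : (N - 2 * a : ℤ) = 2 * b - N' := by
    have : ((N - 2 * a : ℤ) : ℂ) = ((2 * b - N' : ℤ) : ℂ) := by
      push_cast
      linear_combination -hN - hN'
    exact_mod_cast this
  refine ⟨_, hz, ?_⟩
  -- If `μ(c) = N - 2a` is nonnegative, `f^{N-a} e^a v` is a nonzero vector of the reflected weight;
  -- otherwise the roles of `e` and `f` are exchanged.
  rcases le_total 0 (N - 2 * a : ℤ) with h | h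
  · have := mem_supp_of_ne_zero (pow_apply_mem_weightSpace hf0 hf
      (pow_apply_mem_weightSpace he0 he hv a) (N - a)) (hj _ (by omega))
    convert this using 1
    rw [smul_neg, ← natCast_zsmul, ← natCast_zsmul, Nat.cast_sub (by omega)]
    module
  · have := mem_supp_of_ne_zero (pow_apply_mem_weightSpace he0 he
      (pow_apply_mem_weightSpace hf0 hf hv b) (N' - b)) (hj' _ (by omega))
    convert this using 1
    rw [smul_neg, ← natCast_zsmul, ← natCast_zsmul, Nat.cast_sub (by omega), hNN]
    module

/-! ### The cone of translations of the support -/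

/-- The weights a positive multiple of which translates the support into itself. -/
def shiftCone (ρ : (X.alg k l).Rep M) : Set (Weight k l) :=
  {x | ∃ N : ℕ, 0 < N ∧ ∀ μ ∈ supp ρ, N • x + μ ∈ supp ρ}

theorem add_nsmul_mem_supp {x : Weight k l} (h : ∀ μ ∈ supp ρ, x + μ ∈ supp ρ) (n : ℕ) :
    ∀ μ ∈ supp ρ, n • x + μ ∈ supp ρ := by
  induction n with
  | zero => simp
  | succ n ih =>
    intro μ hμ
    rw [succ_nsmul', add_assoc]
    exact h _ (ih μ hμ)

theorem add_mem_shiftCone {x y : Weight k l} (hx : x ∈ shiftCone ρ) (hy : y ∈ shiftCone ρ) :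
    x + y ∈ shiftCone ρ := by
  obtain ⟨N, hN, h⟩ := hx
  obtain ⟨N', hN', h'⟩ := hy
  refine ⟨N * N', Nat.mul_pos hN hN', fun μ hμ => ?_⟩
  rw [smul_add, add_assoc, mul_comm N N', mul_smul, mul_comm N' N, mul_smul]
  exact add_nsmul_mem_supp h N' _ (add_nsmul_mem_supp h' N μ hμ)

theorem nsmul_mem_shiftCone {x : Weight k l} (hx : x ∈ shiftCone ρ) (n : ℕ) :
    n • x ∈ shiftCone ρ := by
  obtain ⟨N, hN, h⟩ := hx
  refine ⟨N, hN, fun μ hμ => ?_⟩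
  rw [smul_comm]
  exact add_nsmul_mem_supp h n μ hμ

theorem mem_shiftCone_of_nsmul {x : Weight k l} {n : ℕ} (hn : 0 < n)
    (hx : n • x ∈ shiftCone ρ) : x ∈ shiftCone ρ := by
  obtain ⟨N, hN, h⟩ := hx
  exact ⟨N * n, Nat.mul_pos hN hn, fun μ hμ => by rw [mul_smul]; exact h μ hμ⟩

/-- If a positive multiple of `α` preserves the support, the ray from any weight in direction `α`
meets the support infinitely often. This excludes `α` from `setB ρ`, and shadow leaves only
injectivity. -/
theorem mem_rootsIn_iff (hs : HasShadow ρ) (hne : (supp ρ).Nonempty) {α : Weight k l}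
    (hα : α ∈ X.realRoots k l) : α ∈ rootsIn ρ ↔ α ∈ shiftCone ρ := by
  obtain ⟨h1, h2, h3⟩ := hs
  constructor
  · intro h
    rw [h3] at h
    exact ⟨1, one_pos, fun μ hμ => by simpa using h.1.2 μ hμ⟩
  · rintro ⟨N, hN, h⟩
    have := hα
    rw [h1] at this
    refine this.resolve_right fun h' => ?_
    rw [h2] at h'
    obtain ⟨μ, hμ⟩ := hne
    have hinj : Function.Injective fun n : ℕ => (n + 1) * N := fun a b h => by
      simpa [hN.ne'] using h
    refine Set.infinite_range_of_injective hinj ((h'.1.2 μ hμ).subset ?_)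
    rintro _ ⟨n, rfl⟩
    refine ⟨by positivity, ?_⟩
    dsimp only
    rw [add_comm, mul_smul]
    exact add_nsmul_mem_supp h _ μ hμ

theorem mem_rootsLn_iff (hs : HasShadow ρ) (hne : (supp ρ).Nonempty) {α : Weight k l}
    (hα : α ∈ X.realRoots k l) : α ∈ rootsLn ρ ↔ α ∉ shiftCone ρ := by
  rw [← mem_rootsIn_iff hs hne hα]
  obtain ⟨h1, h2, h3⟩ := id hs
  constructor
  · intro h h'
    have h'' := (mem_rootsIn_iff hs hne hα).1 h'
    rw [h2] at h
    obtain ⟨N, hN, hx⟩ := h''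
    obtain ⟨μ, hμ⟩ := hne
    have hinj : Function.Injective fun n : ℕ => (n + 1) * N := fun a b h => by
      simpa [hN.ne'] using h
    refine Set.infinite_range_of_injective hinj ((h.1.2 μ hμ).subset ?_)
    rintro _ ⟨n, rfl⟩
    refine ⟨by positivity, ?_⟩
    dsimp only
    rw [add_comm, mul_smul]
    exact add_nsmul_mem_supp hx _ μ hμ
  · intro h
    rw [h1] at hα
    exact hα.resolve_left h

/-- The support is stable under the reflection in a real root `α`, if neither `α` nor `-α`
belongs to the cone of translations. -/
theorem exists_supp_reflection (hs : HasShadow ρ) (hne : (supp ρ).Nonempty) {α : Weight k l}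
    (hα : α ∈ X.realRoots k l) (h1 : α ∉ shiftCone ρ) (h2 : -α ∉ shiftCone ρ) :
    ∃ c : Cartan k l, (∀ γ : Weight k l, level γ = 0 →
      γ c = 2 * weightForm α γ / weightForm α α) ∧
      ∀ μ ∈ supp ρ, ∃ z : ℤ, μ c = z ∧ μ - z • α ∈ supp ρ := by
  have nil : ∀ {β : Weight k l}, β ∈ X.realRoots k l → β ∉ shiftCone ρ →
      ∀ x ∈ X.rootSpace k l β, x ≠ 0 → ∀ v : M, ∃ n : ℕ, (ρ.toEnd x ^ n) v = 0 :=
    fun hβ h => ((mem_rootsLn_iff hs hne hβ).2 h).2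
  obtain ⟨i, j, p, hw, e, ho, hi, hj⟩ := exists_of_mem_realRoots hα
  by_cases hpar : par i = par j
  · obtain ⟨e, he, f, hf, he0, hf0, hee, hfe, c, hef, hc⟩ := exists_sl2 ho hw hpar e hα.2
    refine ⟨c, hc, fun μ hμ => supp_reflection he hf hee hfe hef ?_ (nil hα h1 e he he0)
      (nil (neg_mem_realRoots hα) h2 f hf hf0) hμ⟩
    rw [hc α (level_of_mem_roots hα.1), mul_div_assoc, div_self hα.2, mul_one]
  -- Here `α` is odd and the triple is taken for `2α`. Since the cone admits division by `2`, `±2α`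
  -- are outside it as well. The coroot of `2α` is half that of `α`, whence the factor `2` in the
  -- witness.
  · have hj := hj.resolve_right hpar
    have hd := ho.double hj hpar
    rw [isExtra_of_wt_eq_zero hj, sub_zero] at e
    have e2 : (2 : ℤ) • α = wt i - wt (star i) + (2 * p) • delta := by
      rw [e, wt_star, smul_add, mul_smul]
      module
    have hn : weightForm ((2 : ℤ) • α) ((2 : ℤ) • α) ≠ 0 := by
      rw [weightForm_zsmul_left, weightForm_zsmul_right]
      have := hα.2
      simpa using this
    have hα2 : (2 : ℤ) • α ∈ X.realRoots k l := mem_realRoots_iff.2 ⟨hn, _, _, _, e2, hd⟩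
    have hw' : (wt i : Weight k l) ≠ wt (star i) := by
      intro h
      rw [h, sub_self, zero_add] at e2
      exact ne_zero_of_mem_realRoots hα2 _ e2
    have h1' : (2 : ℤ) • α ∉ shiftCone ρ := fun h =>
      h1 (mem_shiftCone_of_nsmul two_pos (by exact_mod_cast h))
    have h2' : -((2 : ℤ) • α) ∉ shiftCone ρ := fun h =>
      h2 (mem_shiftCone_of_nsmul two_pos (by rw [← smul_neg] at h; exact_mod_cast h))
    obtain ⟨e, he, f, hf, he0, hf0, hee, hfe, c, hef, hc⟩ :=
      exists_sl2 hd hw' (by simp) e2 hn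
    have hc' : ∀ γ : Weight k l, level γ = 0 →
        2 * γ c = 2 * weightForm α γ / weightForm α α := by
      intro γ hγ
      rw [hc γ hγ, weightForm_zsmul_left, weightForm_zsmul_left, weightForm_zsmul_right]
      have := hα.2
      push_cast
      field_simp
    refine ⟨(2 : ℂ) • c, fun γ hγ => ?_, fun μ hμ => ?_⟩
    · rw [map_smul, smul_eq_mul, hc' γ hγ]
    · obtain ⟨z, hz, hm⟩ := supp_reflection he hf hee hfe hef (by
        rw [hc _ (level_of_mem_roots hα2.1), mul_div_assoc, div_self hn, mul_one])
        (nil hα2 h1' e he he0) (nil (neg_mem_realRoots hα2) h2' f hf hf0) hμ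
      refine ⟨z * 2, by rw [map_smul, hz, smul_eq_mul]; push_cast; ring, ?_⟩
      rwa [mul_smul]

/-- The coroot is integral on the support, which contains both `μ` and `β + μ`; subtracting gives
integrality on `β`. -/
theorem cartan_int (hs : HasShadow ρ) (hne : (supp ρ).Nonempty) {α β : Weight k l}
    (hα : α ∈ X.realRoots k l) (h1 : α ∉ shiftCone ρ) (h2 : -α ∉ shiftCone ρ)
    (hβ : β ∈ X.realRoots k l) (h : β ∈ shiftCone ρ) :
    ∃ z : ℤ, (z : ℂ) = 2 * weightForm α β / weightForm α α := by
  obtain ⟨c, hc, hr⟩ := exists_supp_reflection hs hne hα h1 h2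
  obtain ⟨μ, hμ⟩ := hne
  have hβ' := (mem_rootsIn_iff hs ⟨μ, hμ⟩ hβ).2 h
  rw [hs.2.2] at hβ'
  obtain ⟨z, hz, -⟩ := hr μ hμ
  obtain ⟨z', hz', -⟩ := hr _ (hβ'.1.2 μ hμ)
  refine ⟨z' - z, ?_⟩
  rw [LinearMap.add_apply, hz] at hz'
  rw [← hc β (level_of_mem_roots hβ.1)]
  push_cast
  linear_combination -hz'

/-- The reflection preserves the support, so conjugating the translation by `N x` with it again
preserves the support; the result is translation by `N` times the reflected weight. -/
theorem reflection_mem_shiftCone (hs : HasShadow ρ) (hne : (supp ρ).Nonempty) {α : Weight k l}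
    (hα : α ∈ X.realRoots k l) (h1 : α ∉ shiftCone ρ) (h2 : -α ∉ shiftCone ρ) {x : Weight k l}
    (hl : level x = 0) (hx : x ∈ shiftCone ρ) {z : ℤ}
    (hz : (z : ℂ) = 2 * weightForm α x / weightForm α α) : x - z • α ∈ shiftCone ρ := by
  obtain ⟨c, hc, hr⟩ := exists_supp_reflection hs hne hα h1 h2
  obtain ⟨N, hN, h⟩ := hx
  have hα2 : α c = 2 := by
    rw [hc _ (level_of_mem_roots hα.1), mul_div_assoc, div_self hα.2, mul_one]
  refine ⟨N, hN, fun μ hμ => ?_⟩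
  obtain ⟨m, hm, hm'⟩ := hr μ hμ
  obtain ⟨m', hm1, hm2⟩ := hr _ (h _ hm')
  have : m' = N * z - m := by
    have : (m' : ℂ) = ((N * z - m : ℤ) : ℂ) := by
      rw [← hm1]
      simp only [LinearMap.add_apply, LinearMap.sub_apply, LinearMap.smul_apply, hm, hα2,
        hc x hl, ← hz, nsmul_eq_mul, zsmul_eq_mul]
      push_cast
      ring
    exact_mod_cast this
  rw [this] at hm2
  convert hm2 using 1
  module

end TwistedType
end

noncomputable section

namespace TwistedType

variable {X : TwistedType} {k l : ℕ} {M : Type*} [AddCommGroup M] [Module ℂ M]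
  {ρ : (X.alg k l).Rep M}

/-! ### Translations by a whole fibre -/

/-- All weights in `x + ℤ δ` belong to the cone of translations. -/
def FibreIn (ρ : (X.alg k l).Rep M) (x : Weight k l) : Prop :=
  ∀ n : ℤ, x + n • delta ∈ shiftCone ρ

theorem FibreIn.mem {x : Weight k l} (h : FibreIn ρ x) : x ∈ shiftCone ρ := by
  simpa using h 0

theorem FibreIn.shift {x : Weight k l} (h : FibreIn ρ x) (m : ℤ) : FibreIn ρ (x + m • delta) := by
  intro n
  rw [add_assoc, ← add_smul]
  exact h _

theorem fibreIn_shift_iff {x : Weight k l} {m : ℤ} :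
    FibreIn ρ (x + m • delta) ↔ FibreIn ρ x := by
  refine ⟨fun h => ?_, fun h => h.shift m⟩
  simpa [add_assoc, ← add_smul] using h.shift (-m)

theorem fibreIn_neg_shift_iff {x : Weight k l} {m : ℤ} :
    FibreIn ρ (-(x + m • delta)) ↔ FibreIn ρ (-x) := by
  rw [neg_add, ← neg_smul, fibreIn_shift_iff]

theorem zsmul_mem_shiftCone {x : Weight k l} (hx : x ∈ shiftCone ρ) {z : ℤ} (hz : 0 ≤ z) :
    z • x ∈ shiftCone ρ := by
  lift z to ℕ using hz
  rw [natCast_zsmul]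
  exact nsmul_mem_shiftCone hx z

theorem mem_shiftCone_of_zsmul {x : Weight k l} {z : ℤ} (hz : 0 < z) (hx : z • x ∈ shiftCone ρ) :
    x ∈ shiftCone ρ := by
  lift z to ℕ using hz.le
  rw [natCast_zsmul] at hx
  exact mem_shiftCone_of_nsmul (by exact_mod_cast hz) hx

/-- For `z > 0`, `z (x + nδ)` is the sum of `z - 1` copies of `x + mδ` and of `x + (m + z(n - m))δ`,
all from the progression, and the cone admits division by `z`. -/
theorem fibreIn_of_progression {x : Weight k l} {m z : ℤ} (hz : z ≠ 0)
    (h : ∀ j : ℤ, x + (m + z * j) • delta ∈ shiftCone ρ) : FibreIn ρ x := by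
  wlog hz' : 0 < z generalizing z
  · exact this (neg_ne_zero.2 hz) (fun j => by simpa using h (-j)) (by omega)
  intro n
  refine mem_shiftCone_of_zsmul hz' ?_
  have h1 := zsmul_mem_shiftCone (h 0) (z := z - 1) (by omega)
  have := add_mem_shiftCone h1 (h (n - m))
  convert this using 1
  module

/-- Fullness concerns only the roots of the fibre, `FibreIn` all its weights. The roots include the
progression `α + 4ℤδ`, so nothing is lost. -/
theorem mem_fullIn_iff (hs : HasShadow ρ) (hne : (supp ρ).Nonempty) {α : Weight k l}
    (hα : α ∈ X.realRoots k l) : α ∈ fullIn ρ ↔ FibreIn ρ α := by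
  constructor
  · rintro ⟨-, h⟩
    refine fibreIn_of_progression (m := 0) (z := 4) (by norm_num) fun j => ?_
    rw [zero_add]
    have hr := add_four_mem_realRoots hα j
    exact (mem_rootsIn_iff hs hne hr).1
      (h ⟨Set.add_mem_add rfl (mem_zdelta.2 ⟨_, rfl⟩), hr.1⟩)
  · refine fun h => ⟨hα, ?_⟩
    rintro _ ⟨⟨_, rfl, _, hy, rfl⟩, hr⟩
    obtain ⟨n, rfl⟩ := mem_zdelta.1 hy
    exact (mem_rootsIn_iff hs hne (mem_realRoots_of_add hα hr)).2 (h n)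

theorem notMem_shiftCone_of_mem_fullLn (hs : HasShadow ρ) (hne : (supp ρ).Nonempty)
    {α : Weight k l} (hα : α ∈ fullLn ρ) {n : ℤ} (h : α + n • delta ∈ X.roots k l) :
    α + n • delta ∉ shiftCone ρ :=
  (mem_rootsLn_iff hs hne (mem_realRoots_of_add hα.1 h)).1
    (hα.2 ⟨Set.add_mem_add rfl (mem_zdelta.2 ⟨n, rfl⟩), h⟩)

theorem mem_setP_iff (hs : HasShadow ρ) (hne : (supp ρ).Nonempty) {α : Weight k l} :
    α ∈ setP ρ ↔ α ∈ zdelta k l ∨ α ∈ X.realRoots k l ∧ (FibreIn ρ α → FibreIn ρ (-α)) := by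
  constructor
  · rintro (((h | h) | h) | h)
    · refine Or.inr ⟨h.1, fun h' => ?_⟩
      have := notMem_shiftCone_of_mem_fullLn hs hne h (n := 0) (by simpa using h.1.1)
      exact (this (h' 0)).elim
    · have hr : -α ∈ X.realRoots k l := h.1
      have hr' := neg_mem_realRoots hr
      rw [neg_neg] at hr'
      exact Or.inr ⟨hr', fun _ => (mem_fullIn_iff hs hne hr).1 h⟩
    · exact Or.inr ⟨h.1, fun h' => (h.2 (Or.inr ((mem_fullIn_iff hs hne h.1).2 h'))).elim⟩
    · exact Or.inl h
  · rintro (h | ⟨h, h'⟩)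
    · exact Or.inr h
    · refine Or.inl ?_
      by_cases h1 : α ∈ fullIn ρ
      · exact Or.inl (Or.inr ((mem_fullIn_iff hs hne (neg_mem_realRoots h)).2
          (h' ((mem_fullIn_iff hs hne h).1 h1))))
      · by_cases h2 : α ∈ fullLn ρ
        · exact Or.inl (Or.inl h2)
        · exact Or.inr ⟨h, fun h3 => h3.elim h2 h1⟩

theorem mem_or_neg_mem_setP (hs : HasShadow ρ) (hne : (supp ρ).Nonempty) {x : Weight k l}
    (h : x ∈ zdelta k l ∪ X.realRoots k l) : x ∈ setP ρ ∨ -x ∈ setP ρ := by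
  rw [mem_setP_iff hs hne, mem_setP_iff hs hne]
  rcases h with h | h
  · exact Or.inl (Or.inl h)
  · by_cases hx : FibreIn ρ x → FibreIn ρ (-x)
    · exact Or.inl (Or.inr ⟨h, hx⟩)
    · rw [Classical.not_imp] at hx
      exact Or.inr (Or.inr ⟨neg_mem_realRoots h, fun h' => (hx.2 h').elim⟩)

/-! ### Closedness -/

/-- Let `γ ∈ α + β + ℤ δ` be real roots such that `γ` has positive Cartan integer with `α`. If
`γ + ℤ δ` lies in the cone of translations, `-α + ℤ δ` does not meet it and `α + ℤ δ` is not
contained in it, then `β + ℤ δ` lies in it. -/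
theorem fibreIn_of_cartan_pos (hs : HasShadow ρ) (hne : (supp ρ).Nonempty) {α β γ : Weight k l}
    (hα : α ∈ X.realRoots k l) (hγ : γ ∈ X.realRoots k l) {s : ℤ} (h : γ = α + β + s • delta)
    (hU : FibreIn ρ γ) (hA : ∀ n : ℤ, -α + n • delta ∉ shiftCone ρ) (hα' : ¬ FibreIn ρ α)
    (hpos : 0 < (2 * weightForm α γ / weightForm α α).re) : FibreIn ρ β := by
  -- A root in the fibre of `α` at which the reflection is available: it is outside the cone, and so
  -- is its negative by `hA`.
  obtain ⟨n, hn⟩ : ∃ n : ℤ, α + (4 * n) • delta ∉ shiftCone ρ := by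
    by_contra! H
    exact hα' (fibreIn_of_progression (m := 0) (z := 4) (by norm_num) fun j => by
      rw [zero_add]; exact H j)
  have hlα := level_of_mem_roots hα.1
  have hlγ := level_of_mem_roots hγ.1
  have hr := add_four_mem_realRoots hα n
  have hn' : -(α + (4 * n) • delta) ∉ shiftCone ρ := by
    rw [neg_add, ← neg_smul]
    exact hA _
  obtain ⟨z, hz⟩ := cartan_int hs hne hr hn hn' hγ hU.mem
  have hz' := hz
  rw [weightForm_add_zsmul_delta hlα, weightForm_add_left, weightForm_zsmul_left,
    weightForm_delta_left, hlγ, mul_zero, add_zero] at hz'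
  have hz0 : 0 < z := by
    rw [← hz'] at hpos
    simpa using hpos
  intro j
  refine mem_shiftCone_of_zsmul hz0 ?_
  -- The shift is chosen so that the reflected weight plus `(z - 1) γ` equals `z (β + jδ)`.
  have h1 := reflection_mem_shiftCone hs hne hr hn hn' (x := γ + (z * (j + 4 * n - s)) • delta)
    (by simp [hlγ]) (hU _) (z := z) (by
      rw [hz, weightForm_add_right _ γ, weightForm_zsmul_right, weightForm_delta_right]
      simp [hlα])
  have h2 := add_mem_shiftCone (zsmul_mem_shiftCone hU.mem (z := z - 1) (by omega)) h1
  convert h2 using 1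
  rw [h]
  module

theorem fibreIn_neg_of_add (hs : HasShadow ρ) (hne : (supp ρ).Nonempty) {α β γ : Weight k l}
    (hα : α ∈ X.realRoots k l) (hβ : β ∈ X.realRoots k l) (hγ : γ ∈ X.realRoots k l) {s : ℤ}
    (h : γ = α + β + s • delta) (hα' : FibreIn ρ α → FibreIn ρ (-α))
    (hβ' : FibreIn ρ β → FibreIn ρ (-β)) (hU : FibreIn ρ γ) : FibreIn ρ (-γ) := by
  by_contra H
  -- Were one weight of `-α + ℤδ` in the cone, adding it to the fibre of `γ` would yield that of
  -- `β`, hence that of `-β`; adding it once more would yield the fibre of `-γ`.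
  have key : ∀ {α β : Weight k l}, γ = α + β + s • delta → (FibreIn ρ β → FibreIn ρ (-β)) →
      ∀ n : ℤ, -α + n • delta ∉ shiftCone ρ := by
    intro α β h hβ' n hn
    have h1 : FibreIn ρ β := by
      intro m
      have := add_mem_shiftCone hn (hU (m - n - s))
      convert this using 1
      rw [h]
      module
    refine H fun m => ?_
    have := add_mem_shiftCone hn (hβ' h1 (m - n - s))
    convert this using 1
    rw [h]
    module
  have h' : γ = β + α + s • delta := by rw [h, add_comm α]
  have hA := key h hβ'
  have hB := key h' hα'
  have hA' : ¬ FibreIn ρ α := fun h => hA 0 (hα' h 0)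
  have hB' : ¬ FibreIn ρ β := fun h => hB 0 (hβ' h 0)
  -- Whichever root has the positive Cartan number, `fibreIn_of_cartan_pos` forces the fibre of the
  -- other one into the cone.
  rcases re_cartan_pos hα hβ hγ h with hp | hp
  · exact hB' (fibreIn_of_cartan_pos hs hne hα hγ h hU hA hA' hp)
  · exact hA' (fibreIn_of_cartan_pos hs hne hβ hγ h' hU hB hB' hp)

/-- Membership in `P` is constant on the roots of a fibre, so a shift by `s δ` costs nothing.
Allowing it lets the same statement serve `P`, `P_i` and the projections `Ṗ_i`. -/
theorem add_mem_setP (hs : HasShadow ρ) (hne : (supp ρ).Nonempty) {x y z : Weight k l}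
    (hx : x ∈ setP ρ) (hy : y ∈ setP ρ) {s : ℤ} (h : z = x + y + s • delta)
    (hz : z ∈ zdelta k l ∪ X.realRoots k l) : z ∈ setP ρ := by
  have aux : ∀ {y z : Weight k l} {n : ℤ}, y ∈ setP ρ → z = y + n • delta →
      z ∈ X.realRoots k l → z ∈ setP ρ := by
    rintro y _ n hy rfl hz
    rw [mem_setP_iff hs hne] at hy ⊢
    rcases hy with hy | ⟨-, hy⟩
    · obtain ⟨m, rfl⟩ := mem_zdelta.1 hy
      exact (ne_zero_of_mem_realRoots hz (m + n) (add_smul _ _ _).symm).elim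
    · rw [fibreIn_shift_iff, fibreIn_neg_shift_iff]
      exact Or.inr ⟨hz, hy⟩
  rcases hz with hz | hz
  · exact Or.inr hz
  rcases (mem_setP_iff hs hne).1 hx with hx' | ⟨hxr, hx'⟩
  · obtain ⟨n, rfl⟩ := mem_zdelta.1 hx'
    exact aux hy (n := n + s) (by rw [h]; module) hz
  rcases (mem_setP_iff hs hne).1 hy with hy' | ⟨hyr, hy'⟩
  · obtain ⟨n, rfl⟩ := mem_zdelta.1 hy'
    exact aux hx (n := n + s) (by rw [h]; module) hz
  exact (mem_setP_iff hs hne).2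
    (Or.inr ⟨hz, fibreIn_neg_of_add hs hne hxr hyr hz h hx' hy'⟩)

/-! ### Parabolicity of `P`, `P_i` and `Ṗ_i` -/

theorem neg_mem_zdelta {x : Weight k l} (h : x ∈ zdelta k l) : -x ∈ zdelta k l := by
  obtain ⟨n, rfl⟩ := mem_zdelta.1 h
  exact mem_zdelta.2 ⟨-n, (neg_smul _ _).symm⟩

theorem setP_subset (hs : HasShadow ρ) (hne : (supp ρ).Nonempty) :
    setP ρ ⊆ zdelta k l ∪ X.realRoots k l := fun _ h =>
  ((mem_setP_iff hs hne).1 h).imp id And.left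

theorem isParabolicSubset_setP_inter (hs : HasShadow ρ) (hne : (supp ρ).Nonempty)
    {S : Set (Weight k l)} (hS : S ⊆ zdelta k l ∪ X.realRoots k l) (hneg : ∀ x ∈ S, -x ∈ S) :
    IsParabolicSubset (setP ρ ∩ S) S := by
  refine ⟨Set.inter_subset_right, Set.Subset.antisymm ?_ ?_, ?_⟩
  · rintro x (h | h)
    · exact h.2
    · simpa using hneg _ h.2
  · intro x hx
    exact (mem_or_neg_mem_setP hs hne (hS hx)).imp (fun h => ⟨h, hx⟩) (fun h => ⟨h, hneg x hx⟩)
  · rintro _ ⟨⟨x, hx, y, hy, rfl⟩, h⟩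
    exact ⟨add_mem_setP hs hne hx.1 hy.1 (s := 0) (by simp) (hS h), h⟩

theorem isParabolicSubset_dotP (hs : HasShadow ρ) (hne : (supp ρ).Nonempty) (c : Fin 2) :
    IsParabolicSubset (dotP ρ c) (X.dotEvenRoots k l c) := by
  have hneg : ∀ {x : Weight k l}, x ∈ X.dotEvenRoots k l c → -x ∈ X.dotEvenRoots k l c := by
    rintro x ⟨hx, σ, hσ, h⟩
    refine ⟨neg_mem_dotRoots X x hx, -σ, neg_mem_zdelta hσ, ?_⟩
    rw [← neg_add]
    exact neg_mem_evenRoots X c _ h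
  refine ⟨fun x h => h.1, Set.Subset.antisymm ?_ ?_, ?_⟩
  · rintro x (h | h)
    · exact h.1
    · simpa using hneg h.1
  · intro x hx
    obtain ⟨hd, σ, hσ, h⟩ := id hx
    obtain ⟨n, rfl⟩ := mem_zdelta.1 hσ
    rcases mem_or_neg_mem_setP hs hne (evenRoots_subset X c h) with h' | h'
    · exact Or.inl ⟨hx, n, h', h⟩
    · refine Or.inr ⟨hneg hx, -n, ?_⟩
      rw [neg_smul, ← neg_add]
      exact ⟨h', neg_mem_evenRoots X c _ h⟩
  · rintro _ ⟨⟨x, ⟨hx, m, hm⟩, y, ⟨hy, n, hn⟩, rfl⟩, h⟩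
    refine ⟨h, ?_⟩
    obtain ⟨-, σ, hσ, h⟩ := h
    obtain ⟨r, rfl⟩ := mem_zdelta.1 hσ
    -- The sum of the chosen lifts need not be a root; `r - m - n` corrects it to the lift that is
    -- known to lie in `R_0(i)`.
    refine ⟨r, add_mem_setP hs hne hm.1 hn.1 (s := r - m - n) ?_ (evenRoots_subset X c h), h⟩
    dsimp only
    module

theorem setP_inter_evenRoots (hs : HasShadow ρ) (hne : (supp ρ).Nonempty) (c : Fin 2) :
    setP ρ ∩ X.evenRoots k l c = (dotP ρ c + zdelta k l) ∩ X.evenRoots k l c := by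
  ext y
  constructor
  · rintro ⟨hy, hy'⟩
    obtain ⟨x, hx, n, rfl⟩ := exists_dot_of_mem_evenRoots hy'
    have hn : n • delta ∈ zdelta k l := mem_zdelta.2 ⟨n, rfl⟩
    exact ⟨Set.add_mem_add ⟨⟨hx, _, hn, hy'⟩, n, hy, hy'⟩ hn, hy'⟩
  · rintro ⟨⟨x, ⟨-, m, hm⟩, _, hσ, rfl⟩, hy⟩
    obtain ⟨n, rfl⟩ := mem_zdelta.1 hσ
    refine ⟨add_mem_setP hs hne hm.1 (y := 0) (Or.inr (mem_zdelta.2 ⟨0, by simp⟩)) (s := n - m)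
      ?_ (evenRoots_subset X c hy), hy⟩
    dsimp only
    module

/-! ### Properness -/

/-- No weight in `x + 4 ℤ δ` belongs to the cone of translations. -/
def FibreOut (ρ : (X.alg k l).Rep M) (x : Weight k l) : Prop :=
  ∀ n : ℤ, x + (4 * n) • delta ∉ shiftCone ρ

theorem FibreOut.notMem {x : Weight k l} (h : FibreOut ρ x) : x ∉ shiftCone ρ := by
  simpa using h 0

/-- Some `-γ + 4mδ` is outside the cone, so the reflection in `γ - 4mδ` is available. It carries `-γ
+ 4jδ` to `γ + 4(j - 2m)δ`, which is excluded. -/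
theorem FibreOut.neg (hs : HasShadow ρ) (hne : (supp ρ).Nonempty) {γ : Weight k l}
    (hγ : γ ∈ X.realRoots k l) (h : FibreOut ρ γ) (h' : ¬ FibreIn ρ (-γ)) : FibreOut ρ (-γ) := by
  intro j hj
  obtain ⟨m, hm⟩ : ∃ m : ℤ, -γ + (4 * m) • delta ∉ shiftCone ρ := by
    by_contra! H
    exact h' (fibreIn_of_progression (m := 0) (z := 4) (by norm_num) fun j => by
      rw [zero_add]; exact H j)
  have hl := level_of_mem_roots hγ.1
  have hr := add_four_mem_realRoots hγ (-m)
  have h1 := reflection_mem_shiftCone hs hne hr (h _)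
    (by rw [neg_add, ← neg_smul, mul_neg, neg_neg]; exact hm) (x := -γ + (4 * j) • delta)
    (by simp [hl]) hj (z := -2) (by
      rw [weightForm_add_zsmul_delta hl, weightForm_add_right, weightForm_zsmul_right,
        weightForm_delta_right, weightForm_neg_right, weightForm_add_left, weightForm_zsmul_left,
        weightForm_delta_left]
      have := hγ.2
      simp only [map_add, map_zsmul, level_delta, hl, smul_zero, add_zero, mul_zero]
      push_cast
      field_simp)
  refine h (j - 2 * m) ?_
  convert h1 using 1
  module

/-- Reflecting successively in `γ` and in its shifts `γ + 4nδ` produces translations along `δ`. One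
weight `β + 4jδ` in the cone would thus bring in the whole fibre of `β`, then that of `-β`, and
finally a nonzero multiple of `γ`. -/
theorem FibreOut.spread (hs : HasShadow ρ) (hne : (supp ρ).Nonempty) {β γ : Weight k l}
    (hγ : γ ∈ X.realRoots k l) (hβ : β ∈ X.realRoots k l) (h : FibreOut ρ γ)
    (h' : FibreOut ρ (-γ)) (hβ' : FibreIn ρ β → FibreIn ρ (-β)) (hn : weightForm γ β ≠ 0) :
    FibreOut ρ β := by
  intro j hj
  have hlγ := level_of_mem_roots hγ.1
  have hlβ := level_of_mem_roots hβ.1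
  obtain ⟨z, hz⟩ := cartan_int hs hne hγ h.notMem h'.notMem (add_four_mem_realRoots hβ j) hj
  have h1 := reflection_mem_shiftCone hs hne hγ h.notMem h'.notMem (by simp [hlβ]) hj hz
  rw [weightForm_add_right, weightForm_zsmul_right, weightForm_delta_right, hlγ, mul_zero,
    add_zero] at hz
  have hz0 : z ≠ 0 := by
    rintro rfl
    rw [Int.cast_zero, eq_comm, div_eq_zero_iff] at hz
    exact hz.elim (mul_ne_zero two_ne_zero hn) hγ.2
  -- The two reflections have opposite Cartan numbers `z` and `-z`, so their composite sends `β +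
  -- 4jδ` to `β + (4j + 4zn)δ`, a progression of step `4z ≠ 0`.
  have hU : FibreIn ρ β := by
    refine fibreIn_of_progression (m := 4 * j) (z := 4 * z) (by omega) fun n => ?_
    have h2 := reflection_mem_shiftCone hs hne (add_four_mem_realRoots hγ n) (h n)
      (by rw [neg_add, ← neg_smul, ← mul_neg]; exact h' _) (x := β + (4 * j) • delta - z • γ)
      (by simp [hlβ, hlγ]) h1 (z := -z) (by
        rw [weightForm_add_zsmul_delta hlγ, sub_eq_add_neg, weightForm_add_right,
          weightForm_add_right, weightForm_neg_right, weightForm_zsmul_right,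
          weightForm_zsmul_right, weightForm_delta_right, weightForm_add_left,
          weightForm_add_left, weightForm_zsmul_left, weightForm_zsmul_left,
          weightForm_delta_left, weightForm_delta_left]
        have := hγ.2
        simp only [map_add, map_zsmul, level_delta, hlγ, hlβ, smul_zero, add_zero, mul_zero]
        push_cast
        rw [hz]
        field_simp
        ring)
    convert h2 using 1
    module
  -- This sum is `-zγ`; by the sign of `z`, either `γ` or `-γ` would be in the cone.
  have h3 := add_mem_shiftCone h1 (hβ' hU (-(4 * j)))
  rcases lt_or_gt_of_ne hz0 with hz1 | hz1
  · refine h.notMem (mem_shiftCone_of_zsmul (z := -z) (by omega) ?_)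
    convert h3 using 1
    module
  · refine h'.notMem (mem_shiftCone_of_zsmul hz1 ?_)
    convert h3 using 1
    module

/-- Over an empty support the finiteness condition in `setB ρ` is vacuous, so all real roots would
be locally nilpotent, against properness. -/
theorem supp_nonempty (hs : HasShadow ρ) {S : Set (Weight k l)}
    (h : rootsLn ρ ∩ S ⊂ S ∩ X.realRoots k l) : (supp ρ).Nonempty := by
  by_contra H
  rw [Set.not_nonempty_iff_eq_empty] at H
  refine h.2 fun α hα => ⟨?_, hα.1⟩
  rw [hs.2.1]
  exact ⟨⟨Submodule.subset_span hα.2.1, by simp [H]⟩, hα.2⟩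

/-- If `R_0(i) ⊆ P`, a real root of `R_0(i)` whose fibre does not meet the cone of translations
forces all real roots of `R_0(i)` to act locally nilpotently. -/
theorem not_fibreOut (hs : HasShadow ρ) (hne : (supp ρ).Nonempty) {c : Fin 2}
    (hP : X.evenRoots k l c ⊆ setP ρ)
    (hln : rootsLn ρ ∩ X.evenRoots k l c ⊂ X.evenRoots k l c ∩ X.realRoots k l)
    {γ : Weight k l} (hγ : γ ∈ X.evenRoots k l c) (hγ' : γ ∈ X.realRoots k l) :
    ¬ FibreOut ρ γ := by
  intro h
  have hin : ∀ {β : Weight k l}, β ∈ X.evenRoots k l c → β ∈ X.realRoots k l → FibreIn ρ β →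
      FibreIn ρ (-β) := by
    intro β hβ hβ'
    rcases (mem_setP_iff hs hne).1 (hP hβ) with h0 | h0
    · obtain ⟨n, hn⟩ := mem_zdelta.1 h0
      exact (ne_zero_of_mem_realRoots hβ' n hn).elim
    · exact h0.2
  refine hln.2 fun β hβ => ⟨?_, hβ.1⟩
  rw [mem_rootsLn_iff hs hne hβ.2]
  refine FibreOut.notMem (evenRoots_spread (Q := FibreOut ρ) ?_ hγ hβ.1 hγ' hβ.2 h)
  intro y hy z hz hy' hz' hyz hQ
  refine hQ.spread hs hne hy' hz' (hQ.neg hs hne hy' fun h0 => ?_) (hin hz hz') hyz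
  -- Also `-y ∈ P`, so a fibre of `-y` inside the cone would bring the fibre of `y` with it.
  have := hin (neg_mem_evenRoots X c y hy) (neg_mem_realRoots hy') h0
  rw [neg_neg] at this
  exact hQ.notMem this.mem

theorem exists_real_even {α : Weight k l} (hα : α ∈ X.realRoots k l) :
    ∃ (c : Fin 2) (γ : Weight k l), γ ∈ X.evenRoots k l c ∧ γ ∈ X.realRoots k l ∧
      ((∃ n : ℤ, γ = α + n • delta) ∨
        γ = 2 • α ∧ ∀ n : ℤ, α + n • delta ∈ X.realRoots k l) := by
  obtain ⟨c, ⟨n, hn⟩ | ⟨h2, hr⟩⟩ := exists_mem_evenRoots hα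
  · refine ⟨c, _, hn, mem_realRoots_of_add hα ?_, Or.inl ⟨n, rfl⟩⟩
    rcases evenRoots_subset X c hn with h | h
    · obtain ⟨m, hm⟩ := mem_zdelta.1 h
      refine (ne_zero_of_mem_realRoots hα (m - n) ?_).elim
      rw [sub_smul, ← hm, add_sub_cancel_right]
    · exact h.1
  · refine ⟨c, _, h2, (evenRoots_subset X c h2).resolve_left fun h => ?_, Or.inr ⟨rfl, hr⟩⟩
    obtain ⟨m, hm⟩ := mem_zdelta.1 h
    have h1 : weightForm (2 • α) (2 • α) = 0 := by
      rw [hm, weightForm_zsmul_left, weightForm_delta_left]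
      simp
    rw [← natCast_zsmul, weightForm_zsmul_left, weightForm_zsmul_right] at h1
    exact hα.2 (by simpa using h1)

/-- Otherwise `not_fibreOut` applies to every nonempty `R_0(i)`. A root that is not hybrid
contradicts it: directly if it is full-locally nilpotent, and through translations along `δ` if it
is full-injective. -/
theorem not_evenRoots_subset_setP (hs : HasShadow ρ) (hne : (supp ρ).Nonempty)
    (ht : ¬ IsHybrid ρ)
    (hln : ∀ i : Fin 2, (X.evenRoots k l i).Nonempty →
      (rootsLn ρ ∩ X.evenRoots k l i).Nonempty ∧
      rootsLn ρ ∩ X.evenRoots k l i ⊂ X.evenRoots k l i ∩ X.realRoots k l) :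
    ∃ c : Fin 2, (X.evenRoots k l c).Nonempty ∧ ¬ X.evenRoots k l c ⊆ setP ρ := by
  by_contra! hP
  obtain ⟨α, hα, hfull⟩ : ∃ α ∈ X.realRoots k l, α ∈ fullLn ρ ∪ fullIn ρ := by
    by_contra! H
    exact ht (Set.Subset.antisymm Set.sdiff_subset fun α hα => ⟨hα, H α hα⟩)
  obtain ⟨c, γ, hγ, hγ', hγα⟩ := exists_real_even hα
  have hc : (X.evenRoots k l c).Nonempty := ⟨γ, hγ⟩
  obtain ⟨⟨w, hw, hwc⟩, hpr⟩ := hln c hc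
  have hout : ∀ {y : Weight k l}, y ∈ X.evenRoots k l c → y ∈ X.realRoots k l →
      ¬ FibreOut ρ y := not_fibreOut hs hne (hP c hc) hpr
  rcases hfull with hf | hf
  · refine hout hγ hγ' fun j => ?_
    rcases hγα with ⟨n, rfl⟩ | ⟨rfl, hr⟩
    · have hr := (add_four_mem_realRoots hγ' j).1
      rw [add_assoc, ← add_smul] at hr ⊢
      exact notMem_shiftCone_of_mem_fullLn hs hne hf hr
    · intro h
      refine notMem_shiftCone_of_mem_fullLn hs hne hf (hr (2 * j)).1
        (mem_shiftCone_of_nsmul two_pos ?_)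
      convert h using 1
      module
  · rw [mem_fullIn_iff hs hne hα] at hf
    have hU : FibreIn ρ γ := by
      rcases hγα with ⟨n, rfl⟩ | ⟨rfl, hr⟩
      · exact hf.shift n
      · intro n
        rw [two_smul, add_assoc]
        exact add_mem_shiftCone hf.mem (hf n)
    have hU' : FibreIn ρ (-γ) := by
      rcases (mem_setP_iff hs hne).1 (hP c hc hγ) with h0 | h0
      · obtain ⟨n, hn⟩ := mem_zdelta.1 h0
        exact (ne_zero_of_mem_realRoots hγ' n hn).elim
      · exact h0.2 hU
    -- The fibres of `γ` and `-γ` both lie in the cone, hence so does every `-4jδ`. If some `w +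
    -- 4jδ` were in the cone, the locally nilpotent root `w` would be too.
    have hw' := (mem_rootsLn_iff hs hne hw.1).1 hw
    refine hout hwc hw.1 fun j hj => hw' ?_
    have := add_mem_shiftCone (add_mem_shiftCone hU.mem (hU' (-(4 * j)))) hj
    convert this using 1
    module

end TwistedType
end

/-! ### The proposition -/

theorem proposition4p5 (X : TwistedType) (k l : ℕ) (hX : X.Admissible k l)
    {M : Type*} [AddCommGroup M] [Module ℂ M] (ρ : (X.alg k l).Rep M)
    (hw : TwistedType.IsWeightModule ρ) (hs : TwistedType.HasShadow ρ)
    (ht : ¬ TwistedType.IsHybrid ρ)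
    (hln : ∀ i : Fin 2, (X.evenRoots k l i).Nonempty →
      (TwistedType.rootsLn ρ ∩ X.evenRoots k l i).Nonempty ∧
      TwistedType.rootsLn ρ ∩ X.evenRoots k l i ⊂ X.evenRoots k l i ∩ X.realRoots k l) :
    (IsClosedSubset (TwistedType.setP ρ) ({0} ∪ X.realRoots k l ∪ X.imagRoots k l) ∧
      TwistedType.setP ρ ∪ -TwistedType.setP ρ = {0} ∪ X.realRoots k l ∪ X.imagRoots k l) ∧
    (∀ i : Fin 2, (X.evenRoots k l i).Nonempty →
      IsParabolicSubset (TwistedType.setP ρ ∩ X.evenRoots k l i) (X.evenRoots k l i) ∧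
      IsParabolicSubset (TwistedType.dotP ρ i) (X.dotEvenRoots k l i) ∧
      TwistedType.setP ρ ∩ X.evenRoots k l i =
        (TwistedType.dotP ρ i + TwistedType.zdelta k l) ∩ X.evenRoots k l i) ∧
    ∃ i : Fin 2, (X.evenRoots k l i).Nonempty ∧
      TwistedType.dotP ρ i ⊂ X.dotEvenRoots k l i := by
  -- Without real roots the module would be hybrid trivially. A real root makes some `R_0(i)`
  -- nonempty, and the hypothesis on that `R_0(i)` makes the support nonempty.
  obtain ⟨α, hα⟩ : (X.realRoots k l).Nonempty := by
    by_contra H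
    rw [Set.not_nonempty_iff_eq_empty] at H
    exact ht (by rw [TwistedType.IsHybrid, TwistedType.hybridRoots, H, Set.empty_sdiff])
  obtain ⟨i, γ, hγ, -⟩ := TwistedType.exists_real_even hα
  have hne := TwistedType.supp_nonempty hs (hln i ⟨γ, hγ⟩).2
  have hR : {0} ∪ X.realRoots k l ∪ X.imagRoots k l =
      TwistedType.zdelta k l ∪ X.realRoots k l := by
    rw [TwistedType.imagRoots_eq hX, Set.union_right_comm,
      Set.union_eq_self_of_subset_left (s := {0}) (t := TwistedType.zdelta k l)]
    rintro _ rfl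
    exact TwistedType.mem_zdelta.2 ⟨0, (zero_smul _ _).symm⟩
  -- The first claim is the general parabolicity statement applied to the whole set of real and
  -- imaginary roots.
  have hpar := TwistedType.isParabolicSubset_setP_inter hs hne (subset_refl _) fun x hx =>
    hx.imp TwistedType.neg_mem_zdelta TwistedType.neg_mem_realRoots
  rw [Set.inter_eq_left.2 (TwistedType.setP_subset hs hne)] at hpar
  rw [hR]
  refine ⟨⟨⟨hpar.1, hpar.2.2⟩, hpar.2.1⟩, fun i _ =>
    ⟨TwistedType.isParabolicSubset_setP_inter hs hne (TwistedType.evenRoots_subset X i)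
      (TwistedType.neg_mem_evenRoots X i), TwistedType.isParabolicSubset_dotP hs hne i,
      TwistedType.setP_inter_evenRoots hs hne i⟩, ?_⟩
  obtain ⟨c, hc, hP⟩ := TwistedType.not_evenRoots_subset_setP hs hne ht hln
  -- If `Ṗ_c` were all of `Ṙ_0(c)`, every element of `R_0(c)` would lie over `Ṗ_c` and hence belong
  -- to `P`.
  refine ⟨c, hc, fun x h => h.1, fun h => hP ?_⟩
  have hinter := TwistedType.setP_inter_evenRoots hs hne c
  rw [← Set.inter_eq_right, hinter, Set.inter_eq_right]
  intro y hy
  obtain ⟨x, hx, n, rfl⟩ := TwistedType.exists_dot_of_mem_evenRoots hy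
  have hn : n • TwistedType.delta ∈ TwistedType.zdelta k l := TwistedType.mem_zdelta.2 ⟨n, rfl⟩
  exact Set.add_mem_add (h ⟨hx, _, hn, hy⟩) hn
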